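/- Let $N\ge 3$, $\alpha\in(0,N)$, $V_\infty>0$, and let $I_\alpha(x)=\dfrac{\Gamma(\frac{N-\alpha}{2})}{\Gamma(\frac{\alpha}{2})2^{\alpha}\pi^{N/2}|x|^{N-\alpha}}$ ($x\in\mathbb R^N\setminus\{0\}$) be the Riesz potential. Let $f:\mathbb R\to\mathbb R$, $F(t)=\int_0^t f(s)\,ds$, and assume (F1) $f$ is continuous and there is $C_0>0$ with $|f(t)t|\le C_0\left(|t|^{(N+\alpha)/N}+|t|^{(N+\alpha)/(N-2)}\right)$ for all $t\in\mathbb R$; (F2) $F(t)=o\left(|t|^{(N+\alpha)/N}\right)$ as $t\to0$ and $F(t)=o\left(|t|^{(N+\alpha)/(N-2)}\right)$ as $|t|\to\infty$; (F3) there is $s_0>0$ with $F(s_0)\neq0$. For $u\in H^1(\mathbb R^N)$ put $$\mathcal I^\infty(u)=\frac12\int_{\mathbb R^N}\left(|\nabla u|^2+V_\infty u^2\right)dx-\frac12\int_{\mathbb R^N}(I_\alpha*F(u))F(u)\,dx,$$ $$\mathcal P^\infty(u)=\frac{N-2}{2}\|\nabla u\|_2^2+\frac{NV_\infty}{2}\|u\|_2^2-\frac{N+\alpha}{2}\int_{\mathbb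 R^N}(I_\alpha*F(u))F(u)\,dx,$$ $$\mathcal M^\infty=\{u\in H^1(\mathbb R^N)\setminus\{0\}:\mathcal P^\infty(u)=0\},\qquad \Lambda=\left\{u\in H^1(\mathbb R^N):\int_{\mathbb R^N}(I_\alpha*F(u))F(u)\,dx>0\right\},$$ and $u_t(x)=u(x/t)$ for $t>0$. Corollary 1.2. The maximum $\max_{t>0}\mathcal I^\infty(u_t)$ is attained for every $u\in\Lambda$, and the problem $-\Delta u+V_\infty u=(I_\alpha*F(u))f(u)$ in $\mathbb R^N$ has a weak solution $\bar u\in H^1(\mathbb R^N)$, i.e. $$\int_{\mathbb R^N}\left(\nabla\bar u\cdot\nabla\varphi+V_\infty\bar u\varphi\right)dx=\int_{\mathbb R^N}(I_\alpha*F(\bar u))f(\bar u)\varphi\,dx\qquad\text{for all }\varphi\in H^1(\mathbb R^N),$$ such that $$\mathcal I^\infty(\bar u)=\inf_{\mathcal M^\infty}\mathcal I^\infty=\inf_{u\in\Lambda}\max_{t>0}\mathcal I^\infty(u_t)>0.$$ -/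

import Mathlib

open MeasureTheory Filter Set
open scoped Topology ContDiff

namespace Choquard

noncomputable section

/-- The Euclidean space `ℝ^N`. -/
abbrev Space (N : ℕ) : Type := EuclideanSpace ℝ (Fin N)

/-! ### The Sobolev space `H¹(ℝ^N)` -/

/-- `G` is the weak (distributional) gradient of `u` on `ℝ^N`: both are locally integrable and
`∫ u ∂_v φ = - ∫ ⟨G, v⟩ φ` for all test functions `φ ∈ C_c^∞(ℝ^N)` and all directions `v`. -/
structure HasWeakGradient {N : ℕ} (u : Space N → ℝ) (G : Space N → Space N) : Prop where
  locallyIntegrable : LocallyIntegrable u volume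
  locallyIntegrable_grad : LocallyIntegrable G volume
  integral_eq : ∀ φ : Space N → ℝ, ContDiff ℝ ∞ φ → HasCompactSupport φ → ∀ v : Space N,
    ∫ x, u x * fderiv ℝ φ x v = -∫ x, inner ℝ (G x) v * φ x

/-- The weak gradient is unique almost everywhere. -/
theorem HasWeakGradient.ae_eq {N : ℕ} {u : Space N → ℝ} {G H : Space N → Space N}
    (hG : HasWeakGradient u G) (hH : HasWeakGradient u H) : G =ᵐ[volume] H := by
  have hd : LocallyIntegrable (fun x => G x - H x) volume :=
    hG.locallyIntegrable_grad.sub hH.locallyIntegrable_grad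
  have h0 : ∀ᵐ x ∂(volume : Measure (Space N)), G x - H x = 0 := by
    refine ae_eq_zero_of_integral_contDiff_smul_eq_zero hd ?_
    intro φ hφ hc
    have hiG : Integrable (fun x => φ x • G x) volume :=
      hG.locallyIntegrable_grad.integrable_smul_left_of_hasCompactSupport hφ.continuous hc
    have hiH : Integrable (fun x => φ x • H x) volume :=
      hH.locallyIntegrable_grad.integrable_smul_left_of_hasCompactSupport hφ.continuous hc
    simp only [smul_sub]
    rw [integral_sub hiG hiH, sub_eq_zero]
    refine ext_inner_left ℝ fun v => ?_
    rw [← integral_inner hiG, ← integral_inner hiH]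
    have e := (hG.integral_eq φ hφ hc v).symm.trans (hH.integral_eq φ hφ hc v)
    simpa [inner_smul_right, real_inner_comm, mul_comm] using neg_injective e
  filter_upwards [h0] with x hx using sub_eq_zero.mp hx

/-- `u ∈ H¹(ℝ^N)`: `u ∈ L²` and its weak gradient exists and is in `L²`. Elements of `H¹` are
represented by functions; everything below depends only on their almost-everywhere classes. -/
def MemH1 {N : ℕ} (u : Space N → ℝ) : Prop :=
  MemLp u 2 volume ∧ ∃ G : Space N → Space N, HasWeakGradient u G ∧ MemLp G 2 volume

open Classical in
/-- The weak gradient `∇u` (a representative; `0` if there is none). -/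
def weakGrad {N : ℕ} (u : Space N → ℝ) : Space N → Space N :=
  if h : ∃ G : Space N → Space N, HasWeakGradient u G then h.choose else 0

/-! ### The nonlinearity and the Riesz potential -/

/-- The Riesz kernel `I_α(x) = Γ((N-α)/2) / (Γ(α/2) 2^α π^{N/2} |x|^{N-α})`. -/
def rieszKernel (N : ℕ) (α : ℝ) (x : Space N) : ℝ :=
  Real.Gamma (((N : ℝ) - α) / 2) /
    (Real.Gamma (α / 2) * (2 : ℝ) ^ α * Real.pi ^ ((N : ℝ) / 2) * ‖x‖ ^ ((N : ℝ) - α))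

/-- `F(t) = ∫_0^t f(s) ds`. -/
def primitive (f : ℝ → ℝ) (t : ℝ) : ℝ := ∫ s in (0 : ℝ)..t, f s

/-- The function `I_α * F(u)` on `ℝ^N`. -/
def rieszConv {N : ℕ} (α : ℝ) (f : ℝ → ℝ) (u : Space N → ℝ) : Space N → ℝ :=
  convolution (rieszKernel N α) (fun y => primitive f (u y)) (ContinuousLinearMap.mul ℝ ℝ) volume

/-- The nonlocal term `∫ (I_α * F(u)) F(u) dx`. -/
def nonlocalTerm {N : ℕ} (α : ℝ) (f : ℝ → ℝ) (u : Space N → ℝ) : ℝ :=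
  ∫ x, rieszConv α f u x * primitive f (u x)

/-- (F1): `f` is continuous and `|f(t)t| ≤ C₀ (|t|^{(N+α)/N} + |t|^{(N+α)/(N-2)})`. -/
def CondF1 (N : ℕ) (α : ℝ) (f : ℝ → ℝ) : Prop :=
  Continuous f ∧ ∃ C₀ : ℝ, 0 < C₀ ∧ ∀ t : ℝ,
    |f t * t| ≤ C₀ * (|t| ^ (((N : ℝ) + α) / N) + |t| ^ (((N : ℝ) + α) / ((N : ℝ) - 2)))

/-- (F2): `F(t) = o(|t|^{(N+α)/N})` as `t → 0` and `F(t) = o(|t|^{(N+α)/(N-2)})` as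
`|t| → ∞`. -/
def CondF2 (N : ℕ) (α : ℝ) (f : ℝ → ℝ) : Prop :=
  (primitive f =o[𝓝 0] fun t : ℝ => |t| ^ (((N : ℝ) + α) / N)) ∧
    primitive f =o[atBot ⊔ atTop] fun t : ℝ => |t| ^ (((N : ℝ) + α) / ((N : ℝ) - 2))

/-- (F3): `F(s₀) ≠ 0` for some `s₀ > 0`. -/
def CondF3 (f : ℝ → ℝ) : Prop := ∃ s₀ : ℝ, 0 < s₀ ∧ primitive f s₀ ≠ 0

/-! ### The autonomous problem -/

/-- The energy `I^∞(u) = ½ ∫ (|∇u|² + V u²) - ½ ∫ (I_α * F(u)) F(u)`. -/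
def energy {N : ℕ} (α V : ℝ) (f : ℝ → ℝ) (u : Space N → ℝ) : ℝ :=
  1 / 2 * (∫ x, (‖weakGrad u x‖ ^ 2 + V * u x ^ 2)) - 1 / 2 * nonlocalTerm α f u

/-- The Pohožaev functional
`P^∞(u) = (N-2)/2 ‖∇u‖₂² + N V/2 ‖u‖₂² - (N+α)/2 ∫ (I_α * F(u)) F(u)`. -/
def pohozaev {N : ℕ} (α V : ℝ) (f : ℝ → ℝ) (u : Space N → ℝ) : ℝ :=
  ((N : ℝ) - 2) / 2 * (∫ x, ‖weakGrad u x‖ ^ 2) + (N : ℝ) * V / 2 * (∫ x, u x ^ 2)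
    - ((N : ℝ) + α) / 2 * nonlocalTerm α f u

/-- The Pohožaev manifold `M^∞ = {u ∈ H¹ \ {0} : P^∞(u) = 0}`. -/
def pohozaevManifold (N : ℕ) (α V : ℝ) (f : ℝ → ℝ) : Set (Space N → ℝ) :=
  {u | MemH1 u ∧ ¬ (u =ᵐ[volume] 0) ∧ pohozaev α V f u = 0}

/-- `Λ = {u ∈ H¹ : ∫ (I_α * F(u)) F(u) > 0}`. -/
def Lam (N : ℕ) (α : ℝ) (f : ℝ → ℝ) : Set (Space N → ℝ) :=
  {u | MemH1 u ∧ 0 < nonlocalTerm α f u}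

/-- The dilation `u_t(x) = u(x/t)`. -/
def dilate {N : ℕ} (t : ℝ) (u : Space N → ℝ) : Space N → ℝ := fun x => u (t⁻¹ • x)

/-- The set of values `{I^∞(u_t) : t > 0}`. -/
def fiberValues {N : ℕ} (α V : ℝ) (f : ℝ → ℝ) (u : Space N → ℝ) : Set ℝ :=
  (fun t : ℝ => energy α V f (dilate t u)) '' Ioi 0

/-- `u ∈ H¹(ℝ^N)` is a weak solution of `-Δu + V u = (I_α * F(u)) f(u)`:
`∫ ∇u·∇φ + V u φ = ∫ (I_α * F(u)) f(u) φ` for all `φ ∈ H¹(ℝ^N)`, the right-hand integrand being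
integrable. -/
def IsWeakSolution {N : ℕ} (α V : ℝ) (f : ℝ → ℝ) (u : Space N → ℝ) : Prop :=
  MemH1 u ∧ ∀ φ : Space N → ℝ, MemH1 φ →
    Integrable (fun x => rieszConv α f u x * f (u x) * φ x) volume ∧
    ∫ x, (inner ℝ (weakGrad u x) (weakGrad φ x) + V * u x * φ x) =
      ∫ x, rieszConv α f u x * f (u x) * φ x

end

end Choquard

open scoped ENNReal

namespace Choquard

noncomputable section

/-! ### The Riesz kernel and the Hardy–Littlewood–Sobolev inequality -/

/-! Write $a=\|\nabla u\|_2^2$, $b=V\|u\|_2^2$ and $d=\int (I_\alpha*F(u))F(u)$. Along dilations the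
energy is $\frac12(t^{N-2}a+t^Nb-t^{N+\alpha}d)$, and its $t$-derivative is the Pohožaev functional
of $u_t$ divided by $t$. If $d>0$, an intermediate value argument gives a critical $t$, and a
Bernoulli inequality (`fiber_le_of_critical`) shows that it is a global maximum. So the fibre of
every $u\in\Lambda$ meets the Pohožaev manifold exactly where its maximum is attained. Conversely
the manifold lies in $\Lambda$, so the infimum over the manifold and the minimax value agree, and it
remains to find a minimiser and show that it solves the equation.

On the manifold the nonlocal term can be eliminated, and the energy becomes `reducedEnergy`, a
positive quadratic form equivalent to the squared $H^1$ norm and decreasing under dilation by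
$t\le1$. A minimising sequence is therefore bounded. The Hardy–Littlewood–Sobolev and Sobolev
inequalities make the nonlocal term superlinear in the squared norm, hence bounded below on the
manifold. By (F2) and Lions' lemma, mass cannot vanish on all balls
(`exists_mass_of_le_nonlocalTerm`). After translation there is a weak limit $v\ne0$. With
$w_n=u_n-v$, the quadratic terms and, by a Brezis–Lieb argument, the nonlocal term split
(`tendsto_nonlocalTerm_splitting`). If $v$ had positive Pohožaev value, that of $w_n$ would
eventually be negative, so $w_n$ would already cost the whole infimum and nothing would be left for
$v$. Hence the Pohožaev value of $v$ is nonpositive, and a dilation by some $t\le1$ brings $v$ onto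
the manifold without raising the reduced energy (`exists_minimizer_of_mass`).

A minimiser $v$ is critical for the full energy, with no Lagrange multiplier. For small $s>0$ the
function $u=v+s\varphi$ has a fibre maximum at some $t$ near $1$, and $I(v_t)\le I(v)\le I(u_t)$.
Dividing $I(u_t)-I(v_t)\ge0$ by $s$ and letting $s\to0$, $t\to1$ gives $I'(v)\varphi\ge0$ for every
$\varphi$, hence equality (`deriv_nonneg_of_minimizer`). -/

theorem lintegral_comp_smul_space {N : ℕ} (g : Space N → ℝ≥0∞) {R : ℝ} (hR : 0 < R) :
    ∫⁻ x, g x = ENNReal.ofReal (R ^ N) * ∫⁻ x, g (R • x) := by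
  have h := (measurableEmbedding_const_smul₀ (α := Space N) hR.ne').lintegral_map
    (μ := volume) g
  rw [Measure.map_addHaar_smul _ hR.ne', lintegral_smul_measure, finrank_euclideanSpace_fin,
    abs_of_pos (by positivity)] at h
  rw [← h, smul_eq_mul, ← mul_assoc, ← ENNReal.ofReal_mul (by positivity),
    mul_inv_cancel₀ (by positivity), ENNReal.ofReal_one, one_mul]

/-- The normalising constant of the Riesz kernel. -/
def rieszConst (N : ℕ) (α : ℝ) : ℝ :=
  Real.Gamma (((N : ℝ) - α) / 2) /
    (Real.Gamma (α / 2) * (2 : ℝ) ^ α * Real.pi ^ ((N : ℝ) / 2))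

theorem rieszKernel_eq (N : ℕ) (α : ℝ) (x : Space N) :
    rieszKernel N α x = rieszConst N α * ‖x‖ ^ (-((N : ℝ) - α)) := by
  rw [rieszKernel, rieszConst, Real.rpow_neg (norm_nonneg _), div_mul_eq_div_div, div_eq_mul_inv _ (‖x‖ ^ _)]

theorem rieszConst_pos {N : ℕ} {α : ℝ} (hα0 : 0 < α) (hαN : α < N) : 0 < rieszConst N α := by
  have h1 : 0 < Real.Gamma (((N : ℝ) - α) / 2) := Real.Gamma_pos_of_pos (by linarith)
  have h2 : 0 < Real.Gamma (α / 2) := Real.Gamma_pos_of_pos (by linarith)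
  unfold rieszConst
  positivity

theorem rieszKernel_nonneg {N : ℕ} {α : ℝ} (hα0 : 0 < α) (hαN : α < N) (x : Space N) :
    0 ≤ rieszKernel N α x := by
  rw [rieszKernel_eq]
  have := rieszConst_pos hα0 hαN
  positivity

theorem measurable_rieszKernel (N : ℕ) (α : ℝ) : Measurable (rieszKernel N α) := by
  have : rieszKernel N α = fun x => rieszConst N α * ‖x‖ ^ (-((N : ℝ) - α)) :=
    funext (rieszKernel_eq N α)
  rw [this]
  fun_prop

theorem rieszKernel_neg {N : ℕ} {α : ℝ} (x : Space N) :
    rieszKernel N α (-x) = rieszKernel N α x := by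
  simp [rieszKernel_eq]

theorem rieszKernel_smul {N : ℕ} {α : ℝ} {R : ℝ} (hR : 0 < R) (x : Space N) :
    rieszKernel N α (R • x) = R ^ (-((N : ℝ) - α)) * rieszKernel N α x := by
  rw [rieszKernel_eq, rieszKernel_eq, norm_smul, Real.norm_of_nonneg hR.le,
    Real.mul_rpow hR.le (norm_nonneg _)]
  ring

theorem rieszKernel_pos {N : ℕ} {α : ℝ} (hα0 : 0 < α) (hαN : α < N) {x : Space N} (hx : x ≠ 0) :
    0 < rieszKernel N α x := by
  rw [rieszKernel_eq]
  have := rieszConst_pos hα0 hαN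
  have := norm_pos_iff.mpr hx
  positivity

/-- The Riesz kernel as an extended nonnegative function. -/
def rieszE (N : ℕ) (α : ℝ) (x : Space N) : ℝ≥0∞ := ENNReal.ofReal (rieszKernel N α x)

@[fun_prop]
theorem measurable_rieszE (N : ℕ) (α : ℝ) : Measurable (rieszE N α) :=
  (measurable_rieszKernel N α).ennreal_ofReal

theorem rieszE_sub_comm {N : ℕ} {α : ℝ} (x y : Space N) :
    rieszE N α (x - y) = rieszE N α (y - x) := by
  rw [rieszE, rieszE, ← rieszKernel_neg, neg_sub]

theorem rieszE_smul {N : ℕ} {α : ℝ} {R : ℝ} (hR : 0 < R) (x : Space N) :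
    rieszE N α (R • x) = ENNReal.ofReal (R ^ (-((N : ℝ) - α))) * rieszE N α x := by
  rw [rieszE, rieszKernel_smul hR, ENNReal.ofReal_mul (by positivity), rieszE]

/-- The kernel is homogeneous of degree $-(N-\alpha)$, so rescaling to the unit ball produces the
factor $R^{N-(N-\alpha)}=R^\alpha$. The unit ball integral is finite because $N-\alpha<N$. -/
theorem exists_lintegral_rieszE_ball {N : ℕ} {α : ℝ} (hN : 1 ≤ N) (hα0 : 0 < α) (hαN : α < N) :
    ∃ C : ℝ≥0∞, C ≠ ⊤ ∧ ∀ R : ℝ, 0 < R →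
      ∫⁻ y in Metric.ball (0 : Space N) R, rieszE N α y ≤ C * ENNReal.ofReal (R ^ α) := by
  refine ⟨∫⁻ y in Metric.ball (0 : Space N) 1, rieszE N α y, ?_, fun R hR => ?_⟩
  · have hi : IntegrableOn (rieszKernel N α) (Metric.ball (0 : Space N) 1) volume := by
      refine integrableOn_ball_of_norm_le_rpow (C := rieszConst N α) (α := N - α) ?_ ?_ ?_
        (measurable_rieszKernel N α).aestronglyMeasurable
      · simpa using hN
      · simp; linarith
      · refine Eventually.of_forall fun x => ?_
        rw [Real.norm_of_nonneg (rieszKernel_nonneg hα0 hαN x), rieszKernel_eq]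
    have := hi.hasFiniteIntegral
    rw [hasFiniteIntegral_iff_ofReal (Eventually.of_forall fun x => rieszKernel_nonneg hα0 hαN x)]
      at this
    exact this.ne
  · rw [← lintegral_indicator Metric.isOpen_ball.measurableSet,
      ← lintegral_indicator Metric.isOpen_ball.measurableSet, lintegral_comp_smul_space _ hR]
    have : ∀ x : Space N, (Metric.ball (0 : Space N) R).indicator (rieszE N α) (R • x) =
        ENNReal.ofReal (R ^ (-((N : ℝ) - α))) *
          (Metric.ball (0 : Space N) 1).indicator (rieszE N α) x := by
      intro x
      by_cases hx : x ∈ Metric.ball (0 : Space N) 1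
      · have h2 : R • x ∈ Metric.ball (0 : Space N) R := by
          rw [mem_ball_zero_iff] at *
          rw [norm_smul, Real.norm_of_nonneg hR.le]; nlinarith
        rw [indicator_of_mem hx, indicator_of_mem h2, rieszE_smul hR]
      · have h2 : R • x ∉ Metric.ball (0 : Space N) R := by
          rw [mem_ball_zero_iff] at *
          rw [norm_smul, Real.norm_of_nonneg hR.le]; nlinarith
        rw [indicator_of_notMem hx, indicator_of_notMem h2, mul_zero]
    simp_rw [this]
    rw [lintegral_const_mul _ ((measurable_rieszE N α).indicator
      Metric.isOpen_ball.measurableSet), ← mul_assoc, ← ENNReal.ofReal_mul (by positivity),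
      ← Real.rpow_natCast, ← Real.rpow_add hR, mul_comm]
    simp

/-- The power $2N/(N-\alpha)$ is the Hölder conjugate of `hlsExp`. It turns the kernel into a
multiple of $|x|^{-2N}$, which is integrable at infinity, and scaling gives $R^{N-2N}$. -/
theorem exists_lintegral_rieszE_compl_ball {N : ℕ} {α : ℝ} (hN : 1 ≤ N) (hα0 : 0 < α)
    (hαN : α < N) :
    ∃ C : ℝ≥0∞, C ≠ ⊤ ∧ ∀ R : ℝ, 0 < R →
      ∫⁻ y in (Metric.ball (0 : Space N) R)ᶜ, rieszE N α y ^ (2 * (N : ℝ) / (N - α)) ≤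
        C * ENNReal.ofReal (R ^ (-(N : ℝ))) := by
  have hN0 : (0 : ℝ) < N := by exact_mod_cast hN
  have hq : 0 < 2 * (N : ℝ) / (N - α) := by
    have : 0 < (N : ℝ) - α := by linarith
    positivity
  have hl : -((N : ℝ) - α) * (2 * (N : ℝ) / (N - α)) = -(2 * N) := by
    have : (N : ℝ) - α ≠ 0 := by linarith
    field_simp
  refine ⟨∫⁻ y in (Metric.ball (0 : Space N) 1)ᶜ, rieszE N α y ^ (2 * (N : ℝ) / (N - α)), ?_,
    fun R hR => ?_⟩
  · have hf := finite_integral_one_add_norm (μ := (volume : Measure (Space N))) (r := 2 * N)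
      (by simp; linarith)
    have hc := rieszConst_pos hα0 hαN
    -- Comparison with $(1+|x|)^{-2N}$: for $|x|\ge1$ one has $1+|x|\le2|x|$, whence the factor
    -- $2^{2N}$.
    refine ne_top_of_le_ne_top (ENNReal.mul_ne_top (ENNReal.ofReal_ne_top (r := rieszConst N α ^ (2 * (N : ℝ) / (N - α)) * 2 ^ (2 * (N : ℝ)))) hf.ne) ?_
    rw [← lintegral_const_mul' _ _ ENNReal.ofReal_ne_top,
      ← lintegral_indicator Metric.isOpen_ball.measurableSet.compl]
    refine lintegral_mono fun x => ?_
    refine indicator_apply_le' (fun hx => ?_) (fun _ => zero_le)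
    have hx1 : 1 ≤ ‖x‖ := by simpa using hx
    rw [rieszE, ENNReal.ofReal_rpow_of_nonneg (rieszKernel_nonneg hα0 hαN x) hq.le,
      ← ENNReal.ofReal_mul (by positivity)]
    refine ENNReal.ofReal_le_ofReal ?_
    rw [rieszKernel_eq, Real.mul_rpow hc.le (by positivity), ← Real.rpow_mul (norm_nonneg _), hl,
      mul_assoc]
    refine mul_le_mul_of_nonneg_left ?_ (by positivity)
    rw [Real.rpow_neg (by positivity), Real.rpow_neg (by positivity), ← div_eq_mul_inv,
      inv_eq_one_div, div_le_div_iff₀ (by positivity) (by positivity), one_mul,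
      ← Real.mul_rpow (by positivity) (by positivity)]
    exact Real.rpow_le_rpow (by positivity) (by linarith) (by positivity)
  · have hm := Metric.isOpen_ball (x := (0 : Space N)) (ε := R) |>.measurableSet.compl
    have hm1 := Metric.isOpen_ball (x := (0 : Space N)) (ε := 1) |>.measurableSet.compl
    rw [← lintegral_indicator hm, ← lintegral_indicator hm1, lintegral_comp_smul_space _ hR]
    have : ∀ x : Space N, (Metric.ball (0 : Space N) R)ᶜ.indicator
          (fun y => rieszE N α y ^ (2 * (N : ℝ) / (N - α))) (R • x) =
        ENNReal.ofReal (R ^ (-(2 * (N : ℝ)))) *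
          (Metric.ball (0 : Space N) 1)ᶜ.indicator
            (fun y => rieszE N α y ^ (2 * (N : ℝ) / (N - α))) x := by
      intro x
      by_cases hx : x ∈ (Metric.ball (0 : Space N) 1)ᶜ
      · have h2 : R • x ∈ (Metric.ball (0 : Space N) R)ᶜ := by
          rw [mem_compl_iff, mem_ball_zero_iff] at *
          rw [norm_smul, Real.norm_of_nonneg hR.le]; nlinarith
        rw [indicator_of_mem hx, indicator_of_mem h2, rieszE_smul hR,
          ENNReal.mul_rpow_of_nonneg _ _ hq.le, ENNReal.ofReal_rpow_of_nonneg (by positivity) hq.le,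
          ← Real.rpow_mul hR.le, hl]
      · have h2 : R • x ∉ (Metric.ball (0 : Space N) R)ᶜ := by
          rw [mem_compl_iff, mem_ball_zero_iff] at *
          rw [norm_smul, Real.norm_of_nonneg hR.le]; 
          intro h
          apply hx
          nlinarith
        rw [indicator_of_notMem hx, indicator_of_notMem h2, mul_zero]
    simp_rw [this]
    rw [lintegral_const_mul' _ _ ENNReal.ofReal_ne_top, ← mul_assoc,
      ← ENNReal.ofReal_mul (by positivity), ← Real.rpow_natCast, ← Real.rpow_add hR, mul_comm]
    refine le_of_eq ?_
    congr 3
    ring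


/-- The exponent `2N/(N+α)` of the Hardy–Littlewood–Sobolev inequality. -/
def hlsExp (N : ℕ) (α : ℝ) : ℝ := 2 * (N : ℝ) / (N + α)

theorem one_lt_hlsExp {N : ℕ} {α : ℝ} (hα0 : 0 < α) (hαN : α < N) : 1 < hlsExp N α := by
  rw [hlsExp, lt_div_iff₀ (by linarith)]
  linarith

theorem hlsExp_sub_one {N : ℕ} {α : ℝ} (hα0 : 0 < α) (hαN : α < N) :
    hlsExp N α - 1 = (N - α) / (N + α) := by
  rw [hlsExp]
  have : (N : ℝ) + α ≠ 0 := by linarith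
  field_simp
  ring

theorem hlsExp_holderConjugate {N : ℕ} {α : ℝ} (hα0 : 0 < α) (hαN : α < N) :
    (hlsExp N α).HolderConjugate (2 * (N : ℝ) / (N - α)) := by
  rw [Real.holderConjugate_iff]
  refine ⟨one_lt_hlsExp hα0 hαN, ?_⟩
  rw [hlsExp]
  have h1 : (N : ℝ) + α ≠ 0 := by linarith
  have h2 : (N : ℝ) - α ≠ 0 := by linarith
  have h3 : (N : ℝ) ≠ 0 := by linarith
  field_simp
  ring

/-- Split the potential at distance $R$ from $x$. Near $x$ the bound by $a$ gives $aR^\alpha$; far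
from $x$, Hölder gives $R^{-(N-\alpha)/2}$. The two balance at $R=a^{-2/(N+\alpha)}$. -/
theorem exists_lintegral_truncated_rieszE_le {N : ℕ} {α : ℝ} (hN : 1 ≤ N) (hα0 : 0 < α)
    (hαN : α < N) :
    ∃ C : ℝ≥0∞, C ≠ ⊤ ∧ ∀ h : Space N → ℝ≥0∞, Measurable h → ∫⁻ y, h y ^ hlsExp N α ≤ 1 →
      ∀ (a : ℝ≥0∞) (x : Space N),
        ∫⁻ y, {y | h y ≤ a}.indicator h y * rieszE N α (x - y) ≤ C * a ^ (hlsExp N α - 1) := by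
  obtain ⟨C₁, hC₁, h₁⟩ := exists_lintegral_rieszE_ball hN hα0 hαN
  obtain ⟨C₂, hC₂, h₂⟩ := exists_lintegral_rieszE_compl_ball hN hα0 hαN
  have hpq := hlsExp_holderConjugate hα0 hαN
  have hp := one_lt_hlsExp hα0 hαN
  set p := hlsExp N α with hp_def
  set q := 2 * (N : ℝ) / (N - α) with hq_def
  have hN0 : (0 : ℝ) < N := by linarith
  -- The summand $1$ keeps the constant nonzero, so that the bound is $\infty$ when $a=\infty$.
  refine ⟨C₁ + C₂ ^ (1 / q) + 1, ENNReal.add_ne_top.2 ⟨ENNReal.add_ne_top.2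
    ⟨hC₁, ENNReal.rpow_ne_top_of_nonneg (one_div_nonneg.2 hpq.symm.pos.le) hC₂⟩, by simp⟩, ?_⟩
  intro h hh hint a x
  set g : Space N → ℝ≥0∞ := {y | h y ≤ a}.indicator h with hg_def
  have hgm : Measurable g := hh.indicator (measurableSet_le hh measurable_const)
  have hga : ∀ y, g y ≤ a := fun y => indicator_apply_le' (fun hy => hy) (fun _ => zero_le)
  have hgh : ∀ y, g y ≤ h y := fun y => indicator_le_self _ _ _
  rcases eq_or_ne a 0 with rfl | ha0
  · have : ∀ y, g y = 0 := fun y => nonpos_iff_eq_zero.1 (hga y)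
    simp [this]
  rcases eq_or_ne a ⊤ with rfl | hat
  · rw [ENNReal.top_rpow_of_pos (by linarith), ENNReal.mul_top (by simp)]
    exact le_top
  obtain ⟨r, hr, rfl⟩ : ∃ r : ℝ, 0 < r ∧ a = ENNReal.ofReal r :=
    ⟨a.toReal, ENNReal.toReal_pos ha0 hat, (ENNReal.ofReal_toReal hat).symm⟩
  set R : ℝ := r ^ (-2 / (N + α)) with hR_def
  have hR : 0 < R := by positivity
  have hNα : (N : ℝ) + α ≠ 0 := by linarith
  have hNα' : (N : ℝ) - α ≠ 0 := by linarith
  have e1 : r * R ^ α = r ^ (p - 1) := by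
    rw [hR_def, ← Real.rpow_mul hr.le]
    nth_rewrite 1 [← Real.rpow_one r]
    rw [← Real.rpow_add hr, hp_def, hlsExp_sub_one hα0 hαN]
    congr 1
    field_simp
    ring
  have e2 : (R ^ (-(N : ℝ))) ^ (1 / q) = r ^ (p - 1) := by
    rw [hR_def, ← Real.rpow_mul hr.le, ← Real.rpow_mul hr.le, hp_def, hlsExp_sub_one hα0 hαN]
    congr 1
    rw [hq_def]
    field_simp
  have hsub : ∫⁻ y, g y * rieszE N α (x - y) = ∫⁻ y, g (x - y) * rieszE N α y := by
    rw [← lintegral_sub_left_eq_self _ x]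
    simp
  rw [hsub, ← lintegral_add_compl _ (Metric.isOpen_ball (x := (0 : Space N)) (ε := R)).measurableSet]
  have hA : ∫⁻ y in Metric.ball 0 R, g (x - y) * rieszE N α y ≤
      C₁ * ENNReal.ofReal r ^ (p - 1) := by
    calc _ ≤ ∫⁻ y in Metric.ball 0 R, ENNReal.ofReal r * rieszE N α y :=
          lintegral_mono fun y => mul_le_mul_left (hga _) _
      _ = ENNReal.ofReal r * ∫⁻ y in Metric.ball 0 R, rieszE N α y :=
          lintegral_const_mul _ (measurable_rieszE N α)
      _ ≤ ENNReal.ofReal r * (C₁ * ENNReal.ofReal (R ^ α)) := by gcongr; exact h₁ R hR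
      _ = C₁ * ENNReal.ofReal r ^ (p - 1) := by
          rw [mul_left_comm, ← ENNReal.ofReal_mul hr.le, e1, ENNReal.ofReal_rpow_of_pos hr]
  have hB : ∫⁻ y in (Metric.ball 0 R)ᶜ, g (x - y) * rieszE N α y ≤
      C₂ ^ (1 / q) * ENNReal.ofReal r ^ (p - 1) := by
    have hgm' : Measurable fun y => g (x - y) := hgm.comp (measurable_const.sub measurable_id)
    refine (ENNReal.lintegral_mul_le_Lp_mul_Lq _ hpq hgm'.aemeasurable
      (measurable_rieszE N α).aemeasurable).trans ?_
    have i1 : ∫⁻ y in (Metric.ball 0 R)ᶜ, g (x - y) ^ p ≤ 1 := by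
      calc _ ≤ ∫⁻ y, g (x - y) ^ p := setLIntegral_le_lintegral _ _
        _ = ∫⁻ y, g y ^ p := lintegral_sub_left_eq_self (fun y => g y ^ p) x
        _ ≤ ∫⁻ y, h y ^ p :=
            lintegral_mono fun y => ENNReal.rpow_le_rpow (hgh y) (by linarith)
        _ ≤ 1 := hint
    calc _ ≤ (1 : ℝ≥0∞) ^ (1 / p) * (C₂ * ENNReal.ofReal (R ^ (-(N : ℝ)))) ^ (1 / q) := by
          refine mul_le_mul' (ENNReal.rpow_le_rpow i1 (by positivity))
            (ENNReal.rpow_le_rpow (h₂ R hR) (one_div_nonneg.2 hpq.symm.pos.le))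
      _ = _ := by
          rw [ENNReal.one_rpow, one_mul, ENNReal.mul_rpow_of_nonneg _ _
            (one_div_nonneg.2 hpq.symm.pos.le), ENNReal.ofReal_rpow_of_pos (by positivity), e2,
            ENNReal.ofReal_rpow_of_pos hr]
  calc _ ≤ C₁ * ENNReal.ofReal r ^ (p - 1) + C₂ ^ (1 / q) * ENNReal.ofReal r ^ (p - 1) :=
        add_le_add hA hB
    _ ≤ _ := by
        rw [← add_mul]
        exact mul_le_mul_left le_self_add _

/-- The Hardy–Littlewood–Sobolev inequality in the diagonal case, normalised. -/
theorem exists_lintegral_rieszE_mul_le_of_le_one {N : ℕ} {α : ℝ} (hN : 1 ≤ N) (hα0 : 0 < α)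
    (hαN : α < N) :
    ∃ C : ℝ≥0∞, C ≠ ⊤ ∧ ∀ g h : Space N → ℝ≥0∞, Measurable g → Measurable h →
      ∫⁻ y, g y ^ hlsExp N α ≤ 1 → ∫⁻ y, h y ^ hlsExp N α ≤ 1 →
      ∫⁻ x, ∫⁻ y, rieszE N α (x - y) * g y * h x ≤ C := by
  obtain ⟨C, hC, H⟩ := exists_lintegral_truncated_rieszE_le hN hα0 hαN
  have hp := one_lt_hlsExp hα0 hαN
  set p := hlsExp N α with hp_def
  refine ⟨C + C, by simp [hC], fun g h hg hh hg1 hh1 => ?_⟩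
  -- On the region $g(y)\le h(x)$ the truncated potential with $a=h(x)$ is at most $Ch(x)^{p-1}$,
  -- and $h^{p-1}h=h^p$ has integral at most $1$. The region $h(x)\le g(y)$ is the same statement
  -- with $g$ and $h$ exchanged, after Tonelli.
  have key : ∀ g h : Space N → ℝ≥0∞, Measurable g → Measurable h →
      ∫⁻ y, g y ^ p ≤ 1 → ∫⁻ y, h y ^ p ≤ 1 →
      ∫⁻ x, ∫⁻ y, {y | g y ≤ h x}.indicator g y * rieszE N α (x - y) * h x ≤ C := by
    intro g h hg hh hg1 hh1
    calc _ ≤ ∫⁻ x, C * h x ^ p := by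
          refine lintegral_mono fun x => ?_
          have hm : Measurable fun y => {y | g y ≤ h x}.indicator g y * rieszE N α (x - y) :=
            (hg.indicator (measurableSet_le hg measurable_const)).mul
              ((measurable_rieszE N α).comp (measurable_const.sub measurable_id))
          rw [lintegral_mul_const _ hm]
          calc _ ≤ C * h x ^ (p - 1) * h x := mul_le_mul_left (H g hg hg1 (h x) x) _
            _ = C * h x ^ p := by
              rw [mul_assoc]
              congr 1
              nth_rewrite 2 [← ENNReal.rpow_one (h x)]
              rw [← ENNReal.rpow_add_of_nonneg _ _ (by linarith) (by norm_num)]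
              congr 1
              ring
      _ = C * ∫⁻ x, h x ^ p := lintegral_const_mul _ (hh.pow_const _)
      _ ≤ C * 1 := by gcongr
      _ = C := mul_one _
  have hm : Measurable fun z : Space N × Space N => g z.2 := hg.comp measurable_snd
  have hm' : Measurable fun z : Space N × Space N => h z.1 := hh.comp measurable_fst
  have hk : Measurable fun z : Space N × Space N => rieszE N α (z.1 - z.2) := by fun_prop
  have hm3 : Measurable (Function.uncurry fun x y => {y | g y ≤ h x}.indicator g y *
      rieszE N α (x - y) * h x) := by
    refine Measurable.mul (Measurable.mul ?_ hk) hm'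
    exact hm.indicator (measurableSet_le hm hm')
  have hm4 : Measurable (Function.uncurry fun x y => {x | h x ≤ g y}.indicator h x *
      rieszE N α (y - x) * g y) := by
    refine Measurable.mul (Measurable.mul ?_ (by fun_prop)) hm
    exact hm'.indicator (measurableSet_le hm' hm)
  calc ∫⁻ x, ∫⁻ y, rieszE N α (x - y) * g y * h x
      ≤ ∫⁻ x, ∫⁻ y, ({y | g y ≤ h x}.indicator g y * rieszE N α (x - y) * h x +
          {x | h x ≤ g y}.indicator h x * rieszE N α (y - x) * g y) := by
        refine lintegral_mono fun x => lintegral_mono fun y => ?_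
        rcases le_total (g y) (h x) with hle | hle
        · rw [indicator_of_mem (show y ∈ {y | g y ≤ h x} from hle)]
          refine le_add_right (le_of_eq ?_)
          ring
        · rw [indicator_of_mem (show x ∈ {x | h x ≤ g y} from hle)]
          refine le_add_left (le_of_eq ?_)
          rw [rieszE_sub_comm]
          ring
    _ = (∫⁻ x, ∫⁻ y, {y | g y ≤ h x}.indicator g y * rieszE N α (x - y) * h x) +
        ∫⁻ x, ∫⁻ y, {x | h x ≤ g y}.indicator h x * rieszE N α (y - x) * g y := by
        refine (lintegral_congr fun x => ?_).trans
          (lintegral_add_left (Measurable.lintegral_prod_right hm3) _)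
        exact lintegral_add_left (hm3.comp measurable_prodMk_left) _
    _ ≤ C + C := by
        refine add_le_add (key g h hg hh hg1 hh1) ?_
        rw [lintegral_lintegral_swap hm4.aemeasurable]
        exact key h g hh hg hh1 hg1

/-- The Hardy–Littlewood–Sobolev inequality in the diagonal case. -/
theorem exists_lintegral_rieszE_mul_le {N : ℕ} {α : ℝ} (hN : 1 ≤ N) (hα0 : 0 < α)
    (hαN : α < N) :
    ∃ C : ℝ≥0∞, C ≠ ⊤ ∧ ∀ g h : Space N → ℝ≥0∞, Measurable g → Measurable h →
      ∫⁻ y, g y ^ hlsExp N α ≠ ⊤ → ∫⁻ y, h y ^ hlsExp N α ≠ ⊤ →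
      ∫⁻ x, ∫⁻ y, rieszE N α (x - y) * g y * h x ≤
        C * (∫⁻ y, g y ^ hlsExp N α) ^ (1 / hlsExp N α) *
          (∫⁻ y, h y ^ hlsExp N α) ^ (1 / hlsExp N α) := by
  obtain ⟨C, hC, H⟩ := exists_lintegral_rieszE_mul_le_of_le_one hN hα0 hαN
  have hp := one_lt_hlsExp hα0 hαN
  set p := hlsExp N α with hp_def
  have hp0 : 0 < p := by linarith
  refine ⟨C, hC, fun g h hg hh hgt hht => ?_⟩
  have zero_of : ∀ g : Space N → ℝ≥0∞, Measurable g → ∫⁻ y, g y ^ p = 0 → g =ᵐ[volume] 0 := by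
    intro g hg h0
    rw [lintegral_eq_zero_iff (hg.pow_const _)] at h0
    filter_upwards [h0] with x hx
    simpa [hp0, hp0.not_gt] using hx
  -- Functions of norm zero cannot be normalised and are treated apart; the general case follows by
  -- homogeneity.
  rcases eq_or_ne (∫⁻ y, g y ^ p) 0 with hg0 | hg0
  · refine le_of_eq_of_le ?_ zero_le
    rw [lintegral_eq_zero_of_ae_eq_zero]
    refine Eventually.of_forall fun x => ?_
    refine lintegral_eq_zero_of_ae_eq_zero ?_
    filter_upwards [zero_of g hg hg0] with y hy
    simp [hy]
  rcases eq_or_ne (∫⁻ y, h y ^ p) 0 with hh0 | hh0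
  · refine le_of_eq_of_le ?_ zero_le
    rw [lintegral_eq_zero_of_ae_eq_zero]
    filter_upwards [zero_of h hh hh0] with y hy
    simp [hy]
  set X := (∫⁻ y, g y ^ p) ^ (1 / p) with hX
  set Y := (∫⁻ y, h y ^ p) ^ (1 / p) with hY
  have hX0 : X ≠ 0 := by simp [hX, hg0, hp0.le]
  have hY0 : Y ≠ 0 := by simp [hY, hh0, hp0.le]
  have hXt : X ≠ ⊤ := ENNReal.rpow_ne_top_of_nonneg (by positivity) hgt
  have hYt : Y ≠ ⊤ := ENNReal.rpow_ne_top_of_nonneg (by positivity) hht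
  have norm1 : ∀ (g : Space N → ℝ≥0∞), Measurable g → ∫⁻ y, g y ^ p ≠ 0 → ∫⁻ y, g y ^ p ≠ ⊤ →
      ∫⁻ y, (((∫⁻ y, g y ^ p) ^ (1 / p))⁻¹ * g y) ^ p ≤ 1 := by
    intro g hg h0 ht
    simp_rw [ENNReal.mul_rpow_of_nonneg _ _ hp0.le]
    rw [lintegral_const_mul _ (hg.pow_const _), ENNReal.inv_rpow, ← ENNReal.rpow_mul,
      one_div_mul_cancel hp0.ne', ENNReal.rpow_one, ENNReal.inv_mul_cancel h0 ht]
  have := H (fun y => X⁻¹ * g y) (fun y => Y⁻¹ * h y) (hg.const_mul _) (hh.const_mul _)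
    (norm1 g hg hg0 hgt) (norm1 h hh hh0 hht)
  have e : ∀ x y, rieszE N α (x - y) * (X⁻¹ * g y) * (Y⁻¹ * h x) =
      (X⁻¹ * Y⁻¹) * (rieszE N α (x - y) * g y * h x) := fun x y => by ring
  simp_rw [e] at this
  have hXY : X⁻¹ * Y⁻¹ ≠ ⊤ := ENNReal.mul_ne_top (by simpa) (by simpa)
  simp_rw [lintegral_const_mul' _ _ hXY] at this
  calc _ = (X * X⁻¹) * (Y * Y⁻¹) * ∫⁻ x, ∫⁻ y, rieszE N α (x - y) * g y * h x := by
        rw [ENNReal.mul_inv_cancel hX0 hXt, ENNReal.mul_inv_cancel hY0 hYt]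
        simp
    _ = X * Y * (X⁻¹ * Y⁻¹ * ∫⁻ x, ∫⁻ y, rieszE N α (x - y) * g y * h x) := by ring
    _ ≤ X * Y * C := by gcongr
    _ = C * X * Y := by ring


/-! ### The bilinear form of the Riesz potential -/

/-- The exponent `2N/(N+α)` as an extended nonnegative real. -/
def hlsE (N : ℕ) (α : ℝ) : ℝ≥0∞ := ENNReal.ofReal (hlsExp N α)

theorem hlsE_ne_top (N : ℕ) (α : ℝ) : hlsE N α ≠ ⊤ := ENNReal.ofReal_ne_top

theorem one_le_hlsE {N : ℕ} {α : ℝ} (hα0 : 0 < α) (hαN : α < N) : 1 ≤ hlsE N α := by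
  rw [hlsE, ENNReal.one_le_ofReal]
  exact (one_lt_hlsExp hα0 hαN).le

theorem hlsE_ne_zero {N : ℕ} {α : ℝ} (hα0 : 0 < α) (hαN : α < N) : hlsE N α ≠ 0 :=
  (zero_lt_one.trans_le (one_le_hlsE hα0 hαN)).ne'

theorem hlsE_toReal {N : ℕ} {α : ℝ} (hα0 : 0 < α) (hαN : α < N) :
    (hlsE N α).toReal = hlsExp N α :=
  ENNReal.toReal_ofReal (by linarith [one_lt_hlsExp hα0 hαN])

theorem abs_integral_le_toReal_lintegral_enorm {X : Type*} [MeasurableSpace X] {μ : Measure X}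
    (g : X → ℝ) : |∫ x, g x ∂μ| ≤ (∫⁻ x, ‖g x‖ₑ ∂μ).toReal := by
  have := norm_integral_le_lintegral_norm (μ := μ) g
  rw [← Real.norm_eq_abs]
  simpa only [ofReal_norm] using this

/-- The bilinear form `(g, h) ↦ ∫∫ I_α(x - y) g(y) h(x) dx dy`. -/
def rieszForm {N : ℕ} (α : ℝ) (g h : Space N → ℝ) : ℝ :=
  ∫ z : Space N × Space N, rieszKernel N α (z.1 - z.2) * g z.2 * h z.1

section

variable {N : ℕ} {α : ℝ}

theorem aestronglyMeasurable_rieszForm {g h : Space N → ℝ} (hg : AEStronglyMeasurable g volume)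
    (hh : AEStronglyMeasurable h volume) :
    AEStronglyMeasurable
      (fun z : Space N × Space N => rieszKernel N α (z.1 - z.2) * g z.2 * h z.1) volume := by
  have hk : Measurable fun z : Space N × Space N => rieszKernel N α (z.1 - z.2) :=
    (measurable_rieszKernel N α).comp (measurable_fst.sub measurable_snd)
  exact (hk.aestronglyMeasurable.mul hg.comp_snd).mul hh.comp_fst

theorem exists_lintegral_enorm_rieszForm_le (hN : 1 ≤ N) (hα0 : 0 < α) (hαN : α < N) :
    ∃ C : ℝ≥0∞, C ≠ ⊤ ∧ ∀ g h : Space N → ℝ, MemLp g (hlsE N α) volume →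
      MemLp h (hlsE N α) volume →
      ∫⁻ z : Space N × Space N, ‖rieszKernel N α (z.1 - z.2) * g z.2 * h z.1‖ₑ ≤
        C * eLpNorm g (hlsE N α) volume * eLpNorm h (hlsE N α) volume := by
  obtain ⟨C, hC, H⟩ := exists_lintegral_rieszE_mul_le hN hα0 hαN
  have main : ∀ g h : Space N → ℝ, StronglyMeasurable g → StronglyMeasurable h →
      MemLp g (hlsE N α) volume → MemLp h (hlsE N α) volume →
      ∫⁻ z : Space N × Space N, ‖rieszKernel N α (z.1 - z.2) * g z.2 * h z.1‖ₑ ≤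
        C * eLpNorm g (hlsE N α) volume * eLpNorm h (hlsE N α) volume := by
    intro g h hgm hhm hg hh
    have := H (fun x => ‖g x‖ₑ) (fun x => ‖h x‖ₑ) hgm.measurable.enorm hhm.measurable.enorm
    have fin : ∀ g : Space N → ℝ, MemLp g (hlsE N α) volume →
        ∫⁻ y, ‖g y‖ₑ ^ hlsExp N α ≠ ⊤ := by
      intro g hg
      have := lintegral_rpow_enorm_lt_top_of_eLpNorm_lt_top (hlsE_ne_zero hα0 hαN)
        (hlsE_ne_top N α) hg.2
      rw [hlsE_toReal hα0 hαN] at this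
      exact this.ne
    rw [eLpNorm_eq_lintegral_rpow_enorm_toReal (hlsE_ne_zero hα0 hαN) (hlsE_ne_top N α),
      eLpNorm_eq_lintegral_rpow_enorm_toReal (hlsE_ne_zero hα0 hαN) (hlsE_ne_top N α),
      hlsE_toReal hα0 hαN]
    refine le_of_eq_of_le ?_ (this (fin g hg) (fin h hh))
    rw [Measure.volume_eq_prod, lintegral_prod _
      (aestronglyMeasurable_rieszForm hg.1 hh.1).enorm]
    refine lintegral_congr fun x => lintegral_congr fun y => ?_
    rw [enorm_mul, enorm_mul, rieszE, Real.enorm_of_nonneg (rieszKernel_nonneg hα0 hαN _)]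
  -- Null sets in either factor pull back to null sets of the product, so passing to measurable
  -- representatives changes neither side.
  refine ⟨C, hC, fun g h hg hh => ?_⟩
  have := main (hg.1.mk g) (hh.1.mk h) hg.1.stronglyMeasurable_mk hh.1.stronglyMeasurable_mk
    ((memLp_congr_ae hg.1.ae_eq_mk).1 hg) ((memLp_congr_ae hh.1.ae_eq_mk).1 hh)
  rw [eLpNorm_congr_ae hg.1.ae_eq_mk, eLpNorm_congr_ae hh.1.ae_eq_mk]
  refine le_of_eq_of_le (lintegral_congr_ae ?_) this
  have e1 : ∀ᵐ z : Space N × Space N, g z.2 = hg.1.mk g z.2 :=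
    (Measure.quasiMeasurePreserving_snd (μ := (volume : Measure (Space N)))).ae hg.1.ae_eq_mk
  have e2 : ∀ᵐ z : Space N × Space N, h z.1 = hh.1.mk h z.1 :=
    (Measure.quasiMeasurePreserving_fst (ν := (volume : Measure (Space N)))).ae hh.1.ae_eq_mk
  filter_upwards [e1, e2] with z h1 h2
  rw [h1, h2]

theorem integrable_rieszForm (hN : 1 ≤ N) (hα0 : 0 < α) (hαN : α < N) {g h : Space N → ℝ}
    (hg : MemLp g (hlsE N α) volume) (hh : MemLp h (hlsE N α) volume) :
    Integrable (fun z : Space N × Space N => rieszKernel N α (z.1 - z.2) * g z.2 * h z.1) := by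
  obtain ⟨C, hC, H⟩ := exists_lintegral_enorm_rieszForm_le hN hα0 hαN
  refine ⟨aestronglyMeasurable_rieszForm hg.1 hh.1, ?_⟩
  exact (H g h hg hh).trans_lt (ENNReal.mul_lt_top (ENNReal.mul_lt_top hC.lt_top hg.2) hh.2)

theorem exists_abs_rieszForm_le (hN : 1 ≤ N) (hα0 : 0 < α) (hαN : α < N) :
    ∃ C : ℝ, 0 < C ∧ ∀ g h : Space N → ℝ, MemLp g (hlsE N α) volume →
      MemLp h (hlsE N α) volume →
      |rieszForm α g h| ≤
        C * (eLpNorm g (hlsE N α) volume).toReal * (eLpNorm h (hlsE N α) volume).toReal := by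
  obtain ⟨C, hC, H⟩ := exists_lintegral_enorm_rieszForm_le hN hα0 hαN
  refine ⟨C.toReal + 1, by positivity, fun g h hg hh => ?_⟩
  have h1 : |rieszForm α g h| ≤ (∫⁻ z : Space N × Space N,
      ‖rieszKernel N α (z.1 - z.2) * g z.2 * h z.1‖ₑ).toReal := by
    exact abs_integral_le_toReal_lintegral_enorm _
  have h2 := ENNReal.toReal_mono
    (ENNReal.mul_ne_top (ENNReal.mul_ne_top hC hg.2.ne) hh.2.ne) (H g h hg hh)
  rw [ENNReal.toReal_mul, ENNReal.toReal_mul] at h2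
  refine h1.trans (h2.trans ?_)
  gcongr
  linarith

theorem rieszForm_comm (g h : Space N → ℝ) : rieszForm α g h = rieszForm α h g := by
  rw [rieszForm, rieszForm, Measure.volume_eq_prod, ← integral_prod_swap]
  refine integral_congr_ae (Eventually.of_forall fun z => ?_)
  simp only [Prod.fst_swap, Prod.snd_swap]
  rw [← rieszKernel_neg, neg_sub]
  ring

theorem rieszForm_add_left (hN : 1 ≤ N) (hα0 : 0 < α) (hαN : α < N) {g g' h : Space N → ℝ}
    (hg : MemLp g (hlsE N α) volume) (hg' : MemLp g' (hlsE N α) volume)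
    (hh : MemLp h (hlsE N α) volume) :
    rieszForm α (g + g') h = rieszForm α g h + rieszForm α g' h := by
  rw [rieszForm, rieszForm, rieszForm, ← integral_add (integrable_rieszForm hN hα0 hαN hg hh)
    (integrable_rieszForm hN hα0 hαN hg' hh)]
  refine integral_congr_ae (Eventually.of_forall fun z => ?_)
  simp only [Pi.add_apply]
  ring

theorem rieszForm_smul_left (c : ℝ) (g h : Space N → ℝ) :
    rieszForm α (c • g) h = c * rieszForm α g h := by
  rw [rieszForm, rieszForm, ← integral_const_mul]
  refine integral_congr_ae (Eventually.of_forall fun z => ?_)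
  simp only [Pi.smul_apply, smul_eq_mul]
  ring

theorem rieszForm_sub_left (hN : 1 ≤ N) (hα0 : 0 < α) (hαN : α < N) {g g' h : Space N → ℝ}
    (hg : MemLp g (hlsE N α) volume) (hg' : MemLp g' (hlsE N α) volume)
    (hh : MemLp h (hlsE N α) volume) :
    rieszForm α (g - g') h = rieszForm α g h - rieszForm α g' h := by
  have : g - g' = g + (-1 : ℝ) • g' := by ext x; simp [sub_eq_add_neg]
  rw [this, rieszForm_add_left hN hα0 hαN hg (hg'.const_smul _) hh, rieszForm_smul_left]
  ring

theorem rieszForm_add_right (hN : 1 ≤ N) (hα0 : 0 < α) (hαN : α < N) {g h h' : Space N → ℝ}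
    (hg : MemLp g (hlsE N α) volume) (hh : MemLp h (hlsE N α) volume)
    (hh' : MemLp h' (hlsE N α) volume) :
    rieszForm α g (h + h') = rieszForm α g h + rieszForm α g h' := by
  rw [rieszForm_comm, rieszForm_add_left hN hα0 hαN hh hh' hg, rieszForm_comm h, rieszForm_comm h']

theorem rieszForm_sub_right (hN : 1 ≤ N) (hα0 : 0 < α) (hαN : α < N) {g h h' : Space N → ℝ}
    (hg : MemLp g (hlsE N α) volume) (hh : MemLp h (hlsE N α) volume)
    (hh' : MemLp h' (hlsE N α) volume) :
    rieszForm α g (h - h') = rieszForm α g h - rieszForm α g h' := by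
  rw [rieszForm_comm, rieszForm_sub_left hN hα0 hαN hh hh' hg, rieszForm_comm h, rieszForm_comm h']

theorem rieszForm_congr {g g' h h' : Space N → ℝ} (hg : g =ᵐ[volume] g') (hh : h =ᵐ[volume] h') :
    rieszForm α g h = rieszForm α g' h' := by
  have e1 : ∀ᵐ z : Space N × Space N, g z.2 = g' z.2 :=
    (Measure.quasiMeasurePreserving_snd (μ := (volume : Measure (Space N)))).ae hg
  have e2 : ∀ᵐ z : Space N × Space N, h z.1 = h' z.1 :=
    (Measure.quasiMeasurePreserving_fst (ν := (volume : Measure (Space N)))).ae hh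
  refine integral_congr_ae ?_
  filter_upwards [e1, e2] with z h1 h2
  rw [h1, h2]

theorem convolution_rieszKernel (g : Space N → ℝ) (x : Space N) :
    convolution (rieszKernel N α) g (ContinuousLinearMap.mul ℝ ℝ) volume x =
      ∫ y, rieszKernel N α (x - y) * g y := by
  rw [convolution_eq_swap]
  rfl

theorem integrable_convolution_rieszKernel_mul (hN : 1 ≤ N) (hα0 : 0 < α) (hαN : α < N)
    {g h : Space N → ℝ} (hg : MemLp g (hlsE N α) volume) (hh : MemLp h (hlsE N α) volume) :
    Integrable (fun x =>
      convolution (rieszKernel N α) g (ContinuousLinearMap.mul ℝ ℝ) volume x * h x) := by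
  have := (integrable_rieszForm hN hα0 hαN hg hh).integral_prod_left
  refine this.congr (Eventually.of_forall fun x => ?_)
  simp only [convolution_rieszKernel]
  rw [integral_mul_const]

theorem integral_convolution_rieszKernel_mul (hN : 1 ≤ N) (hα0 : 0 < α) (hαN : α < N)
    {g h : Space N → ℝ} (hg : MemLp g (hlsE N α) volume) (hh : MemLp h (hlsE N α) volume) :
    ∫ x, convolution (rieszKernel N α) g (ContinuousLinearMap.mul ℝ ℝ) volume x * h x =
      rieszForm α g h := by
  have := integral_prod _ (integrable_rieszForm hN hα0 hαN hg hh)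
  rw [rieszForm, Measure.volume_eq_prod, this]
  refine integral_congr_ae (Eventually.of_forall fun x => ?_)
  simp only [convolution_rieszKernel]
  rw [integral_mul_const]

theorem tendsto_rieszForm (hN : 1 ≤ N) (hα0 : 0 < α) (hαN : α < N) {ι : Type*} {l : Filter ι}
    {g h : ι → Space N → ℝ} {g₀ h₀ : Space N → ℝ}
    (hg : ∀ n, MemLp (g n) (hlsE N α) volume) (hh : ∀ n, MemLp (h n) (hlsE N α) volume)
    (hg₀ : MemLp g₀ (hlsE N α) volume) (hh₀ : MemLp h₀ (hlsE N α) volume)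
    (hgl : Tendsto (fun n => eLpNorm (g n - g₀) (hlsE N α) volume) l (𝓝 0))
    (hhl : Tendsto (fun n => eLpNorm (h n - h₀) (hlsE N α) volume) l (𝓝 0)) :
    Tendsto (fun n => rieszForm α (g n) (h n)) l (𝓝 (rieszForm α g₀ h₀)) := by
  obtain ⟨C, hC, H⟩ := exists_abs_rieszForm_le hN hα0 hαN
  have toR : ∀ {k : ι → Space N → ℝ} {k₀ : Space N → ℝ},
      Tendsto (fun n => eLpNorm (k n - k₀) (hlsE N α) volume) l (𝓝 0) →
      Tendsto (fun n => (eLpNorm (k n - k₀) (hlsE N α) volume).toReal) l (𝓝 0) := fun h => by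
    exact (ENNReal.tendsto_toReal ENNReal.zero_ne_top).comp h
  rw [tendsto_iff_norm_sub_tendsto_zero]
  set X := fun n => (eLpNorm (g n - g₀) (hlsE N α) volume).toReal with hX
  set Y := fun n => (eLpNorm (h n - h₀) (hlsE N α) volume).toReal with hY
  set a := (eLpNorm g₀ (hlsE N α) volume).toReal
  set b := (eLpNorm h₀ (hlsE N α) volume).toReal
  have hlim : Tendsto (fun n => C * X n * Y n + C * X n * b + C * a * Y n) l (𝓝 0) := by
    have := (((toR hgl).const_mul C).mul (toR hhl)).add
      ((((toR hgl).const_mul C).mul_const b)) |>.add ((toR hhl).const_mul (C * a))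
    simpa using this
  refine squeeze_zero (fun n => norm_nonneg _) (fun n => ?_) hlim
  -- Bilinearity reduces the difference to three terms, each with at least one factor tending to
  -- zero in norm.
  have e : rieszForm α (g n) (h n) - rieszForm α g₀ h₀ =
      rieszForm α (g n - g₀) (h n - h₀) + rieszForm α (g n - g₀) h₀ +
        rieszForm α g₀ (h n - h₀) := by
    rw [rieszForm_sub_left hN hα0 hαN (hg n) hg₀ ((hh n).sub hh₀),
      rieszForm_sub_left hN hα0 hαN (hg n) hg₀ hh₀, rieszForm_sub_right hN hα0 hαN (hg n) (hh n) hh₀,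
      rieszForm_sub_right hN hα0 hαN hg₀ (hh n) hh₀]
    ring
  rw [e, Real.norm_eq_abs]
  refine (abs_add_three _ _ _).trans ?_
  exact add_le_add (add_le_add (H _ _ ((hg n).sub hg₀) ((hh n).sub hh₀))
    (H _ _ ((hg n).sub hg₀) hh₀)) (H _ _ hg₀ ((hh n).sub hh₀))

end

/-! ### Weak convergence and the Riesz potential -/

/-- A sequence bounded in `L^p` and converging to `0` almost everywhere converges weakly. -/
theorem tendsto_lintegral_mul_of_bounded_of_ae_tendsto {X : Type*} [MeasurableSpace X]
    {μ : Measure X} {p q : ℝ} (hpq : p.HolderConjugate q) {g : ℕ → X → ℝ≥0∞} {H : X → ℝ≥0∞}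
    (hg : ∀ n, AEMeasurable (g n) μ) (hH : AEMeasurable H μ) {B : ℝ≥0∞} (hB : B ≠ ⊤)
    (hgB : ∀ n, ∫⁻ x, g n x ^ p ∂μ ≤ B) (hHq : ∫⁻ x, H x ^ q ∂μ ≠ ⊤)
    (hlim : ∀ᵐ x ∂μ, Tendsto (fun n => g n x) atTop (𝓝 0)) :
    Tendsto (fun n => ∫⁻ x, g n x * H x ∂μ) atTop (𝓝 0) := by
  have hp := hpq.lt
  have hq := hpq.symm.lt
  have hpq1 : (q - 1) * (p - 1) = 1 := by
    have := hpq.mul_eq_add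
    linarith
  have hHfin : ∀ᵐ x ∂μ, H x ≠ ⊤ := by
    filter_upwards [ae_lt_top' (hH.pow_const q) hHq] with x hx h
    rw [h, ENNReal.top_rpow_of_pos (by linarith)] at hx
    exact lt_irrefl _ hx
  -- Where $g_n$ exceeds $MH^{q-1}$, the identity $(q-1)(p-1)=1$ gives $H\le M^{-(p-1)}g_n^{p-1}$.
  -- That part of the integral is at most $M^{-(p-1)}B$, uniformly in $n$. The truncated part is
  -- dominated by $MH^q$.
  have split : ∀ (M : ℝ), 0 < M → ∀ n x, g n x * H x ≤
      min (g n x) (ENNReal.ofReal M * H x ^ (q - 1)) * H x +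
        ENNReal.ofReal (M ^ (-(p - 1))) * g n x ^ p := by
    intro M hM n x
    rcases le_total (g n x) (ENNReal.ofReal M * H x ^ (q - 1)) with h | h
    · rw [min_eq_left h]
      exact le_self_add
    · refine le_add_left ?_
      have h1 : H x ≤ ENNReal.ofReal (M ^ (-(p - 1))) * g n x ^ (p - 1) := by
        have := ENNReal.rpow_le_rpow h (show 0 ≤ p - 1 by linarith)
        rw [ENNReal.mul_rpow_of_nonneg _ _ (by linarith), ← ENNReal.rpow_mul, hpq1,
          ENNReal.rpow_one, ENNReal.ofReal_rpow_of_pos hM] at this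
        calc H x = ENNReal.ofReal (M ^ (-(p - 1))) * (ENNReal.ofReal (M ^ (p - 1)) * H x) := by
              rw [← mul_assoc, ← ENNReal.ofReal_mul (by positivity), ← Real.rpow_add hM]
              simp
          _ ≤ _ := by gcongr
      calc g n x * H x ≤ g n x * (ENNReal.ofReal (M ^ (-(p - 1))) * g n x ^ (p - 1)) := by gcongr
        _ = ENNReal.ofReal (M ^ (-(p - 1))) * g n x ^ p := by
          rw [mul_left_comm]
          congr 1
          nth_rewrite 1 [← ENNReal.rpow_one (g n x)]
          rw [← ENNReal.rpow_add_of_nonneg _ _ (by norm_num) (by linarith)]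
          congr 1
          ring
  have dom : ∀ (M : ℝ), 0 < M →
      Tendsto (fun n => ∫⁻ x, min (g n x) (ENNReal.ofReal M * H x ^ (q - 1)) * H x ∂μ) atTop
        (𝓝 0) := by
    intro M hM
    have hb : ∀ n, AEMeasurable (fun x => min (g n x) (ENNReal.ofReal M * H x ^ (q - 1)) * H x) μ :=
      fun n => ((hg n).inf ((hH.pow_const _).const_mul _)).mul hH
    have := tendsto_lintegral_of_dominated_convergence' (μ := μ) (F := fun n x =>
      min (g n x) (ENNReal.ofReal M * H x ^ (q - 1)) * H x) (f := fun _ => 0)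
      (fun x => ENNReal.ofReal M * H x ^ q) hb ?_ ?_ ?_
    · simpa using this
    · intro n
      refine Eventually.of_forall fun x => ?_
      calc _ ≤ ENNReal.ofReal M * H x ^ (q - 1) * H x := mul_le_mul_left (min_le_right _ _) _
        _ = ENNReal.ofReal M * H x ^ q := by
          rw [mul_assoc]
          congr 1
          nth_rewrite 2 [← ENNReal.rpow_one (H x)]
          rw [← ENNReal.rpow_add_of_nonneg _ _ (by linarith) (by norm_num)]
          congr 1
          ring
    · rw [lintegral_const_mul'' _ (hH.pow_const _)]
      exact ENNReal.mul_ne_top ENNReal.ofReal_ne_top hHq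
    · filter_upwards [hlim, hHfin] with x hx hf
      have h1 : Tendsto (fun n => g n x * H x) atTop (𝓝 0) := by
        simpa using ENNReal.Tendsto.mul_const hx (Or.inr hf)
      refine tendsto_of_tendsto_of_tendsto_of_le_of_le tendsto_const_nhds h1
        (fun n => zero_le) (fun n => ?_)
      exact mul_le_mul_left (min_le_left _ _) _
  rw [ENNReal.tendsto_nhds_zero]
  intro ε hε
  obtain ⟨M, hM, hMB⟩ : ∃ M : ℝ, 0 < M ∧ ENNReal.ofReal (M ^ (-(p - 1))) * B ≤ ε / 2 := by
    have h1 : Tendsto (fun M : ℝ => ENNReal.ofReal (M ^ (-(p - 1))) * B) atTop (𝓝 0) := by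
      have := ENNReal.tendsto_ofReal (tendsto_rpow_neg_atTop (show 0 < p - 1 by linarith))
      simpa using ENNReal.Tendsto.mul_const this (Or.inr hB)
    have h2 := (ENNReal.tendsto_nhds_zero.1 h1 (ε / 2) (ENNReal.half_pos hε.ne'))
    obtain ⟨M, hM⟩ := (h2.and (eventually_gt_atTop 0)).exists
    exact ⟨M, hM.2, hM.1⟩
  filter_upwards [ENNReal.tendsto_nhds_zero.1 (dom M hM) (ε / 2) (ENNReal.half_pos hε.ne')] with n hn
  calc ∫⁻ x, g n x * H x ∂μ ≤ ∫⁻ x, (min (g n x) (ENNReal.ofReal M * H x ^ (q - 1)) * H x +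
        ENNReal.ofReal (M ^ (-(p - 1))) * g n x ^ p) ∂μ := lintegral_mono (split M hM n)
    _ = ∫⁻ x, min (g n x) (ENNReal.ofReal M * H x ^ (q - 1)) * H x ∂μ +
        ENNReal.ofReal (M ^ (-(p - 1))) * ∫⁻ x, g n x ^ p ∂μ := by
      rw [lintegral_add_right' _ (((hg n).pow_const _).const_mul _),
        lintegral_const_mul'' _ ((hg n).pow_const _)]
    _ ≤ ε / 2 + ε / 2 := by
      refine add_le_add hn (le_trans ?_ hMB)
      gcongr
      exact hgB n
    _ = ε := ENNReal.add_halves ε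

/-- Duality: a function pairing boundedly with `L^p` is in `L^q`. -/
theorem lintegral_rpow_lt_top_of_pairing_le {N : ℕ} {p q : ℝ} (hpq : p.HolderConjugate q)
    {H : Space N → ℝ≥0∞} (hH : Measurable H) {C : ℝ≥0∞} (hC : C ≠ ⊤)
    (hpair : ∀ g : Space N → ℝ≥0∞, Measurable g → ∫⁻ x, g x ^ p ≠ ⊤ →
      ∫⁻ x, g x * H x ≤ C * (∫⁻ x, g x ^ p) ^ (1 / p)) :
    ∫⁻ x, H x ^ q ≠ ⊤ := by
  have hp := hpq.lt
  have hq := hpq.symm.lt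
  have hpq1 : (q - 1) * p = q := by
    have := hpq.mul_eq_add
    linarith
  -- Testing with $H^{q-1}$ itself would need the conclusion. The truncations have finite $q$-th
  -- power integral $X$, so $X\le CX^{1/p}$ may be divided by $X^{1/p}$, and Fatou's lemma removes
  -- the truncation.
  set T : ℕ → Space N → ℝ≥0∞ := fun n =>
    (Metric.ball (0 : Space N) n).indicator fun x => min (H x) n with hT
  have hTm : ∀ n, Measurable (T n) := fun n =>
    (hH.min measurable_const).indicator Metric.isOpen_ball.measurableSet
  have hTH : ∀ n x, T n x ≤ H x := fun n x =>
    indicator_apply_le' (fun _ => min_le_left _ _) (fun _ => zero_le)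
  have hTfin : ∀ n, ∫⁻ x, T n x ^ q ≠ ⊤ := by
    intro n
    have : ∀ x, T n x ^ q ≤ (Metric.ball (0 : Space N) n).indicator (fun _ => (n : ℝ≥0∞) ^ q) x := by
      intro x
      by_cases hx : x ∈ Metric.ball (0 : Space N) n
      · simp only [hT, indicator_of_mem hx]
        exact ENNReal.rpow_le_rpow (min_le_right _ _) (by linarith)
      · simp only [hT, indicator_of_notMem hx]
        rw [ENNReal.zero_rpow_of_pos (by linarith)]
    refine ne_top_of_le_ne_top ?_ (lintegral_mono this)
    rw [lintegral_indicator Metric.isOpen_ball.measurableSet, setLIntegral_const]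
    exact ENNReal.mul_ne_top (ENNReal.rpow_ne_top_of_nonneg (by linarith) (by simp))
      measure_ball_lt_top.ne
  have hbound : ∀ n, ∫⁻ x, T n x ^ q ≤ C ^ q := by
    intro n
    set X := ∫⁻ x, T n x ^ q with hX
    have e : ∫⁻ x, (T n x ^ (q - 1)) ^ p = X := by
      simp_rw [← ENNReal.rpow_mul, hpq1, hX]
    have h1 : X ≤ C * X ^ (1 / p) := by
      have := hpair (fun x => T n x ^ (q - 1)) ((hTm n).pow_const _) (by rw [e]; exact hTfin n)
      rw [e] at this
      refine le_trans (lintegral_mono fun x => ?_) this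
      calc T n x ^ q = T n x ^ (q - 1) * T n x := by
            nth_rewrite 3 [← ENNReal.rpow_one (T n x)]
            rw [← ENNReal.rpow_add_of_nonneg _ _ (by linarith) (by norm_num)]
            congr 1
            ring
        _ ≤ _ := by gcongr; exact hTH n x
    rcases eq_or_ne X 0 with h0 | h0
    · rw [h0]; exact zero_le
    have h2 : X ^ (1 / q) ≤ C := by
      have hX1 : X = X ^ (1 / q) * X ^ (1 / p) := by
        rw [← ENNReal.rpow_add _ _ h0 (hTfin n)]
        have := hpq.inv_add_inv_eq_one
        rw [one_div, one_div, add_comm, this, ENNReal.rpow_one]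
      have hne : X ^ (1 / p) ≠ 0 := by
        simp [h0, hpq.pos.le]
      have hnt : X ^ (1 / p) ≠ ⊤ := ENNReal.rpow_ne_top_of_nonneg hpq.one_div_nonneg (hTfin n)
      rw [hX1] at h1
      have h3 : X ^ (1 / q) * X ^ (1 / p) ≤ C * X ^ (1 / p) := by
        convert h1 using 2
        exact congrArg (· ^ (1 / p)) hX1
      exact (ENNReal.mul_le_mul_iff_left hne hnt).1 h3
    calc X = (X ^ (1 / q)) ^ q := by
          rw [← ENNReal.rpow_mul, one_div_mul_cancel hpq.symm.pos.ne', ENNReal.rpow_one]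
      _ ≤ C ^ q := ENNReal.rpow_le_rpow h2 hpq.symm.pos.le
  have hlim : ∀ x, Tendsto (fun n => T n x ^ q) atTop (𝓝 (H x ^ q)) := by
    intro x
    refine ((ENNReal.continuous_rpow_const).tendsto _).comp ?_
    have h1 : Tendsto (fun n : ℕ => min (H x) (n : ℝ≥0∞)) atTop (𝓝 (min (H x) ⊤)) :=
      tendsto_const_nhds.min ENNReal.tendsto_nat_nhds_top
    rw [min_eq_left le_top] at h1
    refine h1.congr' ?_
    obtain ⟨n₀, hn₀⟩ := exists_nat_gt ‖x‖
    filter_upwards [eventually_ge_atTop n₀] with n hn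
    have : x ∈ Metric.ball (0 : Space N) n := by
      rw [mem_ball_zero_iff]
      exact hn₀.trans_le (by exact_mod_cast hn)
    simp only [hT, indicator_of_mem this]
  refine ne_top_of_le_ne_top (ENNReal.rpow_ne_top_of_nonneg hpq.symm.pos.le hC) ?_
  calc ∫⁻ x, H x ^ q = ∫⁻ x, liminf (fun n => T n x ^ q) atTop :=
        lintegral_congr fun x => (hlim x).liminf_eq.symm
    _ ≤ liminf (fun n => ∫⁻ x, T n x ^ q) atTop :=
        lintegral_liminf_le fun n => (hTm n).pow_const _
    _ ≤ C ^ q := liminf_le_of_le (by isBoundedDefault) fun b hb => by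
        obtain ⟨n, hn⟩ := hb.exists
        exact hn.trans (hbound n)

/-- By Hardy–Littlewood–Sobolev and duality the potential $H$ of $|h|$ lies in the conjugate
Lebesgue space. The form is then bounded by the pairing of a bounded, a.e. null sequence with one
fixed function. -/
theorem tendsto_rieszForm_zero {N : ℕ} {α : ℝ} (hN : 1 ≤ N) (hα0 : 0 < α) (hαN : α < N)
    {g : ℕ → Space N → ℝ} {h : Space N → ℝ} (hg : ∀ n, MemLp (g n) (hlsE N α) volume)
    {B : ℝ≥0∞} (hB : B ≠ ⊤) (hgB : ∀ n, eLpNorm (g n) (hlsE N α) volume ≤ B)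
    (hlim : ∀ᵐ x, Tendsto (fun n => g n x) atTop (𝓝 0)) (hh : MemLp h (hlsE N α) volume) :
    Tendsto (fun n => rieszForm α (g n) h) atTop (𝓝 0) := by
  obtain ⟨C, hC, HC⟩ := exists_lintegral_rieszE_mul_le hN hα0 hαN
  have hpq := hlsExp_holderConjugate hα0 hαN
  have hp0 := hlsE_ne_zero hα0 hαN
  have hpt := hlsE_ne_top N α
  have hhe : ∀ k : Space N → ℝ, MemLp k (hlsE N α) volume →
      ∫⁻ x, ‖k x‖ₑ ^ hlsExp N α = eLpNorm k (hlsE N α) volume ^ hlsExp N α := by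
    intro k _
    rw [eLpNorm_eq_lintegral_rpow_enorm_toReal hp0 hpt, hlsE_toReal hα0 hαN, ← ENNReal.rpow_mul,
      one_div_mul_cancel hpq.pos.ne', ENNReal.rpow_one]
  set h' := hh.1.mk h with hh'
  have hh'm : Measurable h' := hh.1.stronglyMeasurable_mk.measurable
  have hh'p : MemLp h' (hlsE N α) volume := (memLp_congr_ae hh.1.ae_eq_mk).1 hh
  set H : Space N → ℝ≥0∞ := fun y => ∫⁻ x, rieszE N α (x - y) * ‖h' x‖ₑ with hH_def
  have hker : Measurable (Function.uncurry fun y x : Space N => rieszE N α (x - y) * ‖h' x‖ₑ) := by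
    have : Measurable fun z : Space N × Space N => ‖h' z.2‖ₑ := (hh'm.comp measurable_snd).enorm
    exact Measurable.mul (by fun_prop) this
  have hHm : Measurable H := Measurable.lintegral_prod_right hker
  have hHq : ∫⁻ x, H x ^ (2 * (N : ℝ) / (N - α)) ≠ ⊤ := by
    refine lintegral_rpow_lt_top_of_pairing_le hpq hHm
      (C := C * (∫⁻ y, ‖h' y‖ₑ ^ hlsExp N α) ^ (1 / hlsExp N α)) ?_ ?_
    · refine ENNReal.mul_ne_top hC (ENNReal.rpow_ne_top_of_nonneg hpq.one_div_nonneg ?_)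
      rw [hhe h' hh'p]
      exact ENNReal.rpow_ne_top_of_nonneg hpq.nonneg hh'p.2.ne
    · intro g hgm hgt
      have := HC (fun x => ‖h' x‖ₑ) g hh'm.enorm hgm (by
        rw [hhe h' hh'p]
        exact ENNReal.rpow_ne_top_of_nonneg hpq.nonneg hh'p.2.ne) hgt
      refine le_of_eq_of_le ?_ this
      refine lintegral_congr fun x => ?_
      have hm : Measurable fun y => rieszE N α (y - x) * ‖h' y‖ₑ :=
        Measurable.mul (by fun_prop) hh'm.enorm
      rw [hH_def, ← lintegral_const_mul _ hm]
      refine lintegral_congr fun y => ?_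
      rw [rieszE_sub_comm]
      ring
  have hbd : ∀ n, |rieszForm α (g n) h| ≤ (∫⁻ y, ‖g n y‖ₑ * H y).toReal ∧
      ∫⁻ y, ‖g n y‖ₑ * H y ≠ ⊤ := by
    intro n
    have hkey : ∫⁻ y, ‖g n y‖ₑ * H y = ∫⁻ z : Space N × Space N,
        ‖rieszKernel N α (z.1 - z.2) * g n z.2 * h' z.1‖ₑ := by
      rw [Measure.volume_eq_prod, lintegral_prod_symm _
        (aestronglyMeasurable_rieszForm (hg n).1 hh'p.1).enorm]
      refine lintegral_congr fun y => ?_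
      have hm : Measurable fun x => rieszE N α (x - y) * ‖h' x‖ₑ :=
        Measurable.mul (by fun_prop) hh'm.enorm
      rw [hH_def, ← lintegral_const_mul _ hm]
      refine lintegral_congr fun x => ?_
      simp only
      rw [enorm_mul, enorm_mul, rieszE, Real.enorm_of_nonneg (rieszKernel_nonneg hα0 hαN _)]
      ring
    have e : rieszForm α (g n) h = rieszForm α (g n) h' :=
      rieszForm_congr (EventuallyEq.refl _ _) hh.1.ae_eq_mk
    refine ⟨?_, ?_⟩
    · rw [e, hkey]
      exact abs_integral_le_toReal_lintegral_enorm _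
    · rw [hkey]
      exact (integrable_rieszForm hN hα0 hαN (hg n) hh'p).2.ne
  have hl := tendsto_lintegral_mul_of_bounded_of_ae_tendsto (μ := volume) hpq
    (g := fun n x => ‖g n x‖ₑ) (H := H) (fun n => (hg n).1.enorm) hHm.aemeasurable
    (B := B ^ hlsExp N α) (ENNReal.rpow_ne_top_of_nonneg hpq.nonneg hB)
    (fun n => by
      rw [hhe _ (hg n)]
      exact ENNReal.rpow_le_rpow (hgB n) hpq.nonneg) hHq (by
      filter_upwards [hlim] with x hx
      simpa using hx.enorm)
  have hl' := (ENNReal.tendsto_toReal ENNReal.zero_ne_top).comp hl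
  rw [ENNReal.toReal_zero] at hl'
  exact squeeze_zero_norm (fun n => (hbd n).1) hl'


/-! ### Calculus of weak gradients -/

/-- `u ∈ H¹` with weak gradient `G`. -/
structure H1Pair {N : ℕ} (u : Space N → ℝ) (G : Space N → Space N) : Prop where
  memLp : MemLp u 2 volume
  memLp_grad : MemLp G 2 volume
  integral_eq : ∀ φ : Space N → ℝ, ContDiff ℝ ∞ φ → HasCompactSupport φ → ∀ v : Space N,
    ∫ x, u x * fderiv ℝ φ x v = -∫ x, inner ℝ (G x) v * φ x

section

variable {N : ℕ} {u w : Space N → ℝ} {G H : Space N → Space N}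

theorem H1Pair.hasWeakGradient (h : H1Pair u G) : HasWeakGradient u G :=
  ⟨h.memLp.locallyIntegrable one_le_two, h.memLp_grad.locallyIntegrable one_le_two, h.integral_eq⟩

theorem H1Pair.memH1 (h : H1Pair u G) : MemH1 u := ⟨h.memLp, G, h.hasWeakGradient, h.memLp_grad⟩

theorem H1Pair.weakGrad_ae (h : H1Pair u G) : weakGrad u =ᵐ[volume] G := by
  have hex : ∃ G : Space N → Space N, HasWeakGradient u G := ⟨G, h.hasWeakGradient⟩
  rw [weakGrad, dif_pos hex]
  exact hex.choose_spec.ae_eq h.hasWeakGradient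

theorem MemH1.exists_h1Pair (h : MemH1 u) : ∃ G, H1Pair u G := by
  obtain ⟨h1, G, h2, h3⟩ := h
  exact ⟨G, h1, h3, h2.integral_eq⟩

theorem H1Pair.congr_grad (h : H1Pair u G) (hG : G =ᵐ[volume] H) : H1Pair u H := by
  refine ⟨h.memLp, (memLp_congr_ae hG).1 h.memLp_grad, fun φ hφ hc v => ?_⟩
  rw [h.integral_eq φ hφ hc v]
  congr 1
  refine integral_congr_ae ?_
  filter_upwards [hG] with x hx
  rw [hx]

theorem MemH1.h1Pair (h : MemH1 u) : H1Pair u (weakGrad u) := by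
  obtain ⟨G, hG⟩ := h.exists_h1Pair
  exact hG.congr_grad hG.weakGrad_ae.symm

theorem memLp_of_contDiff {φ : Space N → ℝ} (hφ : ContDiff ℝ ∞ φ) (hc : HasCompactSupport φ)
    (p : ℝ≥0∞) : MemLp φ p volume :=
  hφ.continuous.memLp_of_hasCompactSupport hc

theorem memLp_fderiv_apply {φ : Space N → ℝ} (hφ : ContDiff ℝ ∞ φ) (hc : HasCompactSupport φ)
    (v : Space N) (p : ℝ≥0∞) : MemLp (fun x => fderiv ℝ φ x v) p volume :=
  ((hφ.continuous_fderiv (by simp)).clm_apply continuous_const).memLp_of_hasCompactSupport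
    (hc.fderiv_apply ℝ v)

theorem integrable_mul_fderiv {φ : Space N → ℝ} (hu : MemLp u 2 volume) (hφ : ContDiff ℝ ∞ φ)
    (hc : HasCompactSupport φ) (v : Space N) : Integrable (fun x => u x * fderiv ℝ φ x v) :=
  hu.integrable_mul (memLp_fderiv_apply hφ hc v 2)

theorem integrable_inner_mul {φ : Space N → ℝ} (hG : MemLp G 2 volume) (hφ : ContDiff ℝ ∞ φ)
    (hc : HasCompactSupport φ) (v : Space N) : Integrable (fun x => inner ℝ (G x) v * φ x) :=
  (hG.inner_const v).integrable_mul (memLp_of_contDiff hφ hc 2)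

theorem H1Pair.add (h : H1Pair u G) (h' : H1Pair w H) : H1Pair (u + w) (G + H) := by
  refine ⟨h.memLp.add h'.memLp, h.memLp_grad.add h'.memLp_grad, fun φ hφ hc v => ?_⟩
  simp only [Pi.add_apply, add_mul, inner_add_left]
  rw [integral_add (integrable_mul_fderiv h.memLp hφ hc v) (integrable_mul_fderiv h'.memLp hφ hc v),
    integral_add (integrable_inner_mul h.memLp_grad hφ hc v)
      (integrable_inner_mul h'.memLp_grad hφ hc v), h.integral_eq φ hφ hc v,
    h'.integral_eq φ hφ hc v, neg_add]

theorem H1Pair.const_smul (h : H1Pair u G) (c : ℝ) : H1Pair (c • u) (c • G) := by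
  refine ⟨h.memLp.const_smul c, h.memLp_grad.const_smul c, fun φ hφ hc v => ?_⟩
  simp only [Pi.smul_apply, smul_eq_mul, mul_assoc, real_inner_smul_left]
  rw [integral_const_mul, integral_const_mul, h.integral_eq φ hφ hc v, mul_neg]

theorem H1Pair.sub (h : H1Pair u G) (h' : H1Pair w H) : H1Pair (u - w) (G - H) := by
  have := h.add (h'.const_smul (-1))
  simpa [sub_eq_add_neg] using this

theorem exists_norm_gradient_le {χ : Space N → ℝ} (hχ : ContDiff ℝ ∞ χ)
    (hc : HasCompactSupport χ) : ∃ M : ℝ, 0 ≤ M ∧ ∀ x, ‖fderiv ℝ χ x‖ ≤ M := by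
  obtain ⟨M, hM⟩ := (hχ.continuous_fderiv (by simp)).bounded_above_of_compact_support (hc.fderiv ℝ)
  exact ⟨M, (norm_nonneg _).trans (hM 0), hM⟩

theorem norm_gradient (χ : Space N → ℝ) (x : Space N) : ‖gradient χ x‖ = ‖fderiv ℝ χ x‖ :=
  LinearIsometryEquiv.norm_map _ _

theorem continuous_gradient {χ : Space N → ℝ} (hχ : ContDiff ℝ ∞ χ) : Continuous (gradient χ) :=
  (LinearIsometryEquiv.continuous _).comp (hχ.continuous_fderiv (by simp))

/-- The product rule results from testing the weak gradient of $u$ with $\chi\varphi$ instead of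
$\varphi$. -/
theorem H1Pair.cutoff (h : H1Pair u G) {χ : Space N → ℝ} (hχ : ContDiff ℝ ∞ χ)
    (hχc : HasCompactSupport χ) :
    H1Pair (fun x => χ x * u x) (fun x => χ x • G x + u x • gradient χ x) := by
  obtain ⟨M, hM0, hM⟩ := exists_norm_gradient_le hχ hχc
  obtain ⟨B, hB⟩ := hχ.continuous.bounded_above_of_compact_support hχc
  have hχu : MemLp (fun x => χ x * u x) 2 volume := by
    refine h.memLp.of_le_mul (c := B) (hχ.continuous.aestronglyMeasurable.mul h.memLp.1)
      (Eventually.of_forall fun x => ?_)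
    rw [norm_mul]
    exact mul_le_mul_of_nonneg_right (hB x) (norm_nonneg _)
  have hχG : MemLp (fun x => χ x • G x) 2 volume := by
    refine h.memLp_grad.of_le_mul (c := B) (hχ.continuous.aestronglyMeasurable.smul h.memLp_grad.1)
      (Eventually.of_forall fun x => ?_)
    rw [norm_smul]
    exact mul_le_mul_of_nonneg_right (hB x) (norm_nonneg _)
  have hux : MemLp (fun x => u x • gradient χ x) 2 volume := by
    refine h.memLp.of_le_mul (c := M)
      (h.memLp.1.smul (continuous_gradient hχ).aestronglyMeasurable)
      (Eventually.of_forall fun x => ?_)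
    rw [norm_smul, norm_gradient, mul_comm]
    exact mul_le_mul_of_nonneg_right (hM x) (norm_nonneg _)
  refine ⟨hχu, hχG.add hux, fun φ hφ hc v => ?_⟩
  have hχφ : ContDiff ℝ ∞ (fun x => χ x * φ x) := hχ.mul hφ
  have hχφc : HasCompactSupport (fun x => χ x * φ x) := hc.mul_left
  have e := h.integral_eq _ hχφ hχφc v
  have d : ∀ x, fderiv ℝ (fun x => χ x * φ x) x v = χ x * fderiv ℝ φ x v + φ x * fderiv ℝ χ x v := by
    intro x
    rw [fderiv_fun_mul (hχ.differentiable (by simp) x) (hφ.differentiable (by simp) x)]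
    simp
  have i1 : Integrable (fun x => χ x * u x * fderiv ℝ φ x v) := integrable_mul_fderiv hχu hφ hc v
  have i2 : Integrable (fun x => u x * fderiv ℝ χ x v * φ x) :=
    (integrable_inner_mul hux hφ hc v).congr (Eventually.of_forall fun x => by
      simp only [real_inner_smul_left, inner_gradient_left])
  have e1 : ∫ x, u x * fderiv ℝ (fun x => χ x * φ x) x v =
      (∫ x, χ x * u x * fderiv ℝ φ x v) + ∫ x, u x * fderiv ℝ χ x v * φ x := by
    rw [← integral_add i1 i2]
    refine integral_congr_ae (Eventually.of_forall fun x => ?_)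
    simp only [d]
    ring
  have e2 : ∫ x, inner ℝ (χ x • G x + u x • gradient χ x) v * φ x =
      (∫ x, inner ℝ (G x) v * (χ x * φ x)) + ∫ x, u x * fderiv ℝ χ x v * φ x := by
    rw [← integral_add (integrable_inner_mul h.memLp_grad hχφ hχφc v) i2]
    refine integral_congr_ae (Eventually.of_forall fun x => ?_)
    simp only [inner_add_left, real_inner_smul_left, inner_gradient_left]
    ring
  rw [e2]
  linarith

theorem H1Pair.translate (h : H1Pair u G) (a : Space N) :
    H1Pair (fun x => u (x + a)) (fun x => G (x + a)) := by
  have hmp := measurePreserving_add_right (volume : Measure (Space N)) a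
  refine ⟨h.memLp.comp_measurePreserving hmp, h.memLp_grad.comp_measurePreserving hmp,
    fun φ hφ hc v => ?_⟩
  have e := h.integral_eq (fun x => φ (x - a)) (hφ.comp (contDiff_id.sub contDiff_const))
    (hc.comp_homeomorph (Homeomorph.subRight a)) v
  rw [← integral_add_right_eq_self (fun x => u x * _) a,
    ← integral_add_right_eq_self (fun x => inner ℝ (G x) v * _) a] at e
  have d : ∀ x, fderiv ℝ (fun x => φ (x - a)) (x + a) = fderiv ℝ φ x := by
    intro x
    rw [fderiv_comp_sub, add_sub_cancel_right]
  simpa only [d, add_sub_cancel_right] using e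

theorem memLp_comp_smul {F : Type*} [NormedAddCommGroup F] {g : Space N → F} {p : ℝ≥0∞}
    (hg : MemLp g p volume) {c : ℝ} (hc : c ≠ 0) : MemLp (fun x => g (c • x)) p volume := by
  have h1 : Measure.map (fun x : Space N => c • x) volume = ENNReal.ofReal
      |(c ^ Module.finrank ℝ (Space N))⁻¹| • volume := Measure.map_addHaar_smul _ hc
  have h2 : MemLp g p (Measure.map (fun x : Space N => c • x) volume) := by
    rw [h1]
    exact hg.smul_measure ENNReal.ofReal_ne_top
  exact (memLp_map_measure_iff h2.1 (measurable_const_smul c).aemeasurable).1 h2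

/-- The identity for $u$ is tested with $\varphi(t\,\cdot)$; the chain rule factor $t$ accounts for
the $t^{-1}$ in the gradient. -/
theorem H1Pair.dilate (h : H1Pair u G) {t : ℝ} (ht : 0 < t) :
    H1Pair (Choquard.dilate t u) (fun x => t⁻¹ • G (t⁻¹ • x)) := by
  have ht' : t⁻¹ ≠ 0 := inv_ne_zero ht.ne'
  refine ⟨memLp_comp_smul h.memLp ht', (memLp_comp_smul h.memLp_grad ht').const_smul t⁻¹,
    fun φ hφ hc v => ?_⟩
  have e := h.integral_eq (fun x => φ (t • x)) (hφ.comp (contDiff_const_smul t))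
    (hc.comp_homeomorph (Homeomorph.smulOfNeZero t ht.ne')) v
  have d : ∀ x, fderiv ℝ (fun x => φ (t • x)) x v = t * fderiv ℝ φ (t • x) v := by
    intro x
    rw [fderiv_comp_smul]
    simp
  have e1 := Measure.integral_comp_smul volume
    (fun x : Space N => u x * fderiv ℝ (fun x => φ (t • x)) x v) t⁻¹
  have e2 := Measure.integral_comp_smul volume
    (fun x : Space N => inner ℝ (G x) v * φ (t • x)) t⁻¹
  simp only [d, smul_inv_smul₀ ht.ne'] at e1 e2 e
  simp only [Choquard.dilate, real_inner_smul_left]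
  have e3 : ∫ x, u (t⁻¹ • x) * fderiv ℝ φ x v =
      t⁻¹ * ∫ x, u (t⁻¹ • x) * (t * fderiv ℝ φ x v) := by
    rw [← integral_const_mul]
    refine integral_congr_ae (Eventually.of_forall fun x => ?_)
    field_simp
  have e4 : ∫ x, t⁻¹ * inner ℝ (G (t⁻¹ • x)) v * φ x =
      t⁻¹ * ∫ x, inner ℝ (G (t⁻¹ • x)) v * φ x := by
    rw [← integral_const_mul]
    refine integral_congr_ae (Eventually.of_forall fun x => ?_)
    ring
  rw [e3, e4, e1, e2, e, smul_neg, mul_neg]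

theorem h1Pair_of_contDiff {φ : Space N → ℝ} (hφ : ContDiff ℝ ∞ φ) (hc : HasCompactSupport φ) :
    H1Pair φ (gradient φ) := by
  refine ⟨memLp_of_contDiff hφ hc 2, ?_, fun ψ hψ hψc v => ?_⟩
  · refine (continuous_gradient hφ).memLp_of_hasCompactSupport ?_
    refine (hc.fderiv ℝ).mono' (fun x hx => subset_tsupport _ ?_)
    rw [Function.mem_support] at *
    intro h0
    exact hx (norm_eq_zero.1 (by rw [norm_gradient, h0, norm_zero]))
  · simp only [inner_gradient_left]
    refine integral_mul_fderiv_eq_neg_fderiv_mul_of_integrable ?_ ?_ ?_ ?_ ?_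
    · exact (memLp_fderiv_apply hφ hc v 2).integrable_mul (memLp_of_contDiff hψ hψc 2)
    · exact integrable_mul_fderiv (memLp_of_contDiff hφ hc 2) hψ hψc v
    · exact (memLp_of_contDiff hφ hc 2).integrable_mul (memLp_of_contDiff hψ hψc 2)
    · exact fun x _ => hφ.differentiable (by simp) x
    · exact fun x _ => hψ.differentiable (by simp) x

end


/-! ### Mollification -/

/-- Cauchy–Schwarz for the measure $w\,d\mu$, obtained by writing $wg=w^{1/2}\cdot w^{1/2}g$. -/
theorem sq_lintegral_mul_le {X : Type*} [MeasurableSpace X] {μ : Measure X} {w g : X → ℝ≥0∞}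
    (hw : AEMeasurable w μ) (hg : AEMeasurable g μ) :
    (∫⁻ x, w x * g x ∂μ) ^ 2 ≤ (∫⁻ x, w x ∂μ) * ∫⁻ x, w x * g x ^ 2 ∂μ := by
  have h := ENNReal.lintegral_mul_le_Lp_mul_Lq μ Real.HolderConjugate.two_two
    (hw.pow_const (1 / 2 : ℝ)) ((hw.pow_const (1 / 2 : ℝ)).mul hg)
  have e0 : ∀ a : ℝ≥0∞, a ^ (1 / 2 : ℝ) * a ^ (1 / 2 : ℝ) = a := fun a => by
    rw [← ENNReal.rpow_add_of_nonneg _ _ (by norm_num) (by norm_num)]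
    norm_num
  have e1 : ∀ a : ℝ≥0∞, (a ^ (1 / 2 : ℝ)) ^ (2 : ℝ) = a := fun a => by
    rw [← ENNReal.rpow_mul]
    norm_num
  have e2 : ∀ x, ((fun x => w x ^ (1 / 2 : ℝ)) * ((fun x => w x ^ (1 / 2 : ℝ)) * g)) x =
      w x * g x := fun x => by
    simp only [Pi.mul_apply]
    rw [← mul_assoc, e0]
  have e3 : ∀ x, ((fun x => w x ^ (1 / 2 : ℝ)) * g) x ^ (2 : ℝ) = w x * g x ^ 2 := fun x => by
    simp only [Pi.mul_apply]
    rw [ENNReal.mul_rpow_of_nonneg _ _ (by norm_num), e1, ENNReal.rpow_two]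
  simp only [e2, e1, e3] at h
  calc _ ≤ ((∫⁻ x, w x ∂μ) ^ (1 / 2 : ℝ) * (∫⁻ x, w x * g x ^ 2 ∂μ) ^ (1 / 2 : ℝ)) ^ 2 := by gcongr
    _ = _ := by
      rw [mul_pow, ← ENNReal.rpow_two, ← ENNReal.rpow_two, e1, e1]

theorem eLpNorm_two_sq {X F : Type*} [MeasurableSpace X] [NormedAddCommGroup F] (μ : Measure X)
    (g : X → F) : eLpNorm g 2 μ ^ 2 = ∫⁻ x, ‖g x‖ₑ ^ 2 ∂μ := by
  have := eLpNorm_nnreal_pow_eq_lintegral (f := g) (μ := μ) (p := 2) two_ne_zero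
  simpa using this

theorem eLpNorm_two_le_of_sq {X F F' : Type*} [MeasurableSpace X] [NormedAddCommGroup F]
    [NormedAddCommGroup F'] {μ : Measure X} {g : X → F} {h : X → F'}
    (H : ∫⁻ x, ‖g x‖ₑ ^ 2 ∂μ ≤ ∫⁻ x, ‖h x‖ₑ ^ 2 ∂μ) : eLpNorm g 2 μ ≤ eLpNorm h 2 μ := by
  rw [← eLpNorm_two_sq, ← eLpNorm_two_sq] at H
  exact (ENNReal.pow_le_pow_left_iff two_ne_zero).1 H

theorem aemeasurable_enorm_comp_sub {N : ℕ} {F : Type*} [NormedAddCommGroup F]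
    {g : Space N → F} (hg : AEStronglyMeasurable g volume) :
    AEMeasurable (Function.uncurry fun x t : Space N => ‖g (x - t)‖ₑ)
      ((volume : Measure (Space N)).prod volume) :=
  (hg.comp_quasiMeasurePreserving
    (quasiMeasurePreserving_sub_of_right_invariant volume volume)).enorm

section

variable {N : ℕ} {F : Type*} [NormedAddCommGroup F] [NormedSpace ℝ F]

/-- The mollification of `g` by a normalised bump function. -/
def moll (φ : ContDiffBump (0 : Space N)) (g : Space N → F) : Space N → F :=
  convolution (φ.normed volume) g (ContinuousLinearMap.lsmul ℝ ℝ) volume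

theorem moll_apply (φ : ContDiffBump (0 : Space N)) (g : Space N → F) (x : Space N) :
    moll φ g x = ∫ t, φ.normed volume t • g (x - t) := rfl

theorem moll_apply_swap (φ : ContDiffBump (0 : Space N)) (g : Space N → F) (x : Space N) :
    moll φ g x = ∫ y, φ.normed volume (x - y) • g y := by
  rw [moll, convolution_lsmul_swap]

/-- The weight of a mollifier. -/
def mollE (φ : ContDiffBump (0 : Space N)) (t : Space N) : ℝ≥0∞ :=
  ENNReal.ofReal (φ.normed volume t)

theorem mollE_eq (φ : ContDiffBump (0 : Space N)) (t : Space N) :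
    mollE φ t = ‖φ.normed volume t‖ₑ :=
  (Real.enorm_of_nonneg (φ.nonneg_normed t)).symm

theorem measurable_mollE (φ : ContDiffBump (0 : Space N)) : Measurable (mollE φ) :=
  φ.continuous_normed.measurable.ennreal_ofReal

theorem lintegral_mollE (φ : ContDiffBump (0 : Space N)) : ∫⁻ t, mollE φ t = 1 := by
  rw [show (∫⁻ t, mollE φ t) = ∫⁻ t, ENNReal.ofReal (φ.normed volume t) from rfl,
    ← ofReal_integral_eq_lintegral_ofReal φ.integrable_normed
      (Eventually.of_forall φ.nonneg_normed), φ.integral_normed, ENNReal.ofReal_one]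

/-- Jensen's inequality for the probability weight `mollE φ`, followed by Tonelli. It serves both
the $L^2$ contraction and the approximation error of mollification. -/
theorem lintegral_sq_lintegral_mollE_le (φ : ContDiffBump (0 : Space N))
    {Φ : Space N → Space N → ℝ≥0∞}
    (hΦ : AEMeasurable (Function.uncurry Φ) ((volume : Measure (Space N)).prod volume)) :
    ∫⁻ x, (∫⁻ t, mollE φ t * Φ x t) ^ 2 ≤ ∫⁻ t, mollE φ t * ∫⁻ x, Φ x t ^ 2 := by
  have hm2 : AEMeasurable (Function.uncurry fun x t => mollE φ t * Φ x t ^ 2)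
      ((volume : Measure (Space N)).prod volume) :=
    ((measurable_mollE φ).comp measurable_snd).aemeasurable.mul (hΦ.pow_const 2)
  have e : ∀ᵐ x : Space N, AEMeasurable (fun t => Φ x t) volume := by
    obtain ⟨Ψ, hΨ, hΦΨ⟩ := hΦ
    filter_upwards [Measure.ae_ae_of_ae_prod hΦΨ] with x hx
    exact ⟨fun t => Ψ (x, t), hΨ.comp measurable_prodMk_left, hx⟩
  have e' : ∀ᵐ t : Space N, AEMeasurable (fun x => Φ x t) volume := by
    obtain ⟨Ψ, hΨ, hΦΨ⟩ := hΦ.prod_swap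
    filter_upwards [Measure.ae_ae_of_ae_prod hΦΨ] with x hx
    exact ⟨fun t => Ψ (x, t), hΨ.comp measurable_prodMk_left, hx⟩
  calc _ ≤ ∫⁻ x, ∫⁻ t, mollE φ t * Φ x t ^ 2 := by
        refine lintegral_mono_ae ?_
        filter_upwards [e] with x hx
        refine (sq_lintegral_mul_le (measurable_mollE φ).aemeasurable hx).trans ?_
        rw [lintegral_mollE, one_mul]
    _ = ∫⁻ t, ∫⁻ x, mollE φ t * Φ x t ^ 2 := lintegral_lintegral_swap hm2
    _ = _ := by
        refine lintegral_congr_ae ?_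
        filter_upwards [e'] with t ht
        rw [lintegral_const_mul'' _ (ht.pow_const 2)]

theorem lintegral_sq_enorm_moll_le (φ : ContDiffBump (0 : Space N)) {g : Space N → F}
    (hg : AEStronglyMeasurable g volume) :
    ∫⁻ x, ‖moll φ g x‖ₑ ^ 2 ≤ ∫⁻ x, ‖g x‖ₑ ^ 2 := by
  calc _ ≤ ∫⁻ x, (∫⁻ t, mollE φ t * ‖g (x - t)‖ₑ) ^ 2 := by
        refine lintegral_mono fun x => ?_
        gcongr
        rw [moll_apply]
        refine (enorm_integral_le_lintegral_enorm _).trans (le_of_eq ?_)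
        refine lintegral_congr fun t => ?_
        rw [enorm_smul, mollE_eq]
    _ ≤ _ := lintegral_sq_lintegral_mollE_le φ (aemeasurable_enorm_comp_sub hg)
    _ = ∫⁻ t, mollE φ t * ∫⁻ x, ‖g x‖ₑ ^ 2 := by
        refine lintegral_congr fun t => ?_
        rw [lintegral_sub_right_eq_self fun x => ‖g x‖ₑ ^ 2]
    _ = ∫⁻ x, ‖g x‖ₑ ^ 2 := by
        rw [lintegral_mul_const _ (measurable_mollE φ), lintegral_mollE, one_mul]

theorem contDiff_moll [CompleteSpace F] (φ : ContDiffBump (0 : Space N)) {g : Space N → F}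
    (hg : LocallyIntegrable g volume) : ContDiff ℝ ∞ (moll φ g) :=
  φ.hasCompactSupport_normed.contDiff_convolution_left _ φ.contDiff_normed hg

theorem hasCompactSupport_moll (φ : ContDiffBump (0 : Space N)) {g : Space N → F}
    (hg : HasCompactSupport g) : HasCompactSupport (moll φ g) :=
  φ.hasCompactSupport_normed.convolution _ hg

/-- The derivative falls on the kernel, and $y\mapsto\varphi(x-y)$ is an admissible test function
for the weak gradient. The sign from its chain rule cancels the sign of integration by parts. -/
theorem fderiv_moll (φ : ContDiffBump (0 : Space N)) {u : Space N → ℝ} {G : Space N → Space N}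
    (h : H1Pair u G) (x v : Space N) :
    fderiv ℝ (moll φ u) x v = inner ℝ (moll φ G x) v := by
  have hu := h.memLp.locallyIntegrable one_le_two
  have hG := h.memLp_grad.locallyIntegrable one_le_two
  have hφ1 : ContDiff ℝ 1 (φ.normed volume) := φ.contDiff_normed
  have hφc : HasCompactSupport (φ.normed (volume : Measure (Space N))) :=
    φ.hasCompactSupport_normed
  have h1 := hφc.hasFDerivAt_convolution_left (ContinuousLinearMap.lsmul ℝ ℝ) hφ1 hu x
  rw [show moll φ u = convolution (φ.normed volume) u (ContinuousLinearMap.lsmul ℝ ℝ) volume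
    from rfl, h1.fderiv]
  have hex : ConvolutionExistsAt (fderiv ℝ (φ.normed volume)) u x
      (ContinuousLinearMap.precompL (Space N) (ContinuousLinearMap.lsmul ℝ ℝ)) volume :=
    (hφc.fderiv ℝ).convolutionExists_left _ (hφ1.continuous_fderiv (by simp)) hu x
  rw [convolution_eq_swap, ContinuousLinearMap.integral_apply hex.integrable_swap]
  have hψ : ContDiff ℝ ∞ (fun y => φ.normed volume (x - y)) :=
    φ.contDiff_normed.comp (contDiff_const.sub contDiff_id)
  have hψc : HasCompactSupport (fun y => φ.normed (volume : Measure (Space N)) (x - y)) :=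
    hφc.comp_homeomorph (Homeomorph.subLeft x)
  have e := h.integral_eq _ hψ hψc v
  have d : ∀ y, fderiv ℝ (fun y => φ.normed (volume : Measure (Space N)) (x - y)) y v =
      -(fderiv ℝ (φ.normed volume) (x - y) v) := by
    intro y
    have hd : HasFDerivAt (fun y : Space N => x - y) (-ContinuousLinearMap.id ℝ (Space N)) y :=
      (hasFDerivAt_id y).const_sub x
    have := ((hφ1.differentiable (by simp) (x - y)).hasFDerivAt.comp y hd).fderiv
    rw [Function.comp_def] at this
    rw [this]
    simp
  have hint : Integrable fun y => φ.normed volume (x - y) • G y :=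
    hG.integrable_smul_left_of_hasCompactSupport hψ.continuous hψc
  rw [moll_apply_swap, real_inner_comm, ← integral_inner hint]
  simp only [d, mul_neg, integral_neg, neg_inj] at e
  calc _ = ∫ y, u y * fderiv ℝ (φ.normed volume) (x - y) v := by
        refine integral_congr_ae (Eventually.of_forall fun y => ?_)
        simp [ContinuousLinearMap.precompL_apply, mul_comm]
    _ = ∫ y, inner ℝ (G y) v * φ.normed volume (x - y) := e
    _ = _ := by
        refine integral_congr_ae (Eventually.of_forall fun y => ?_)
        simp only [real_inner_smul_right]
        rw [real_inner_comm, mul_comm]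

theorem enorm_fderiv_moll (φ : ContDiffBump (0 : Space N)) {u : Space N → ℝ}
    {G : Space N → Space N} (h : H1Pair u G) (x : Space N) :
    ‖fderiv ℝ (moll φ u) x‖ₑ = ‖moll φ G x‖ₑ := by
  have : gradient (moll φ u) x = moll φ G x := by
    refine ext_inner_right ℝ fun v => ?_
    rw [inner_gradient_left, fderiv_moll φ h]
  rw [← this, ← ofReal_norm, ← ofReal_norm, norm_gradient]

/-- A sequence of mollifiers shrinking to a point. -/
def bumpSeq (N : ℕ) (n : ℕ) : ContDiffBump (0 : Space N) where
  -- The ratio of the radii stays equal to $2$, as Lebesgue differentiation requires for a.e.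
  -- convergence.
  rIn := 1 / (n + 1) / 2
  rOut := 1 / (n + 1)
  rIn_pos := by positivity
  rIn_lt_rOut := by
    have : (0 : ℝ) < 1 / (n + 1) := by positivity
    linarith

theorem ae_tendsto_moll_bumpSeq [CompleteSpace F] {g : Space N → F}
    (hg : LocallyIntegrable g volume) :
    ∀ᵐ x, Tendsto (fun n => moll (bumpSeq N n) g x) atTop (𝓝 (g x)) := by
  refine ContDiffBump.ae_convolution_tendsto_right_of_locallyIntegrable (K := 2) ?_ ?_ hg
  · exact tendsto_one_div_add_atTop_nhds_zero_nat
  · refine Eventually.of_forall fun n => ?_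
    change (1 : ℝ) / (n + 1) ≤ 2 * (1 / (n + 1) / 2)
    linarith

end

/-! ### Translates and mollification error in $L^2$, controlled by the gradient -/

section

variable {N : ℕ} {u : Space N → ℝ} {G : Space N → Space N}

/-- The mollified function is smooth, so its increment is the integral of its gradient along the
segment from $x$ to $x-a$. Cauchy–Schwarz in the segment parameter, Tonelli, translation invariance
and the $L^2$ contraction of mollification conclude. -/
theorem lintegral_sq_enorm_moll_sub_translate_le (h : H1Pair u G) (φ : ContDiffBump (0 : Space N))
    (a : Space N) :
    ∫⁻ x, ‖moll φ u (x - a) - moll φ u x‖ₑ ^ 2 ≤ ‖a‖ₑ ^ 2 * ∫⁻ x, ‖G x‖ₑ ^ 2 := by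
  have hsm : ContDiff ℝ ∞ (moll φ u) := contDiff_moll φ (h.memLp.locallyIntegrable one_le_two)
  have hGm : Continuous (moll φ G) :=
    (contDiff_moll φ (h.memLp_grad.locallyIntegrable one_le_two)).continuous
  have pt : ∀ x, ‖moll φ u (x - a) - moll φ u x‖ₑ ≤
      ∫⁻ s in Ioc (0 : ℝ) 1, 1 * (‖a‖ₑ * ‖moll φ G (x - s • a)‖ₑ) := by
    intro x
    have hd : ∀ s ∈ uIcc (0 : ℝ) 1, HasDerivAt (fun s : ℝ => moll φ u (x - s • a))
        (-inner ℝ (moll φ G (x - s • a)) a) s := by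
      intro s _
      have h1 : HasDerivAt (fun s : ℝ => x - s • a) (-a) s := by
        simpa using ((hasDerivAt_id s).smul_const a).const_sub x
      have h2 := (hsm.differentiable (by simp) (x - s • a)).hasFDerivAt.comp_hasDerivAt s h1
      rw [map_neg, fderiv_moll φ h] at h2
      exact h2
    have hcont : Continuous fun s : ℝ => -inner ℝ (moll φ G (x - s • a)) a := by fun_prop
    have := intervalIntegral.integral_eq_sub_of_hasDerivAt hd (hcont.intervalIntegrable 0 1)
    simp only [one_smul, zero_smul, sub_zero] at this
    rw [← this, intervalIntegral.integral_of_le zero_le_one]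
    refine (enorm_integral_le_lintegral_enorm _).trans (lintegral_mono fun s => ?_)
    rw [enorm_neg, one_mul, mul_comm]
    rw [← ofReal_norm, ← ofReal_norm, ← ofReal_norm, ← ENNReal.ofReal_mul (norm_nonneg _)]
    exact ENNReal.ofReal_le_ofReal (norm_inner_le_norm _ _)
  have hm : Measurable (Function.uncurry fun (x : Space N) (s : ℝ) =>
      ‖a‖ₑ * ‖moll φ G (x - s • a)‖ₑ) := by
    have : Continuous fun z : Space N × ℝ => moll φ G (z.1 - z.2 • a) := by fun_prop
    exact this.measurable.enorm.const_mul _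
  calc _ ≤ ∫⁻ x, ∫⁻ s in Ioc (0 : ℝ) 1, (‖a‖ₑ * ‖moll φ G (x - s • a)‖ₑ) ^ 2 := by
        refine lintegral_mono fun x => ?_
        refine (pow_le_pow_left₀ zero_le (pt x) 2).trans ?_
        refine (sq_lintegral_mul_le aemeasurable_const
          (hm.comp measurable_prodMk_left).aemeasurable).trans (le_of_eq ?_)
        simp
    _ = ∫⁻ s in Ioc (0 : ℝ) 1, ∫⁻ x, (‖a‖ₑ * ‖moll φ G (x - s • a)‖ₑ) ^ 2 :=
        lintegral_lintegral_swap (hm.pow_const 2).aemeasurable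
    _ = ∫⁻ s in Ioc (0 : ℝ) 1, ‖a‖ₑ ^ 2 * ∫⁻ x, ‖moll φ G x‖ₑ ^ 2 := by
        refine lintegral_congr fun s => ?_
        simp_rw [mul_pow]
        rw [lintegral_const_mul' _ _ (by simp),
          lintegral_sub_right_eq_self fun x => ‖moll φ G x‖ₑ ^ 2]
    _ = ‖a‖ₑ ^ 2 * ∫⁻ x, ‖moll φ G x‖ₑ ^ 2 := by simp
    _ ≤ _ := by
        exact mul_le_mul_right (lintegral_sq_enorm_moll_le φ h.memLp_grad.1) _

/-- Fatou's lemma along shrinking mollifiers, since the bound for the mollified function does not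
depend on the mollifier. -/
theorem lintegral_sq_enorm_sub_translate_le (h : H1Pair u G) (a : Space N) :
    ∫⁻ x, ‖u (x - a) - u x‖ₑ ^ 2 ≤ ‖a‖ₑ ^ 2 * ∫⁻ x, ‖G x‖ₑ ^ 2 := by
  have hu := h.memLp.locallyIntegrable one_le_two
  have hc : ∀ n, Continuous (moll (bumpSeq N n) u) := fun n => (contDiff_moll _ hu).continuous
  have h1 := ae_tendsto_moll_bumpSeq hu
  have h2 : ∀ᵐ x, Tendsto (fun n => moll (bumpSeq N n) u (x - a)) atTop (𝓝 (u (x - a))) :=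
    (measurePreserving_sub_right volume a).quasiMeasurePreserving.ae h1
  have hlim : ∀ᵐ x, Tendsto (fun n => ‖moll (bumpSeq N n) u (x - a) - moll (bumpSeq N n) u x‖ₑ ^ 2)
      atTop (𝓝 (‖u (x - a) - u x‖ₑ ^ 2)) := by
    filter_upwards [h1, h2] with x hx1 hx2
    exact ((ENNReal.continuous_pow 2).tendsto _).comp (hx2.sub hx1).enorm
  calc _ = ∫⁻ x, liminf (fun n =>
        ‖moll (bumpSeq N n) u (x - a) - moll (bumpSeq N n) u x‖ₑ ^ 2) atTop := by
        refine lintegral_congr_ae ?_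
        filter_upwards [hlim] with x hx using hx.liminf_eq.symm
    _ ≤ liminf (fun n => ∫⁻ x,
        ‖moll (bumpSeq N n) u (x - a) - moll (bumpSeq N n) u x‖ₑ ^ 2) atTop := by
        refine lintegral_liminf_le fun n => ?_
        have := hc n
        exact (Continuous.measurable (by fun_prop)).enorm.pow_const 2
    _ ≤ _ := liminf_le_of_le (by isBoundedDefault) fun b hb => by
        obtain ⟨n, hn⟩ := hb.exists
        exact hn.trans (lintegral_sq_enorm_moll_sub_translate_le h _ a)

/-- The error is an average of translates $u(\cdot-t)-u$ over $|t|<$ `φ.rOut`, each controlled by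
the gradient. The rate depends on $u$ only through the gradient norm, which is what local
compactness needs. -/
theorem lintegral_sq_enorm_moll_sub_le (h : H1Pair u G) (φ : ContDiffBump (0 : Space N)) :
    ∫⁻ x, ‖moll φ u x - u x‖ₑ ^ 2 ≤ ENNReal.ofReal φ.rOut ^ 2 * ∫⁻ x, ‖G x‖ₑ ^ 2 := by
  have hu := h.memLp.locallyIntegrable one_le_two
  have hφc : HasCompactSupport (φ.normed (volume : Measure (Space N))) :=
    φ.hasCompactSupport_normed
  have hm : AEMeasurable (Function.uncurry fun x t : Space N => ‖u (x - t) - u x‖ₑ)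
      ((volume : Measure (Space N)).prod volume) :=
    ((h.memLp.1.comp_quasiMeasurePreserving
      (quasiMeasurePreserving_sub_of_right_invariant volume volume)).sub h.memLp.1.comp_fst).enorm
  calc _ ≤ ∫⁻ x, (∫⁻ t, mollE φ t * ‖u (x - t) - u x‖ₑ) ^ 2 := by
        refine lintegral_mono fun x => ?_
        gcongr
        have hi : Integrable fun t => φ.normed volume t • u (x - t) :=
          (hφc.convolutionExists_left (ContinuousLinearMap.lsmul ℝ ℝ) φ.continuous_normed hu x)
        have : moll φ u x - u x = ∫ t, φ.normed volume t • (u (x - t) - u x) := by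
          simp_rw [smul_sub]
          rw [integral_sub hi (φ.integrable_normed.smul_const _), integral_smul_const,
            φ.integral_normed, one_smul, moll_apply]
        rw [this]
        refine (enorm_integral_le_lintegral_enorm _).trans (le_of_eq ?_)
        refine lintegral_congr fun t => ?_
        rw [enorm_smul, mollE_eq]
    _ ≤ ∫⁻ t, mollE φ t * ∫⁻ x, ‖u (x - t) - u x‖ₑ ^ 2 := lintegral_sq_lintegral_mollE_le φ hm
    _ ≤ ∫⁻ t, mollE φ t * (ENNReal.ofReal φ.rOut ^ 2 * ∫⁻ x, ‖G x‖ₑ ^ 2) := by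
        refine lintegral_mono fun t => ?_
        by_cases ht : t ∈ Metric.ball (0 : Space N) φ.rOut
        · refine mul_le_mul_right ((lintegral_sq_enorm_sub_translate_le h t).trans ?_) _
          gcongr
          rw [← ofReal_norm]
          exact ENNReal.ofReal_le_ofReal (by simpa using (mem_ball_zero_iff.1 ht).le)
        · have : φ.normed volume t = 0 := by
            rw [← Function.notMem_support, φ.support_normed_eq]
            exact ht
          simp [mollE, this]
    _ = _ := by
        rw [lintegral_mul_const _ (measurable_mollE φ), lintegral_mollE, one_mul]

end


/-! ### The Sobolev inequality and Lions' lemma -/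

/-- The critical Sobolev exponent `2N/(N-2)`. -/
def sobExp (N : ℕ) : ℝ := 2 * (N : ℝ) / ((N : ℝ) - 2)

/-- The critical Sobolev exponent as an extended nonnegative real. -/
def sobE (N : ℕ) : ℝ≥0∞ := ENNReal.ofReal (sobExp N)

theorem two_lt_sobExp {N : ℕ} (hN : 3 ≤ N) : 2 < sobExp N := by
  have : (3 : ℝ) ≤ N := by exact_mod_cast hN
  rw [sobExp, lt_div_iff₀ (by linarith)]
  linarith

theorem sobE_ne_zero {N : ℕ} (hN : 3 ≤ N) : sobE N ≠ 0 := by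
  have := two_lt_sobExp hN
  simp only [sobE, ne_eq, ENNReal.ofReal_eq_zero]
  linarith

theorem sobE_ne_top (N : ℕ) : sobE N ≠ ⊤ := ENNReal.ofReal_ne_top

theorem sobE_toReal {N : ℕ} (hN : 3 ≤ N) : (sobE N).toReal = sobExp N :=
  ENNReal.toReal_ofReal (by linarith [two_lt_sobExp hN])

/-- The Gagliardo–Nirenberg–Sobolev inequality applies to the mollifications, which are smooth with
compact support and whose gradient norms do not exceed that of $G$. Fatou's lemma transfers it to
$u$. -/
theorem exists_eLpNorm_sobE_le_of_hasCompactSupport {N : ℕ} (hN : 3 ≤ N) :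
    ∃ K : ℝ≥0∞, K ≠ ⊤ ∧ ∀ (u : Space N → ℝ) (G : Space N → Space N), H1Pair u G →
      HasCompactSupport u → eLpNorm u (sobE N) volume ≤ K * eLpNorm G 2 volume := by
  have hN' : (3 : ℝ) ≤ N := by exact_mod_cast hN
  refine ⟨SNormLESNormFDerivOfEqConst ℝ (volume : Measure (Space N)) ((2 : NNReal) : ℝ),
    ENNReal.coe_ne_top, fun u G h hc => ?_⟩
  have hu := h.memLp.locallyIntegrable one_le_two
  have key : ∀ n, eLpNorm (moll (bumpSeq N n) u) (sobE N) volume ≤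
      SNormLESNormFDerivOfEqConst ℝ (volume : Measure (Space N)) ((2 : NNReal) : ℝ) *
        eLpNorm G 2 volume := by
    intro n
    have h1 := eLpNorm_le_eLpNorm_fderiv_of_eq (F := ℝ) (volume : Measure (Space N))
      ((contDiff_moll (bumpSeq N n) hu).of_le (by simp)) (hasCompactSupport_moll (bumpSeq N n) hc)
      (p := 2) (p' := (sobExp N).toNNReal) one_le_two (by simp; omega) (by
        rw [Real.coe_toNNReal _ (by linarith [two_lt_sobExp hN]), sobExp, finrank_euclideanSpace_fin]
        have : (N : ℝ) - 2 ≠ 0 := by linarith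
        have : (N : ℝ) ≠ 0 := by linarith
        push_cast
        field_simp)
    refine h1.trans ?_
    gcongr
    refine eLpNorm_two_le_of_sq ?_
    simp_rw [enorm_fderiv_moll _ h]
    exact lintegral_sq_enorm_moll_le _ h.memLp_grad.1
  refine (Lp.eLpNorm_lim_le_liminf_eLpNorm
    (fun n => (contDiff_moll (bumpSeq N n) hu).continuous.aestronglyMeasurable) u
    (ae_tendsto_moll_bumpSeq hu)).trans ?_
  exact liminf_le_of_le (by isBoundedDefault) fun b hb => by
    obtain ⟨n, hn⟩ := hb.exists
    exact hn.trans (key n)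

/-- A fixed bump function with inner radius `1` and outer radius `2`. -/
def unitBump (N : ℕ) : ContDiffBump (0 : Space N) where
  rIn := 1
  rOut := 2
  rIn_pos := one_pos
  rIn_lt_rOut := one_lt_two

/-- The cutoff function at scale `R` centred at `a`. -/
def cut {N : ℕ} (R : ℝ) (a x : Space N) : ℝ := unitBump N (R⁻¹ • (x - a))

section

variable {N : ℕ} {R : ℝ} {a x : Space N}

theorem contDiff_cut (R : ℝ) (a : Space N) : ContDiff ℝ ∞ (cut R a) :=
  (unitBump N).contDiff.comp ((contDiff_id.sub contDiff_const).const_smul _)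

theorem cut_nonneg : 0 ≤ cut R a x := (unitBump N).nonneg

theorem cut_le_one : cut R a x ≤ 1 := (unitBump N).le_one

theorem cut_eq_one (hR : 0 < R) (hx : ‖x - a‖ ≤ R) : cut R a x = 1 := by
  refine (unitBump N).one_of_mem_closedBall ?_
  rw [mem_closedBall_zero_iff, norm_smul, norm_inv, Real.norm_of_nonneg hR.le]
  change R⁻¹ * ‖x - a‖ ≤ 1
  rw [inv_mul_le_iff₀ hR]
  linarith

theorem cut_eq_zero (hR : 0 < R) (hx : 2 * R ≤ ‖x - a‖) : cut R a x = 0 := by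
  refine (unitBump N).zero_of_le_dist ?_
  rw [dist_zero_right, norm_smul, norm_inv, Real.norm_of_nonneg hR.le]
  change 2 ≤ R⁻¹ * ‖x - a‖
  rw [inv_mul_eq_div, le_div_iff₀ hR]
  exact hx

theorem hasCompactSupport_cut (hR : 0 < R) (a : Space N) : HasCompactSupport (cut R a) := by
  refine HasCompactSupport.of_support_subset_isCompact (isCompact_closedBall a (2 * R)) ?_
  intro x hx
  rw [Metric.mem_closedBall, dist_eq_norm]
  by_contra h
  exact hx (cut_eq_zero hR (not_le.1 h).le)

/-- The chain rule produces a factor $R^{-1}\le1$, so one bound serves all scales $R\ge1$ and all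
centres. -/
theorem exists_norm_fderiv_cut_le (N : ℕ) : ∃ M : ℝ, 0 ≤ M ∧ ∀ (R : ℝ) (a x : Space N), 1 ≤ R →
    ‖fderiv ℝ (cut R a) x‖ ≤ M := by
  obtain ⟨M, hM0, hM⟩ := exists_norm_gradient_le (χ := unitBump N) (unitBump N).contDiff
    (unitBump N).hasCompactSupport
  refine ⟨M, hM0, fun R a x hR => ?_⟩
  have h1 : HasFDerivAt (fun x : Space N => R⁻¹ • (x - a))
      (R⁻¹ • ContinuousLinearMap.id ℝ (Space N)) x :=
    ((hasFDerivAt_id x).sub_const a).const_smul R⁻¹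
  have h2 := ((((unitBump N).contDiff (n := 1)).differentiable (by simp)
    (R⁻¹ • (x - a))).hasFDerivAt.comp x h1).fderiv
  have h3 : fderiv ℝ (cut R a) x = _ := h2
  rw [h3]
  refine ContinuousLinearMap.opNorm_le_bound _ hM0 fun v => ?_
  simp only [ContinuousLinearMap.comp_apply, smul_apply,
    ContinuousLinearMap.id_apply, map_smul]
  rw [norm_smul, norm_inv, Real.norm_of_nonneg (by linarith : (0:ℝ) ≤ R)]
  calc R⁻¹ * ‖fderiv ℝ (unitBump N) (R⁻¹ • (x - a)) v‖ ≤
      1 * ‖fderiv ℝ (unitBump N) (R⁻¹ • (x - a)) v‖ := by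
        gcongr
        exact inv_le_one_of_one_le₀ hR
    _ ≤ M * ‖v‖ := by
        rw [one_mul]
        exact ((fderiv ℝ (unitBump N) _).le_opNorm v).trans (by gcongr; exact hM _)

end

/-- A local Sobolev inequality with a constant uniform in scale and centre. It is used with
$R\to\infty$ for the global inequality and with $R=1$ in Lions' lemma. -/
theorem exists_sq_eLpNorm_cut_mul_le {N : ℕ} (hN : 3 ≤ N) :
    ∃ K : ℝ≥0∞, K ≠ ⊤ ∧ ∀ (u : Space N → ℝ) (G : Space N → Space N), H1Pair u G →
      ∀ (R : ℝ) (a : Space N), 1 ≤ R →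
        eLpNorm (fun x => cut R a x * u x) (sobE N) volume ^ 2 ≤
          K * ∫⁻ x in Metric.ball a (2 * R), (‖G x‖ₑ ^ 2 + ‖u x‖ₑ ^ 2) := by
  obtain ⟨K, hK, H⟩ := exists_eLpNorm_sobE_le_of_hasCompactSupport hN
  obtain ⟨M, hM0, hM⟩ := exists_norm_fderiv_cut_le N
  refine ⟨K ^ 2 * ENNReal.ofReal (1 + M ^ 2), ENNReal.mul_ne_top (by simp [hK]) (by simp),
    fun u G h R a hR => ?_⟩
  have hR0 : 0 < R := by linarith
  have hcut := h.cutoff (contDiff_cut R a) (hasCompactSupport_cut hR0 a)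
  have h1 := H _ _ hcut (hasCompactSupport_cut hR0 a).mul_right
  have pt : ∀ x, ‖cut R a x • G x + u x • gradient (cut R a) x‖ₑ ^ 2 ≤
      (Metric.ball a (2 * R)).indicator
        (fun x => ENNReal.ofReal (1 + M ^ 2) * (‖G x‖ₑ ^ 2 + ‖u x‖ₑ ^ 2)) x := by
    intro x
    by_cases hx : x ∈ Metric.ball a (2 * R)
    · rw [indicator_of_mem hx]
      simp only [← ofReal_norm]
      rw [← ENNReal.ofReal_pow (norm_nonneg _), ← ENNReal.ofReal_pow (norm_nonneg _),
        ← ENNReal.ofReal_pow (norm_nonneg _), ← ENNReal.ofReal_add (by positivity) (by positivity),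
        ← ENNReal.ofReal_mul (by positivity)]
      refine ENNReal.ofReal_le_ofReal ?_
      have hn : ‖cut R a x • G x + u x • gradient (cut R a) x‖ ≤ ‖G x‖ + M * ‖u x‖ := by
        refine (norm_add_le _ _).trans ?_
        rw [norm_smul, norm_smul, norm_gradient, Real.norm_of_nonneg cut_nonneg, mul_comm ‖u x‖]
        refine add_le_add ?_ (mul_le_mul_of_nonneg_right (hM R a x hR) (norm_nonneg _))
        exact mul_le_of_le_one_left (norm_nonneg _) cut_le_one
      calc _ ≤ (‖G x‖ + M * ‖u x‖) ^ 2 := by gcongr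
        -- Cauchy–Schwarz: $(a+Mb)^2\le(1+M^2)(a^2+b^2)$.
        _ ≤ _ := by nlinarith [sq_nonneg (M * ‖G x‖ - ‖u x‖)]
    · rw [indicator_of_notMem hx]
      have hx' : 2 * R ≤ ‖x - a‖ := by simpa [dist_eq_norm] using hx
      have hz : cut R a x = 0 := cut_eq_zero hR0 hx'
      have hg : fderiv ℝ (cut R a) x = 0 := by
        -- A zero of the nonnegative cutoff is a minimum, so its derivative vanishes there too, even
        -- on the boundary sphere.
        have hmin : IsLocalMin (cut R a) x :=
          Eventually.of_forall fun y => by rw [hz]; exact cut_nonneg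
        exact hmin.fderiv_eq_zero
      have hg' : gradient (cut R a) x = 0 := norm_eq_zero.1 (by rw [norm_gradient, hg, norm_zero])
      simp [hz, hg']
  calc _ ≤ (K * eLpNorm (fun x => cut R a x • G x + u x • gradient (cut R a) x) 2 volume) ^ 2 :=
        pow_le_pow_left₀ zero_le h1 2
    _ = K ^ 2 * ∫⁻ x, ‖cut R a x • G x + u x • gradient (cut R a) x‖ₑ ^ 2 := by
        rw [mul_pow, eLpNorm_two_sq]
    _ ≤ K ^ 2 * ∫⁻ x, (Metric.ball a (2 * R)).indicator
        (fun x => ENNReal.ofReal (1 + M ^ 2) * (‖G x‖ₑ ^ 2 + ‖u x‖ₑ ^ 2)) x :=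
        mul_le_mul_right (lintegral_mono pt) _
    _ = _ := by
        rw [lintegral_indicator Metric.isOpen_ball.measurableSet,
          lintegral_const_mul' _ _ ENNReal.ofReal_ne_top, mul_assoc]

theorem exists_sq_eLpNorm_sobE_le {N : ℕ} (hN : 3 ≤ N) :
    ∃ K : ℝ≥0∞, K ≠ ⊤ ∧ ∀ (u : Space N → ℝ) (G : Space N → Space N), H1Pair u G →
      eLpNorm u (sobE N) volume ^ 2 ≤ K * ((∫⁻ x, ‖G x‖ₑ ^ 2) + ∫⁻ x, ‖u x‖ₑ ^ 2) := by
  obtain ⟨K, hK, H⟩ := exists_sq_eLpNorm_cut_mul_le hN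
  refine ⟨K, hK, fun u G h => ?_⟩
  have hb : ∀ n : ℕ, eLpNorm (fun x => cut (n + 1 : ℝ) 0 x * u x) (sobE N) volume ^ 2 ≤
      K * ((∫⁻ x, ‖G x‖ₑ ^ 2) + ∫⁻ x, ‖u x‖ₑ ^ 2) := by
    intro n
    refine (H u G h (n + 1) 0 (by linarith [(Nat.cast_nonneg n : (0 : ℝ) ≤ n)])).trans ?_
    rw [← lintegral_add_left' (h.memLp_grad.1.enorm.pow_const 2)]
    gcongr
    exact Measure.restrict_le_self
  have hlim : ∀ᵐ x, Tendsto (fun n : ℕ => cut (n + 1 : ℝ) 0 x * u x) atTop (𝓝 (u x)) := by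
    refine Eventually.of_forall fun x => ?_
    refine tendsto_const_nhds.congr' ?_
    obtain ⟨n₀, hn₀⟩ := exists_nat_gt ‖x‖
    filter_upwards [eventually_ge_atTop n₀] with n hn
    have : (n₀ : ℝ) ≤ n := by exact_mod_cast hn
    rw [cut_eq_one (by positivity) (by rw [sub_zero]; linarith), one_mul]
  have h1 := Lp.eLpNorm_lim_le_liminf_eLpNorm (p := sobE N)
    (fun n : ℕ => (contDiff_cut (n + 1 : ℝ) (0 : Space N)).continuous.aestronglyMeasurable.mul
      h.memLp.1) u hlim
  have key : eLpNorm u (sobE N) volume ≤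
      (K * ((∫⁻ x, ‖G x‖ₑ ^ 2) + ∫⁻ x, ‖u x‖ₑ ^ 2)) ^ (1 / 2 : ℝ) := by
    refine h1.trans (liminf_le_of_le (by isBoundedDefault) fun b hb' => ?_)
    obtain ⟨n, hn⟩ := hb'.exists
    refine hn.trans ?_
    have := ENNReal.rpow_le_rpow (hb n) (show (0 : ℝ) ≤ 1 / 2 by norm_num)
    rwa [← ENNReal.rpow_two, ← ENNReal.rpow_mul, show (2 : ℝ) * (1 / 2) = 1 by norm_num,
      ENNReal.rpow_one] at this
  calc _ ≤ ((K * ((∫⁻ x, ‖G x‖ₑ ^ 2) + ∫⁻ x, ‖u x‖ₑ ^ 2)) ^ (1 / 2 : ℝ)) ^ 2 :=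
        pow_le_pow_left₀ zero_le key 2
    _ = _ := by
        rw [← ENNReal.rpow_two, ← ENNReal.rpow_mul, show (1 / 2 : ℝ) * 2 = 1 by norm_num,
          ENNReal.rpow_one]

theorem H1Pair.memLp_sobE {N : ℕ} (hN : 3 ≤ N) {u : Space N → ℝ} {G : Space N → Space N}
    (h : H1Pair u G) : MemLp u (sobE N) volume := by
  obtain ⟨K, hK, H⟩ := exists_sq_eLpNorm_sobE_le hN
  refine ⟨h.memLp.1, ?_⟩
  have h1 := H u G h
  have h2 : (∫⁻ x, ‖G x‖ₑ ^ 2) + ∫⁻ x, ‖u x‖ₑ ^ 2 ≠ ⊤ := by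
    rw [← eLpNorm_two_sq, ← eLpNorm_two_sq]
    exact ENNReal.add_ne_top.2 ⟨ENNReal.pow_ne_top h.memLp_grad.2.ne,
      ENNReal.pow_ne_top h.memLp.2.ne⟩
  have h3 := h1.trans_lt (ENNReal.mul_lt_top hK.lt_top h2.lt_top)
  by_contra hcon
  rw [not_lt, top_le_iff] at hcon
  rw [hcon] at h3
  simp at h3

/-- Tonelli. Integrating over the centre replaces a covering by balls of bounded overlap. -/
theorem lintegral_lintegral_ball {N : ℕ} {g : Space N → ℝ≥0∞} (hg : AEMeasurable g volume)
    (r : ℝ) : ∫⁻ a : Space N, ∫⁻ x in Metric.ball a r, g x =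
      volume (Metric.ball (0 : Space N) r) * ∫⁻ x, g x := by
  have hS : MeasurableSet {z : Space N × Space N | dist z.2 z.1 < r} :=
    measurableSet_lt (measurable_snd.dist measurable_fst) measurable_const
  have e1 : ∀ a : Space N, ∫⁻ x in Metric.ball a r, g x =
      ∫⁻ x, {z : Space N × Space N | dist z.2 z.1 < r}.indicator (fun z => g z.2) (a, x) := by
    intro a
    rw [← lintegral_indicator Metric.isOpen_ball.measurableSet]
    rfl
  simp_rw [e1]
  rw [lintegral_lintegral_swap (f := fun a x =>
    {z : Space N × Space N | dist z.2 z.1 < r}.indicator (fun z => g z.2) (a, x))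
    ((hg.comp_snd).indicator hS), ← lintegral_const_mul'' _ hg]
  refine lintegral_congr fun x => ?_
  have e2 : ∀ a : Space N, {z : Space N × Space N | dist z.2 z.1 < r}.indicator
      (fun z => g z.2) (a, x) = (Metric.ball x r).indicator (fun _ => g x) a := by
    intro a
    by_cases h : dist x a < r
    · rw [indicator_of_mem (show (a, x) ∈ {z : Space N × Space N | dist z.2 z.1 < r} from h),
        indicator_of_mem (show a ∈ Metric.ball x r by rwa [Metric.mem_ball, dist_comm])]
    · rw [indicator_of_notMem (show (a, x) ∉ {z : Space N × Space N | dist z.2 z.1 < r} from h),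
        indicator_of_notMem (show a ∉ Metric.ball x r by rwa [Metric.mem_ball, dist_comm])]
  simp_rw [e2]
  rw [lintegral_indicator Metric.isOpen_ball.measurableSet, setLIntegral_const,
    Measure.addHaar_ball_center, mul_comm]

/-- The intermediate exponent `2 + 4/N`. -/
def midExp (N : ℕ) : ℝ := 2 + 4 / (N : ℝ)

/-- Lions' lemma in quantitative form. -/
theorem exists_lintegral_midExp_le {N : ℕ} (hN : 3 ≤ N) :
    ∃ C : ℝ≥0∞, C ≠ ⊤ ∧ ∀ (u : Space N → ℝ) (G : Space N → Space N), H1Pair u G →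
      ∀ δ : ℝ≥0∞, (∀ a, ∫⁻ x in Metric.ball a 2, ‖u x‖ₑ ^ 2 ≤ δ) →
        ∫⁻ x, ‖u x‖ₑ ^ midExp N ≤
          C * δ ^ (2 / (N : ℝ)) * ((∫⁻ x, ‖G x‖ₑ ^ 2) + ∫⁻ x, ‖u x‖ₑ ^ 2) := by
  obtain ⟨K, hK, H⟩ := exists_sq_eLpNorm_cut_mul_le hN
  have hN' : (3 : ℝ) ≤ N := by exact_mod_cast hN
  have hpq : ((N : ℝ) / 2).HolderConjugate ((N : ℝ) / (N - 2)) := by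
    rw [Real.holderConjugate_iff]
    refine ⟨by linarith, ?_⟩
    have : (N : ℝ) - 2 ≠ 0 := by linarith
    field_simp
    ring
  set v₁ := volume (Metric.ball (0 : Space N) 1) with hv₁
  set v₂ := volume (Metric.ball (0 : Space N) 2) with hv₂
  have hv₁0 : v₁ ≠ 0 := (Metric.measure_ball_pos _ _ one_pos).ne'
  have hv₁t : v₁ ≠ ⊤ := measure_ball_lt_top.ne
  have hv₂t : v₂ ≠ ⊤ := measure_ball_lt_top.ne
  refine ⟨v₁⁻¹ * (K * v₂), ENNReal.mul_ne_top (by simpa using hv₁0) (ENNReal.mul_ne_top hK hv₂t),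
    fun u G h δ hδ => ?_⟩
  -- Hölder with exponents $N/2$ and $N/(N-2)$ applied to $|v|^{4/N}\cdot|v|^2$. The exponent
  -- $2+4/N$ makes the first factor a power of the local mass and the second exactly the squared
  -- critical norm, so the local energy enters linearly and can be summed.
  have loc : ∀ a, ∫⁻ x in Metric.ball a 1, ‖u x‖ₑ ^ midExp N ≤
      δ ^ (2 / (N : ℝ)) * (K * ∫⁻ x in Metric.ball a 2, (‖G x‖ₑ ^ 2 + ‖u x‖ₑ ^ 2)) := by
    intro a
    set v : Space N → ℝ := fun x => cut 1 a x * u x with hv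
    have hvm : AEMeasurable (fun x => ‖v x‖ₑ) volume :=
      ((contDiff_cut 1 a).continuous.aestronglyMeasurable.mul h.memLp.1).enorm
    have s1 : ∫⁻ x in Metric.ball a 1, ‖u x‖ₑ ^ midExp N ≤
        ∫⁻ x in Metric.ball a 2, (((fun x => ‖v x‖ₑ ^ (4 / (N : ℝ))) * fun x => ‖v x‖ₑ ^ (2 : ℝ)) x) := by
      calc _ = ∫⁻ x in Metric.ball a 1,
            (((fun x => ‖v x‖ₑ ^ (4 / (N : ℝ))) * fun x => ‖v x‖ₑ ^ (2 : ℝ)) x) := by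
            refine setLIntegral_congr_fun Metric.isOpen_ball.measurableSet fun x hx => ?_
            have hx1 : ‖x - a‖ ≤ 1 := by
              rw [← dist_eq_norm]
              exact (Metric.mem_ball.1 hx).le
            simp only [hv, Pi.mul_apply]
            rw [cut_eq_one one_pos hx1, one_mul,
              ← ENNReal.rpow_add_of_nonneg _ _ (by positivity) (by norm_num), midExp, add_comm]
        _ ≤ _ := lintegral_mono_set (Metric.ball_subset_ball one_le_two)
    refine s1.trans ((ENNReal.lintegral_mul_le_Lp_mul_Lq _ hpq
      (hvm.restrict.pow_const _) (hvm.restrict.pow_const _)).trans ?_)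
    refine mul_le_mul' ?_ ?_
    · rw [show 1 / ((N : ℝ) / 2) = 2 / N by field_simp]
      refine ENNReal.rpow_le_rpow (le_trans (lintegral_mono fun x => ?_) (hδ a)) (by positivity)
      rw [← ENNReal.rpow_mul, show 4 / (N : ℝ) * (N / 2) = 2 by field_simp; norm_num,
        ENNReal.rpow_two]
      gcongr
      rw [hv, enorm_mul]
      refine mul_le_of_le_one_left zero_le ?_
      rw [Real.enorm_of_nonneg cut_nonneg]
      exact ENNReal.ofReal_le_one.2 cut_le_one
    · have hs := H u G h 1 a le_rfl
      rw [mul_one] at hs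
      refine le_trans ?_ hs
      rw [eLpNorm_eq_lintegral_rpow_enorm_toReal (sobE_ne_zero hN) (sobE_ne_top N), sobE_toReal hN,
        ← ENNReal.rpow_two, ← ENNReal.rpow_mul]
      have h2 : (N : ℝ) - 2 ≠ 0 := by linarith
      have e : 1 / sobExp N * 2 = 1 / ((N : ℝ) / (N - 2)) := by
        rw [sobExp]
        field_simp
      rw [e]
      have e0 : (0 : ℝ) ≤ 1 / ((N : ℝ) / (N - 2)) := hpq.symm.one_div_nonneg
      refine ENNReal.rpow_le_rpow ?_ e0
      refine (setLIntegral_le_lintegral _ _).trans (le_of_eq (lintegral_congr fun x => ?_))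
      rw [← ENNReal.rpow_mul]
      congr 1
      rw [sobExp]
      ring
  have hq : AEMeasurable (fun x => ‖u x‖ₑ ^ midExp N) volume := h.memLp.1.enorm.pow_const _
  have hs : AEMeasurable (fun x => ‖G x‖ₑ ^ 2 + ‖u x‖ₑ ^ 2) volume :=
    (h.memLp_grad.1.enorm.pow_const 2).add (h.memLp.1.enorm.pow_const 2)
  -- The local estimate is integrated over the centre $a$; both sides become global integrals times
  -- the volume of a ball.
  have tot : v₁ * ∫⁻ x, ‖u x‖ₑ ^ midExp N ≤
      δ ^ (2 / (N : ℝ)) * (K * (v₂ * ((∫⁻ x, ‖G x‖ₑ ^ 2) + ∫⁻ x, ‖u x‖ₑ ^ 2))) := by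
    have hmeas : AEMeasurable (fun a : Space N =>
        ∫⁻ x in Metric.ball a 2, (‖G x‖ₑ ^ 2 + ‖u x‖ₑ ^ 2)) volume := by
      have hS : MeasurableSet {z : Space N × Space N | dist z.2 z.1 < 2} :=
        measurableSet_lt (measurable_snd.dist measurable_fst) measurable_const
      refine (AEMeasurable.lintegral_prod_right' (hs.comp_snd.indicator hS)).congr ?_
      refine Eventually.of_forall fun a => ?_
      simp only
      rw [← lintegral_indicator Metric.isOpen_ball.measurableSet]
      rfl
    rw [← lintegral_lintegral_ball hq 1, ← lintegral_add_left' (h.memLp_grad.1.enorm.pow_const 2),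
      ← lintegral_lintegral_ball hs 2, ← lintegral_const_mul'' _ hmeas,
      ← lintegral_const_mul'' _ (hmeas.const_mul _)]
    exact lintegral_mono loc
  calc ∫⁻ x, ‖u x‖ₑ ^ midExp N = v₁⁻¹ * (v₁ * ∫⁻ x, ‖u x‖ₑ ^ midExp N) := by
        rw [← mul_assoc, ENNReal.inv_mul_cancel hv₁0 hv₁t, one_mul]
    _ ≤ v₁⁻¹ * (δ ^ (2 / (N : ℝ)) * (K * (v₂ * ((∫⁻ x, ‖G x‖ₑ ^ 2) + ∫⁻ x, ‖u x‖ₑ ^ 2)))) := by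
        gcongr
    _ = _ := by ring


/-! ### Weak compactness and local strong convergence -/

/-- Sequential Banach–Alaoglu in the dual of a separable space, transported by the Riesz
isomorphism. -/
theorem exists_weak_limit_of_bounded {E : Type*} [NormedAddCommGroup E] [InnerProductSpace ℝ E]
    [CompleteSpace E] [TopologicalSpace.SeparableSpace E] {x : ℕ → E} {B : ℝ}
    (hx : ∀ n, ‖x n‖ ≤ B) :
    ∃ (σ : ℕ → ℕ) (x₀ : E), StrictMono σ ∧
      ∀ y, Tendsto (fun n => inner ℝ (x (σ n)) y) atTop (𝓝 (inner ℝ x₀ y)) := by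
  have hc := WeakDual.isSeqCompact_closedBall ℝ E 0 B
  have hmem : ∀ n, StrongDual.toWeakDual (InnerProductSpace.toDual ℝ E (x n)) ∈
      (⇑WeakDual.toStrongDual ⁻¹' Metric.closedBall (0 : StrongDual ℝ E) B) := by
    intro n
    rw [mem_preimage, mem_closedBall_zero_iff]
    change ‖InnerProductSpace.toDual ℝ E (x n)‖ ≤ B
    rw [LinearIsometryEquiv.norm_map]
    exact hx n
  obtain ⟨a, -, σ, hσ, hlim⟩ := hc hmem
  refine ⟨σ, (InnerProductSpace.toDual ℝ E).symm (WeakDual.toStrongDual a), hσ, fun y => ?_⟩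
  have := ((WeakDual.eval_continuous y).tendsto a).comp hlim
  rw [InnerProductSpace.toDual_symm_apply]
  exact this

theorem exists_weak_limit_memLp {N : ℕ} {F : Type*} [NormedAddCommGroup F] [InnerProductSpace ℝ F]
    [CompleteSpace F] [TopologicalSpace.SeparableSpace F] {g : ℕ → Space N → F}
    (hg : ∀ n, MemLp (g n) 2 volume) {B : ℝ≥0∞} (hB : B ≠ ⊤)
    (hgB : ∀ n, eLpNorm (g n) 2 volume ≤ B) :
    ∃ (σ : ℕ → ℕ) (g₀ : Space N → F), StrictMono σ ∧ MemLp g₀ 2 volume ∧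
      ∀ h : Space N → F, MemLp h 2 volume →
        Tendsto (fun n => ∫ x, inner ℝ (g (σ n) x) (h x)) atTop (𝓝 (∫ x, inner ℝ (g₀ x) (h x))) := by
  have : Fact ((2 : ℝ≥0∞) ≠ ⊤) := ⟨by simp⟩
  obtain ⟨σ, x₀, hσ, hlim⟩ := exists_weak_limit_of_bounded (x := fun n => (hg n).toLp (g n))
    (B := B.toReal) (fun n => by
      rw [Lp.norm_toLp]
      exact ENNReal.toReal_mono hB (hgB n))
  refine ⟨σ, x₀, hσ, Lp.memLp x₀, fun h hh => ?_⟩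
  have key := hlim (hh.toLp h)
  simp only [L2.inner_def] at key
  have e1 : ∀ n, ∫ x, inner ℝ ((hg (σ n)).toLp (g (σ n)) x) (hh.toLp h x) =
      ∫ x, inner ℝ (g (σ n) x) (h x) := by
    intro n
    refine integral_congr_ae ?_
    filter_upwards [(hg (σ n)).coeFn_toLp, hh.coeFn_toLp] with x h1 h2
    rw [h1, h2]
  have e2 : ∫ x, inner ℝ (x₀ x) (hh.toLp h x) = ∫ x, inner ℝ (x₀ x) (h x) := by
    refine integral_congr_ae ?_
    filter_upwards [hh.coeFn_toLp] with x h2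
    rw [h2]
  simpa only [e1, e2] using key

theorem real_inner_eq_mul (a b : ℝ) : inner ℝ a b = a * b := by
  simp [mul_comm]

/-! ### Local compactness of bounded sequences in $H^1$ -/

section

variable {N : ℕ}

theorem memLp_normed_sub (φ : ContDiffBump (0 : Space N)) (x : Space N) :
    MemLp (fun y => φ.normed volume (x - y)) 2 volume :=
  (φ.continuous_normed.comp (continuous_const.sub continuous_id)).memLp_of_hasCompactSupport
    (φ.hasCompactSupport_normed.comp_homeomorph (Homeomorph.subLeft x))

theorem exists_sq_enorm_moll_le (φ : ContDiffBump (0 : Space N)) :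
    ∃ M : ℝ≥0∞, M ≠ ⊤ ∧ ∀ (w : Space N → ℝ), AEStronglyMeasurable w volume → ∀ x,
      ‖moll φ w x‖ₑ ^ 2 ≤ M * ∫⁻ y, ‖w y‖ₑ ^ 2 := by
  obtain ⟨M, hM⟩ := φ.continuous_normed.bounded_above_of_compact_support
    (φ.hasCompactSupport_normed (μ := volume))
  refine ⟨ENNReal.ofReal M, ENNReal.ofReal_ne_top, fun w hw x => ?_⟩
  have hw' : AEMeasurable (fun t => ‖w (x - t)‖ₑ) volume :=
    (hw.comp_quasiMeasurePreserving (quasiMeasurePreserving_sub_left volume x)).enorm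
  calc _ ≤ (∫⁻ t, mollE φ t * ‖w (x - t)‖ₑ) ^ 2 := by
        gcongr
        rw [moll_apply]
        refine (enorm_integral_le_lintegral_enorm _).trans (le_of_eq ?_)
        refine lintegral_congr fun t => ?_
        rw [enorm_smul, mollE_eq]
    _ ≤ (∫⁻ t, mollE φ t) * ∫⁻ t, mollE φ t * ‖w (x - t)‖ₑ ^ 2 :=
        sq_lintegral_mul_le (measurable_mollE φ).aemeasurable hw'
    _ = ∫⁻ t, mollE φ t * ‖w (x - t)‖ₑ ^ 2 := by rw [lintegral_mollE, one_mul]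
    _ ≤ ∫⁻ t, ENNReal.ofReal M * ‖w (x - t)‖ₑ ^ 2 := by
        refine lintegral_mono fun t => mul_le_mul_left ?_ _
        exact ENNReal.ofReal_le_ofReal ((le_abs_self _).trans (hM t))
    _ = _ := by
        rw [lintegral_const_mul' _ _ ENNReal.ofReal_ne_top,
          lintegral_sub_left_eq_self fun y => ‖w y‖ₑ ^ 2]

/-- Local strong convergence of a weakly null sequence with bounded gradients. -/
theorem tendsto_lintegral_ball_of_weak {w : ℕ → Space N → ℝ} {G : ℕ → Space N → Space N}
    (h : ∀ n, H1Pair (w n) (G n)) {B : ℝ≥0∞} (hB : B ≠ ⊤)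
    (hw : ∀ n, ∫⁻ x, ‖w n x‖ₑ ^ 2 ≤ B) (hG : ∀ n, ∫⁻ x, ‖G n x‖ₑ ^ 2 ≤ B)
    (hweak : ∀ φ : Space N → ℝ, MemLp φ 2 volume →
      Tendsto (fun n => ∫ x, w n x * φ x) atTop (𝓝 0)) (R : ℝ) :
    Tendsto (fun n => ∫⁻ x in Metric.ball 0 R, ‖w n x‖ₑ ^ 2) atTop (𝓝 0) := by
  -- For a fixed mollifier the value at $x$ is the pairing of $w_n$ with one $L^2$ function, so weak
  -- convergence gives pointwise convergence. The values are bounded uniformly in $n$ and $x$, and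
  -- dominated convergence applies on the ball.
  have step : ∀ k, Tendsto (fun n => ∫⁻ x in Metric.ball 0 R, ‖moll (bumpSeq N k) (w n) x‖ₑ ^ 2)
      atTop (𝓝 0) := by
    intro k
    obtain ⟨M, hM, hMb⟩ := exists_sq_enorm_moll_le (bumpSeq N k)
    have := tendsto_lintegral_of_dominated_convergence
      (μ := (volume : Measure (Space N)).restrict (Metric.ball 0 R))
      (F := fun n x => ‖moll (bumpSeq N k) (w n) x‖ₑ ^ 2) (f := fun _ => 0) (fun _ => M * B)
      (fun n => (contDiff_moll _ ((h n).memLp.locallyIntegrable one_le_two)).continuous.measurable.enorm.pow_const 2)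
      (fun n => Eventually.of_forall fun x => (hMb _ (h n).memLp.1 x).trans (by
        simp only
        gcongr
        exact hw n)) ?_ ?_
    · simpa using this
    · rw [lintegral_const]
      refine ENNReal.mul_ne_top (ENNReal.mul_ne_top hM hB) ?_
      rw [Measure.restrict_apply_univ]
      exact measure_ball_lt_top.ne
    · refine Eventually.of_forall fun x => ?_
      have h1 := hweak _ (memLp_normed_sub (bumpSeq N k) x)
      have h2 : ∀ n, ∫ y, w n y * (bumpSeq N k).normed volume (x - y) = moll (bumpSeq N k) (w n) x := by
        intro n
        rw [moll_apply_swap]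
        refine integral_congr_ae (Eventually.of_forall fun y => ?_)
        simp [mul_comm]
      simp only [h2] at h1
      have h3 := ((ENNReal.continuous_pow 2).tendsto _).comp h1.enorm
      simpa [Function.comp_def] using h3
  rw [ENNReal.tendsto_nhds_zero]
  intro ε hε
  -- The mollification error is at most the squared radius times $B$, uniformly in $n$, so the
  -- mollifier can be fixed before $n\to\infty$.
  have hk : Tendsto (fun k : ℕ => 2 * (ENNReal.ofReal (1 / ((k : ℝ) + 1)) ^ 2 * B)) atTop (𝓝 0) := by
    have h1 : Tendsto (fun k : ℕ => ENNReal.ofReal (1 / ((k : ℝ) + 1))) atTop (𝓝 0) := by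
      simpa using ENNReal.tendsto_ofReal tendsto_one_div_add_atTop_nhds_zero_nat
    have h2 := ((ENNReal.continuous_pow 2).tendsto _).comp h1
    have h3 := ENNReal.Tendsto.const_mul (a := 2) (ENNReal.Tendsto.mul_const h2 (Or.inr hB))
      (Or.inr (by simp))
    simpa using h3
  obtain ⟨k, hk⟩ := (ENNReal.tendsto_nhds_zero.1 hk (ε / 2) (ENNReal.half_pos hε.ne')).exists
  have h4 := ENNReal.Tendsto.const_mul (a := 2) (step k) (Or.inr (by simp))
  rw [mul_zero] at h4
  filter_upwards [ENNReal.tendsto_nhds_zero.1 h4 (ε / 2) (ENNReal.half_pos hε.ne')] with n hn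
  have hm : Measurable (moll (bumpSeq N k) (w n)) :=
    (contDiff_moll _ ((h n).memLp.locallyIntegrable one_le_two)).continuous.measurable
  calc ∫⁻ x in Metric.ball 0 R, ‖w n x‖ₑ ^ 2
      ≤ ∫⁻ x in Metric.ball 0 R, (2 * ‖moll (bumpSeq N k) (w n) x - w n x‖ₑ ^ 2 +
          2 * ‖moll (bumpSeq N k) (w n) x‖ₑ ^ 2) := by
        refine lintegral_mono fun x => ?_
        simp only [← ofReal_norm]
        rw [← ENNReal.ofReal_pow (norm_nonneg _), ← ENNReal.ofReal_pow (norm_nonneg _),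
          ← ENNReal.ofReal_pow (norm_nonneg _), ← ENNReal.ofReal_ofNat 2,
          ← ENNReal.ofReal_mul (by norm_num), ← ENNReal.ofReal_mul (by norm_num),
          ← ENNReal.ofReal_add (by positivity) (by positivity)]
        refine ENNReal.ofReal_le_ofReal ?_
        simp only [Real.norm_eq_abs, sq_abs]
        nlinarith [sq_nonneg (2 * moll (bumpSeq N k) (w n) x - w n x)]
    _ = 2 * (∫⁻ x in Metric.ball 0 R, ‖moll (bumpSeq N k) (w n) x - w n x‖ₑ ^ 2) +
          2 * ∫⁻ x in Metric.ball 0 R, ‖moll (bumpSeq N k) (w n) x‖ₑ ^ 2 := by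
        rw [lintegral_add_right _ ((hm.enorm.pow_const 2).const_mul 2),
          lintegral_const_mul' _ _ (by simp), lintegral_const_mul' _ _ (by simp)]
    _ ≤ ε / 2 + ε / 2 := by
        refine add_le_add (le_trans ?_ hk) hn
        gcongr
        refine (setLIntegral_le_lintegral _ _).trans ?_
        refine (lintegral_sq_enorm_moll_sub_le (h n) (bumpSeq N k)).trans ?_
        exact mul_le_mul_right (hG n) _
    _ = ε := ENNReal.add_halves ε

/-- Choose the $k$-th index so that the mass on the ball of radius $k$ is below the $k$-th term of a
summable series. The sum of the localised squares is then integrable, hence finite a.e., and its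
terms tend to zero; each point lies in all late balls. -/
theorem exists_subseq_ae_tendsto {w : ℕ → Space N → ℝ}
    (hwm : ∀ n, AEStronglyMeasurable (w n) volume)
    (hw : ∀ R : ℝ, Tendsto (fun n => ∫⁻ x in Metric.ball 0 R, ‖w n x‖ₑ ^ 2) atTop (𝓝 0)) :
    ∃ σ : ℕ → ℕ, StrictMono σ ∧ ∀ᵐ x, Tendsto (fun n => w (σ n) x) atTop (𝓝 0) := by
  obtain ⟨ε, hε0, hε⟩ := ENNReal.exists_pos_sum_of_countable (one_ne_zero (α := ℝ≥0∞)) ℕ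
  obtain ⟨σ, hσ, hσb⟩ := extraction_forall_of_eventually (fun k : ℕ =>
    ENNReal.tendsto_nhds_zero.1 (hw k) (ε k) (by simpa using hε0 k))
  refine ⟨σ, hσ, ?_⟩
  have hm : ∀ k : ℕ, AEMeasurable
      ((Metric.ball (0 : Space N) k).indicator fun x => ‖w (σ k) x‖ₑ ^ 2) volume := fun k =>
    ((hwm (σ k)).enorm.pow_const 2).indicator Metric.isOpen_ball.measurableSet
  have hsum : ∫⁻ x, ∑' k : ℕ,
      (Metric.ball (0 : Space N) k).indicator (fun x => ‖w (σ k) x‖ₑ ^ 2) x ≠ ⊤ := by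
    rw [lintegral_tsum hm]
    refine ne_top_of_le_ne_top ENNReal.one_ne_top (le_trans (ENNReal.tsum_le_tsum fun k => ?_) hε.le)
    rw [lintegral_indicator Metric.isOpen_ball.measurableSet]
    exact hσb k
  filter_upwards [ae_lt_top' (AEMeasurable.tsum hm) hsum] with x hx
  have h1 := ENNReal.tendsto_atTop_zero_of_tsum_ne_top hx.ne
  have h2 : Tendsto (fun k => ‖w (σ k) x‖ₑ ^ 2) atTop (𝓝 0) := by
    refine h1.congr' ?_
    obtain ⟨n₀, hn₀⟩ := exists_nat_gt ‖x‖
    filter_upwards [eventually_ge_atTop n₀] with n hn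
    refine indicator_of_mem ?_ _
    rw [mem_ball_zero_iff]
    exact hn₀.trans_le (by exact_mod_cast hn)
  have h3 := ((ENNReal.continuous_rpow_const (y := 1 / 2)).tendsto _).comp h2
  rw [ENNReal.zero_rpow_of_pos (by norm_num)] at h3
  have h4 : Tendsto (fun k => ‖w (σ k) x‖ₑ) atTop (𝓝 0) := by
    refine h3.congr fun k => ?_
    simp only [Function.comp_apply]
    rw [← ENNReal.rpow_two, ← ENNReal.rpow_mul]
    norm_num
  have h5 := (ENNReal.tendsto_toReal ENNReal.zero_ne_top).comp h4
  rw [tendsto_zero_iff_norm_tendsto_zero]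
  simpa [Function.comp_def] using h5

/-- The weak limit of the gradients is the weak gradient of the limit, because the defining identity
passes to the limit. Local strong convergence then comes from the differences $u_n-v$, and a last
extraction gives a.e. convergence. -/
theorem exists_weak_limit {u : ℕ → Space N → ℝ} {G : ℕ → Space N → Space N}
    (h : ∀ n, H1Pair (u n) (G n)) {B : ℝ≥0∞} (hB : B ≠ ⊤)
    (hu : ∀ n, eLpNorm (u n) 2 volume ≤ B) (hG : ∀ n, eLpNorm (G n) 2 volume ≤ B) :
    ∃ (σ : ℕ → ℕ) (v : Space N → ℝ) (H : Space N → Space N), StrictMono σ ∧ H1Pair v H ∧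
      (∀ φ : Space N → ℝ, MemLp φ 2 volume →
        Tendsto (fun n => ∫ x, u (σ n) x * φ x) atTop (𝓝 (∫ x, v x * φ x))) ∧
      (∀ φ : Space N → Space N, MemLp φ 2 volume →
        Tendsto (fun n => ∫ x, inner ℝ (G (σ n) x) (φ x)) atTop (𝓝 (∫ x, inner ℝ (H x) (φ x)))) ∧
      (∀ R : ℝ, Tendsto (fun n => ∫⁻ x in Metric.ball 0 R, ‖u (σ n) x - v x‖ₑ ^ 2) atTop (𝓝 0)) ∧
      ∀ᵐ x, Tendsto (fun n => u (σ n) x) atTop (𝓝 (v x)) := by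
  obtain ⟨σ₁, v, hσ₁, hv, hv1⟩ := exists_weak_limit_memLp (fun n => (h n).memLp) hB hu
  obtain ⟨σ₂, H, hσ₂, hH, hH1⟩ := exists_weak_limit_memLp (fun n => (h (σ₁ n)).memLp_grad) hB
    (fun n => hG (σ₁ n))
  simp only [real_inner_eq_mul] at hv1
  have hv2 : ∀ φ : Space N → ℝ, MemLp φ 2 volume →
      Tendsto (fun n => ∫ x, u (σ₁ (σ₂ n)) x * φ x) atTop (𝓝 (∫ x, v x * φ x)) :=
    fun φ hφ => (hv1 φ hφ).comp hσ₂.tendsto_atTop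
  have hpair : H1Pair v H := by
    refine ⟨hv, hH, fun φ hφ hc a => ?_⟩
    have l1 := hv2 _ (memLp_fderiv_apply hφ hc a 2)
    have hφa : MemLp (fun x => φ x • a) 2 volume :=
      (hφ.continuous.smul continuous_const).memLp_of_hasCompactSupport hc.smul_right
    have l2 := (hH1 _ hφa).neg
    refine tendsto_nhds_unique l1 ?_
    have e : ∀ K : Space N → Space N, ∫ x, inner ℝ (K x) (φ x • a) = ∫ x, inner ℝ (K x) a * φ x := by
      intro K
      refine integral_congr_ae (Eventually.of_forall fun x => ?_)
      simp only [real_inner_smul_right, mul_comm]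
    rw [e H] at l2
    refine l2.congr fun n => ?_
    rw [e, (h (σ₁ (σ₂ n))).integral_eq φ hφ hc a]
  have hwp : ∀ n, H1Pair (u (σ₁ (σ₂ n)) - v) (G (σ₁ (σ₂ n)) - H) := fun n => (h _).sub hpair
  have hb1 : ∀ n, eLpNorm (u (σ₁ (σ₂ n)) - v) 2 volume ≤ B + eLpNorm v 2 volume := fun n =>
    (eLpNorm_sub_le (h _).memLp.1 hv.1 one_le_two).trans (by gcongr; exact hu _)
  have hb2 : ∀ n, eLpNorm (G (σ₁ (σ₂ n)) - H) 2 volume ≤ B + eLpNorm H 2 volume := fun n =>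
    (eLpNorm_sub_le (h _).memLp_grad.1 hH.1 one_le_two).trans (by gcongr; exact hG _)
  have hloc := tendsto_lintegral_ball_of_weak hwp
    (B := (B + eLpNorm v 2 volume) ^ 2 + (B + eLpNorm H 2 volume) ^ 2)
    (ENNReal.add_ne_top.2 ⟨ENNReal.pow_ne_top (ENNReal.add_ne_top.2 ⟨hB, hv.2.ne⟩),
      ENNReal.pow_ne_top (ENNReal.add_ne_top.2 ⟨hB, hH.2.ne⟩)⟩)
    (fun n => by
      rw [← eLpNorm_two_sq]
      exact le_add_right (pow_le_pow_left₀ zero_le (hb1 n) 2))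
    (fun n => by
      rw [← eLpNorm_two_sq]
      exact le_add_left (pow_le_pow_left₀ zero_le (hb2 n) 2))
    (fun φ hφ => by
      have l := (hv2 φ hφ).sub_const (∫ x, v x * φ x)
      rw [sub_self] at l
      refine l.congr fun n => ?_
      refine (integral_sub ((h _).memLp.integrable_mul hφ) (hv.integrable_mul hφ)).symm.trans ?_
      refine integral_congr_ae (Eventually.of_forall fun x => ?_)
      simp only [Pi.sub_apply, Pi.mul_apply]
      ring)
  obtain ⟨σ₃, hσ₃, hae⟩ := exists_subseq_ae_tendsto (fun n => (hwp n).memLp.1) hloc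
  refine ⟨σ₁ ∘ σ₂ ∘ σ₃, v, H, hσ₁.comp (hσ₂.comp hσ₃), hpair,
    fun φ hφ => (hv2 φ hφ).comp hσ₃.tendsto_atTop, fun φ hφ => (hH1 φ hφ).comp hσ₃.tendsto_atTop,
    fun R => (hloc R).comp hσ₃.tendsto_atTop, ?_⟩
  filter_upwards [hae] with x hx
  simpa using hx.add_const (v x)

end


/-! ### Pointwise estimates for the nonlinearity -/

/-- The lower critical exponent `(N+α)/N`. -/
def lowExp (N : ℕ) (α : ℝ) : ℝ := ((N : ℝ) + α) / N

/-- The upper critical exponent `(N+α)/(N-2)`. -/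
def upExp (N : ℕ) (α : ℝ) : ℝ := ((N : ℝ) + α) / ((N : ℝ) - 2)

/-- The sum of the two critical powers. -/
def growth (N : ℕ) (α : ℝ) (t : ℝ) : ℝ := |t| ^ lowExp N α + |t| ^ upExp N α

section

variable {N : ℕ} {α : ℝ} {f : ℝ → ℝ}

theorem one_lt_lowExp (hN : 3 ≤ N) (hα0 : 0 < α) : 1 < lowExp N α := by
  have hN' : (3 : ℝ) ≤ N := by exact_mod_cast hN
  rw [lowExp, lt_div_iff₀ (by linarith)]
  linarith

theorem one_lt_upExp (hN : 3 ≤ N) (hα0 : 0 < α) : 1 < upExp N α := by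
  have hN' : (3 : ℝ) ≤ N := by exact_mod_cast hN
  rw [upExp, lt_div_iff₀ (by linarith)]
  linarith

theorem growth_nonneg (t : ℝ) : 0 ≤ growth N α t := by unfold growth; positivity

theorem growth_mono (hN : 3 ≤ N) (hα0 : 0 < α) {s t : ℝ} (h : |s| ≤ |t|) :
    growth N α s ≤ growth N α t := by
  have h1 := one_lt_lowExp hN hα0
  have h2 := one_lt_upExp hN hα0
  unfold growth
  gcongr

theorem growth_eq_abs_mul (hN : 3 ≤ N) (hα0 : 0 < α) (t : ℝ) :
    growth N α t = |t| * (|t| ^ (lowExp N α - 1) + |t| ^ (upExp N α - 1)) := by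
  have h1 := one_lt_lowExp hN hα0
  have h2 := one_lt_upExp hN hα0
  have key : ∀ r : ℝ, 1 < r → |t| ^ r = |t| * |t| ^ (r - 1) := by
    intro r hr
    nth_rewrite 2 [← Real.rpow_one |t|]
    rw [← Real.rpow_add_of_nonneg (abs_nonneg t) zero_le_one (by linarith)]
    congr 1
    ring
  rw [growth, key _ h1, key _ h2]
  ring

/-- For $s\ne0$ divide (F1) by $|s|$. The estimate defines a closed set, both exponents being
positive, so it extends to $s=0$. -/
theorem exists_abs_le_of_condF1 (hN : 3 ≤ N) (hα0 : 0 < α) (hf : CondF1 N α f) :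
    ∃ C₀ : ℝ, 0 < C₀ ∧
      ∀ s, |f s| ≤ C₀ * (|s| ^ (lowExp N α - 1) + |s| ^ (upExp N α - 1)) := by
  obtain ⟨hfc, C₀, hC₀, hb⟩ := hf
  have h1 := one_lt_lowExp hN hα0
  have h2 := one_lt_upExp hN hα0
  refine ⟨C₀, hC₀, ?_⟩
  have hcl : IsClosed {s : ℝ | |f s| ≤ C₀ * (|s| ^ (lowExp N α - 1) + |s| ^ (upExp N α - 1))} := by
    refine isClosed_le hfc.abs (continuous_const.mul (Continuous.add ?_ ?_))
    · exact continuous_abs.rpow_const fun x => Or.inr (by linarith)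
    · exact continuous_abs.rpow_const fun x => Or.inr (by linarith)
  have hsub : {(0 : ℝ)}ᶜ ⊆
      {s : ℝ | |f s| ≤ C₀ * (|s| ^ (lowExp N α - 1) + |s| ^ (upExp N α - 1))} := by
    intro s hs
    have hs0 : 0 < |s| := abs_pos.2 hs
    have := hb s
    rw [abs_mul] at this
    have e := growth_eq_abs_mul hN hα0 s
    rw [growth, lowExp, upExp] at e
    rw [e] at this
    refine le_of_mul_le_mul_right (this.trans (le_of_eq ?_)) hs0
    rw [lowExp, upExp]
    ring
  have := hcl.closure_subset_iff.2 hsub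
  rw [(dense_compl_singleton (0 : ℝ)).closure_eq] at this
  exact fun s => this (mem_univ s)

theorem hasDerivAt_primitive (hf : Continuous f) (t : ℝ) :
    HasDerivAt (primitive f) (f t) t :=
  intervalIntegral.integral_hasDerivAt_right (hf.intervalIntegrable _ _)
    (hf.stronglyMeasurableAtFilter _ _) hf.continuousAt

theorem continuous_primitive (hf : Continuous f) : Continuous (primitive f) :=
  continuous_iff_continuousAt.2 fun t => (hasDerivAt_primitive hf t).continuousAt

theorem primitive_zero (f : ℝ → ℝ) : primitive f 0 = 0 := by simp [primitive]

/-- The increment is $\int_s^{s+t}f$, and $|x|\le|s|+|t|$ on the interval of integration. -/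
theorem exists_abs_primitive_add_sub_le (hN : 3 ≤ N) (hα0 : 0 < α) (hf : CondF1 N α f) :
    ∃ C₀ : ℝ, 0 < C₀ ∧ ∀ s t, |primitive f (s + t) - primitive f s| ≤
      C₀ * (|t| * ((|s| + |t|) ^ (lowExp N α - 1) + (|s| + |t|) ^ (upExp N α - 1))) := by
  obtain ⟨C₀, hC₀, hb⟩ := exists_abs_le_of_condF1 hN hα0 hf
  have h1 := one_lt_lowExp hN hα0
  have h2 := one_lt_upExp hN hα0
  refine ⟨C₀, hC₀, fun s t => ?_⟩
  have e : primitive f (s + t) - primitive f s = ∫ x in s..(s + t), f x := by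
    rw [primitive, primitive, intervalIntegral.integral_interval_sub_left] <;>
      exact hf.1.intervalIntegrable _ _
  rw [e, ← Real.norm_eq_abs]
  have := intervalIntegral.norm_integral_le_of_norm_le_const (a := s) (b := s + t) (f := f)
    (C := C₀ * ((|s| + |t|) ^ (lowExp N α - 1) + (|s| + |t|) ^ (upExp N α - 1))) ?_
  · refine this.trans (le_of_eq ?_)
    rw [add_sub_cancel_left]
    ring
  · intro x hx
    have hx' : |x| ≤ |s| + |t| := by
      rw [mem_uIoc] at hx
      rcases hx with ⟨h1, h2⟩ | ⟨h1, h2⟩ <;> cases abs_cases x <;> cases abs_cases s <;>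
        cases abs_cases t <;> linarith
    refine (hb x).trans ?_
    gcongr

theorem exists_abs_primitive_le (hN : 3 ≤ N) (hα0 : 0 < α) (hf : CondF1 N α f) :
    ∃ C₀ : ℝ, 0 < C₀ ∧ ∀ t, |primitive f t| ≤ C₀ * growth N α t := by
  obtain ⟨C₀, hC₀, hb⟩ := exists_abs_primitive_add_sub_le hN hα0 hf
  refine ⟨C₀, hC₀, fun t => ?_⟩
  have := hb 0 t
  rw [zero_add, primitive_zero, sub_zero, abs_zero, zero_add] at this
  rwa [growth_eq_abs_mul hN hα0]

/-- Two cases: if $t\le\eta s$ then $s+t\le2s$, and otherwise $s+t\le(1+\eta^{-1})t$. The point is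
the small coefficient on the power of $s$. -/
theorem mul_rpow_add_le {a η : ℝ} (ha : 0 ≤ a) (hη : 0 < η) (hη1 : η ≤ 1) (s t : ℝ)
    (hs : 0 ≤ s) (ht : 0 ≤ t) :
    t * (s + t) ^ a ≤ η * 2 ^ a * s ^ (a + 1) + (1 + η⁻¹) ^ a * t ^ (a + 1) := by
  have split : ∀ r : ℝ, 0 ≤ r → r ^ (a + 1) = r * r ^ a := by
    intro r hr
    rw [Real.rpow_add_of_nonneg hr ha zero_le_one, Real.rpow_one, mul_comm]
  rw [split s hs, split t ht]
  rcases le_total t (η * s) with h | h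
  · have h1 : s + t ≤ 2 * s := by nlinarith
    have h2 : (s + t) ^ a ≤ 2 ^ a * s ^ a := by
      rw [← Real.mul_rpow (by norm_num) hs]
      exact Real.rpow_le_rpow (by positivity) h1 ha
    have h3 : t * (s + t) ^ a ≤ (η * s) * (2 ^ a * s ^ a) := by gcongr
    have h4 : 0 ≤ (1 + η⁻¹) ^ a * (t * t ^ a) := by positivity
    nlinarith
  · have h1 : s + t ≤ (1 + η⁻¹) * t := by
      have : s ≤ η⁻¹ * t := by rwa [← inv_mul_le_iff₀ (inv_pos.2 hη), inv_inv]
      linarith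
    have h2 : (s + t) ^ a ≤ (1 + η⁻¹) ^ a * t ^ a := by
      rw [← Real.mul_rpow (by positivity) ht]
      exact Real.rpow_le_rpow (by positivity) h1 ha
    have h3 : t * (s + t) ^ a ≤ t * ((1 + η⁻¹) ^ a * t ^ a) := by gcongr
    have h4 : 0 ≤ η * 2 ^ a * (s * s ^ a) := by positivity
    nlinarith

/-- The pointwise input to the Brezis–Lieb lemma: the defect of additivity is a small part of the
growth in $s$ plus a large part of that in $t$. Later $s$ is the weakly null sequence and $t$ the
fixed limit. -/
theorem exists_abs_primitive_splitting_le (hN : 3 ≤ N) (hα0 : 0 < α) (hf : CondF1 N α f)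
    {ε : ℝ} (hε : 0 < ε) :
    ∃ C : ℝ, 0 < C ∧ ∀ s t, |primitive f (s + t) - primitive f s - primitive f t| ≤
      ε * growth N α s + C * growth N α t := by
  obtain ⟨C₀, hC₀, hb⟩ := exists_abs_primitive_add_sub_le hN hα0 hf
  obtain ⟨C₁, hC₁, hb₁⟩ := exists_abs_primitive_le hN hα0 hf
  have h1 := one_lt_lowExp hN hα0
  have h2 := one_lt_upExp hN hα0
  set a := lowExp N α - 1 with ha
  set b := upExp N α - 1 with hb'
  set L : ℝ := C₀ * (2 ^ a + 2 ^ b) with hL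
  have hL0 : 0 < L := by positivity
  -- Chosen so that $C_0\eta(2^a+2^b)\le\varepsilon$, while $\eta\le1$ as `mul_rpow_add_le`
  -- requires.
  set η : ℝ := min 1 (ε / L) with hη
  have hη0 : 0 < η := lt_min one_pos (by positivity)
  have hη1 : η ≤ 1 := min_le_left _ _
  have hηL : η * L ≤ ε := by
    calc η * L ≤ ε / L * L := by gcongr; exact min_le_right _ _
      _ = ε := by field_simp
  have ea : C₀ * (η * 2 ^ a) ≤ ε := by
    refine le_trans ?_ hηL
    rw [hL]
    have : 0 ≤ η * (C₀ * 2 ^ b) := by positivity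
    nlinarith
  have eb : C₀ * (η * 2 ^ b) ≤ ε := by
    refine le_trans ?_ hηL
    rw [hL]
    have : 0 ≤ η * (C₀ * 2 ^ a) := by positivity
    nlinarith
  set A : ℝ := (1 + η⁻¹) ^ a + (1 + η⁻¹) ^ b with hA
  have pa : 0 < (1 + η⁻¹) ^ a := by positivity
  have pb : 0 < (1 + η⁻¹) ^ b := by positivity
  refine ⟨C₀ * A + C₁, by positivity, fun s t => ?_⟩
  have m1 := mul_rpow_add_le (a := a) (by linarith) hη0 hη1 |s| |t| (abs_nonneg _) (abs_nonneg _)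
  have m2 := mul_rpow_add_le (a := b) (by linarith) hη0 hη1 |s| |t| (abs_nonneg _) (abs_nonneg _)
  rw [show a + 1 = lowExp N α by simp [ha]] at m1
  rw [show b + 1 = upExp N α by simp [hb']] at m2
  have hs1 : 0 ≤ |s| ^ lowExp N α := by positivity
  have hs2 : 0 ≤ |s| ^ upExp N α := by positivity
  have ht1 : 0 ≤ |t| ^ lowExp N α := by positivity
  have ht2 : 0 ≤ |t| ^ upExp N α := by positivity
  calc _ ≤ |primitive f (s + t) - primitive f s| + |primitive f t| := abs_sub _ _
    _ ≤ C₀ * (|t| * ((|s| + |t|) ^ a + (|s| + |t|) ^ b)) + C₁ * growth N α t :=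
        add_le_add (hb s t) (hb₁ t)
    _ ≤ C₀ * ((η * 2 ^ a * |s| ^ lowExp N α + (1 + η⁻¹) ^ a * |t| ^ lowExp N α) +
          (η * 2 ^ b * |s| ^ upExp N α + (1 + η⁻¹) ^ b * |t| ^ upExp N α)) +
          C₁ * growth N α t := by
        rw [mul_add |t|]
        gcongr
    _ = (C₀ * (η * 2 ^ a) * |s| ^ lowExp N α + C₀ * (η * 2 ^ b) * |s| ^ upExp N α) +
          C₀ * ((1 + η⁻¹) ^ a * |t| ^ lowExp N α + (1 + η⁻¹) ^ b * |t| ^ upExp N α) +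
          C₁ * growth N α t := by ring
    _ ≤ (ε * |s| ^ lowExp N α + ε * |s| ^ upExp N α) +
          C₀ * (A * |t| ^ lowExp N α + A * |t| ^ upExp N α) + C₁ * growth N α t := by
        gcongr
        · rw [hA]; linarith
        · rw [hA]; linarith
    _ = ε * growth N α s + (C₀ * A + C₁) * growth N α t := by
        rw [growth, growth]
        ring

/-- By (F2) the small multiple of the critical growth suffices near zero and near infinity. On the
intermediate range $F$ is bounded and $|t|^r\ge\delta^r$, so any power $r\ge0$ absorbs it. -/
theorem exists_abs_primitive_le_eps (hN : 3 ≤ N) (hα0 : 0 < α) (hf : CondF1 N α f)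
    (hf2 : CondF2 N α f) {ε r : ℝ} (hε : 0 < ε) (hr : 0 ≤ r) :
    ∃ C : ℝ, 0 < C ∧ ∀ t, |primitive f t| ≤ ε * growth N α t + C * |t| ^ r := by
  obtain ⟨C₁, hC₁, hb₁⟩ := exists_abs_primitive_le hN hα0 hf
  obtain ⟨hsmall, hlarge⟩ := hf2
  obtain ⟨δ, hδ, hδb⟩ := Metric.eventually_nhds_iff.1 (hsmall.bound hε)
  have hl := hlarge.bound hε
  rw [eventually_sup] at hl
  obtain ⟨M₁, hM₁⟩ := eventually_atBot.1 hl.1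
  obtain ⟨M₂, hM₂⟩ := eventually_atTop.1 hl.2
  set M := max |M₁| |M₂| with hM
  have hg : ∀ t : ℝ, 0 ≤ |t| ^ lowExp N α := fun t => by positivity
  have hg' : ∀ t : ℝ, 0 ≤ |t| ^ upExp N α := fun t => by positivity
  refine ⟨C₁ * (growth N α M + 1) * (δ ^ r)⁻¹, by
    have := growth_nonneg (N := N) (α := α) M
    positivity, fun t => ?_⟩
  have hlast : 0 ≤ C₁ * (growth N α M + 1) * (δ ^ r)⁻¹ * |t| ^ r := by
    have := growth_nonneg (N := N) (α := α) M
    positivity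
  have hlarge' : ∀ t, ‖primitive f t‖ ≤ ε * ‖|t| ^ (((N : ℝ) + α) / ((N : ℝ) - 2))‖ →
      |primitive f t| ≤ ε * growth N α t := by
    intro t ht
    rw [Real.norm_eq_abs, Real.norm_of_nonneg (by positivity)] at ht
    refine ht.trans ?_
    rw [growth]
    gcongr
    exact le_add_of_nonneg_left (hg t)
  rcases lt_or_ge |t| δ with h | h
  · have := hδb (y := t) (by simpa using h)
    rw [Real.norm_eq_abs, Real.norm_of_nonneg (by positivity)] at this
    have h2 : |primitive f t| ≤ ε * growth N α t := by
      refine this.trans ?_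
      rw [growth]
      gcongr
      exact le_add_of_nonneg_right (hg' t)
    linarith
  rcases le_or_gt |t| M with h' | h'
  · have h1 : growth N α t ≤ growth N α M :=
      growth_mono hN hα0 (h'.trans (le_abs_self M))
    have h2 : 1 ≤ (δ ^ r)⁻¹ * |t| ^ r := by
      rw [inv_mul_eq_div, le_div_iff₀ (by positivity), one_mul]
      exact Real.rpow_le_rpow hδ.le h hr
    have h3 : 0 ≤ ε * growth N α t := mul_nonneg hε.le (growth_nonneg t)
    calc |primitive f t| ≤ C₁ * growth N α t := hb₁ t
      _ ≤ C₁ * (growth N α M + 1) := by gcongr; linarith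
      _ ≤ C₁ * (growth N α M + 1) * ((δ ^ r)⁻¹ * |t| ^ r) := by
        refine le_mul_of_one_le_right ?_ h2
        have := growth_nonneg (N := N) (α := α) M
        positivity
      _ ≤ _ := by linarith
  · have h2 : |primitive f t| ≤ ε * growth N α t := by
      apply hlarge'
      have m1 : |M₁| < |t| := (le_max_left _ _).trans_lt h'
      have m2 : |M₂| < |t| := (le_max_right _ _).trans_lt h'
      rcases le_total 0 t with h0 | h0
      · refine hM₂ t ?_
        rw [abs_of_nonneg h0] at m2
        exact ((le_abs_self _).trans_lt m2).le
      · refine hM₁ t ?_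
        rw [abs_of_nonpos h0] at m1
        linarith [neg_abs_le M₁]
    linarith

end


/-! ### The nonlinearity in Lebesgue spaces -/

section

variable {N : ℕ} {α : ℝ} {f : ℝ → ℝ}

/-- This and `upExp_mul` tie the growth exponents to Hardy–Littlewood–Sobolev: the lower power of
$u$ lies in the right space when $u\in L^2$, the upper one when $u$ lies in the critical Sobolev
space. -/
theorem lowExp_mul (hα0 : 0 < α) (hαN : α < N) :
    hlsE N α * ENNReal.ofReal (lowExp N α) = 2 := by
  have h1 := one_lt_hlsExp hα0 hαN
  rw [hlsE, ← ENNReal.ofReal_mul (by linarith), ← ENNReal.ofReal_ofNat 2]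
  congr 1
  rw [hlsExp, lowExp]
  have : (N : ℝ) + α ≠ 0 := by linarith
  have : (N : ℝ) ≠ 0 := by linarith
  field_simp

theorem upExp_mul (hN : 3 ≤ N) (hα0 : 0 < α) (hαN : α < N) :
    hlsE N α * ENNReal.ofReal (upExp N α) = sobE N := by
  have hN' : (3 : ℝ) ≤ N := by exact_mod_cast hN
  have h1 := one_lt_hlsExp hα0 hαN
  rw [hlsE, sobE, ← ENNReal.ofReal_mul (by linarith)]
  congr 1
  rw [hlsExp, upExp, sobExp]
  have : (N : ℝ) + α ≠ 0 := by linarith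
  have : (N : ℝ) - 2 ≠ 0 := by linarith
  field_simp

theorem eLpNorm_abs_rpow (u : Space N → ℝ) {r : ℝ} (hr : 0 < r) (p : ℝ≥0∞) :
    eLpNorm (fun x => |u x| ^ r) p volume = eLpNorm u (p * ENNReal.ofReal r) volume ^ r := by
  simpa only [Real.norm_eq_abs] using eLpNorm_norm_rpow (μ := volume) (p := p) u hr

theorem eLpNorm_growth_le (hN : 3 ≤ N) (hα0 : 0 < α) (hαN : α < N) {u : Space N → ℝ}
    (hu : AEStronglyMeasurable u volume) :
    eLpNorm (fun x => growth N α (u x)) (hlsE N α) volume ≤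
      eLpNorm u 2 volume ^ lowExp N α + eLpNorm u (sobE N) volume ^ upExp N α := by
  have h1 := one_lt_lowExp hN hα0
  have h2 := one_lt_upExp hN hα0
  have e1 := eLpNorm_abs_rpow u (zero_lt_one.trans h1) (hlsE N α)
  have e2 := eLpNorm_abs_rpow u (zero_lt_one.trans h2) (hlsE N α)
  rw [lowExp_mul hα0 hαN] at e1
  rw [upExp_mul hN hα0 hαN] at e2
  rw [← e1, ← e2]
  exact eLpNorm_add_le (hu.norm.aemeasurable.pow_const _).aestronglyMeasurable
    (hu.norm.aemeasurable.pow_const _).aestronglyMeasurable (one_le_hlsE hα0 hαN)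

theorem continuous_growth (hN : 3 ≤ N) (hα0 : 0 < α) : Continuous (growth N α) := by
  have h1 := one_lt_lowExp hN hα0
  have h2 := one_lt_upExp hN hα0
  unfold growth
  exact (continuous_abs.rpow_const fun x => Or.inr (by linarith)).add
    (continuous_abs.rpow_const fun x => Or.inr (by linarith))

theorem memLp_growth (hN : 3 ≤ N) (hα0 : 0 < α) (hαN : α < N) {u : Space N → ℝ}
    (hu : MemLp u 2 volume) (hu' : MemLp u (sobE N) volume) :
    MemLp (fun x => growth N α (u x)) (hlsE N α) volume := by
  have h1 := one_lt_lowExp hN hα0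
  have h2 := one_lt_upExp hN hα0
  refine ⟨(continuous_growth hN hα0).comp_aestronglyMeasurable hu.1, ?_⟩
  refine (eLpNorm_growth_le hN hα0 hαN hu.1).trans_lt (ENNReal.add_lt_top.2 ⟨?_, ?_⟩)
  · exact ENNReal.rpow_lt_top_of_nonneg (by linarith) hu.2.ne
  · exact ENNReal.rpow_lt_top_of_nonneg (by linarith) hu'.2.ne

theorem memLp_primitive (hN : 3 ≤ N) (hα0 : 0 < α) (hαN : α < N) (hf : CondF1 N α f)
    {u : Space N → ℝ} (hu : MemLp u 2 volume) (hu' : MemLp u (sobE N) volume) :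
    MemLp (fun x => primitive f (u x)) (hlsE N α) volume := by
  obtain ⟨C, hC, hb⟩ := exists_abs_primitive_le hN hα0 hf
  refine (memLp_growth hN hα0 hαN hu hu').of_le_mul (c := C)
    ((continuous_primitive hf.1).comp_aestronglyMeasurable hu.1) (Eventually.of_forall fun x => ?_)
  rw [Real.norm_eq_abs, Real.norm_of_nonneg (growth_nonneg _)]
  exact hb _

theorem H1Pair.memLp_primitive (hN : 3 ≤ N) (hα0 : 0 < α) (hαN : α < N) (hf : CondF1 N α f)
    {u : Space N → ℝ} {G : Space N → Space N} (h : H1Pair u G) :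
    MemLp (fun x => primitive f (u x)) (hlsE N α) volume :=
  Choquard.memLp_primitive hN hα0 hαN hf h.memLp (h.memLp_sobE hN)

theorem nonlocalTerm_eq_rieszForm (hN : 3 ≤ N) (hα0 : 0 < α) (hαN : α < N) (hf : CondF1 N α f)
    {u : Space N → ℝ} {G : Space N → Space N} (h : H1Pair u G) :
    nonlocalTerm α f u =
      rieszForm α (fun x => primitive f (u x)) (fun x => primitive f (u x)) := by
  have hp := h.memLp_primitive hN hα0 hαN hf
  exact integral_convolution_rieszKernel_mul (by omega) hα0 hαN hp hp

/-- The squared `H¹` norm. -/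
def sqNorm {N : ℕ} (u : Space N → ℝ) (G : Space N → Space N) : ℝ≥0∞ :=
  (∫⁻ x, ‖G x‖ₑ ^ 2) + ∫⁻ x, ‖u x‖ₑ ^ 2

theorem rpow_le_of_sq_le {a b : ℝ≥0∞} (h : a ^ 2 ≤ b) {r : ℝ} (hr : 0 ≤ r) :
    a ^ r ≤ b ^ (r / 2) := by
  have := ENNReal.rpow_le_rpow h (show 0 ≤ r / 2 by positivity)
  rwa [← ENNReal.rpow_two, ← ENNReal.rpow_mul, mul_div_cancel₀ _ (two_ne_zero)] at this

theorem exists_eLpNorm_growth_le_sqNorm (hN : 3 ≤ N) (hα0 : 0 < α) (hαN : α < N) :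
    ∃ K : ℝ≥0∞, K ≠ ⊤ ∧ ∀ (u : Space N → ℝ) (G : Space N → Space N), H1Pair u G →
      eLpNorm (fun x => growth N α (u x)) (hlsE N α) volume ≤
        K * (sqNorm u G ^ (lowExp N α / 2) + sqNorm u G ^ (upExp N α / 2)) := by
  obtain ⟨K, hK, H⟩ := exists_sq_eLpNorm_sobE_le hN
  have h1 := one_lt_lowExp hN hα0
  have h2 := one_lt_upExp hN hα0
  refine ⟨1 + K ^ (upExp N α / 2), ENNReal.add_ne_top.2
    ⟨by simp, ENNReal.rpow_ne_top_of_nonneg (by linarith) hK⟩, fun u G h => ?_⟩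
  refine (eLpNorm_growth_le hN hα0 hαN h.memLp.1).trans ?_
  have e1 : eLpNorm u 2 volume ^ lowExp N α ≤ sqNorm u G ^ (lowExp N α / 2) := by
    refine rpow_le_of_sq_le ?_ (by linarith)
    rw [eLpNorm_two_sq]
    exact le_add_self
  have e2 : eLpNorm u (sobE N) volume ^ upExp N α ≤
      K ^ (upExp N α / 2) * sqNorm u G ^ (upExp N α / 2) := by
    rw [← ENNReal.mul_rpow_of_nonneg _ _ (by linarith)]
    exact rpow_le_of_sq_le (H u G h) (by linarith)
  calc _ ≤ sqNorm u G ^ (lowExp N α / 2) + K ^ (upExp N α / 2) * sqNorm u G ^ (upExp N α / 2) :=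
        add_le_add e1 e2
    _ ≤ _ := by
        rw [mul_add]
        refine add_le_add ?_ ?_
        · exact le_mul_of_one_le_left zero_le le_self_add
        · exact mul_le_mul_left le_add_self _

/-- The nonlocal term is controlled by superlinear powers of the squared `H¹` norm. -/
theorem exists_abs_nonlocalTerm_le (hN : 3 ≤ N) (hα0 : 0 < α) (hαN : α < N) (hf : CondF1 N α f) :
    ∃ C : ℝ, 0 < C ∧ ∀ (u : Space N → ℝ) (G : Space N → Space N), H1Pair u G →
      |nonlocalTerm α f u| ≤
        C * ((sqNorm u G).toReal ^ (lowExp N α / 2) + (sqNorm u G).toReal ^ (upExp N α / 2)) ^ 2 := by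
  obtain ⟨K, hK, H⟩ := exists_eLpNorm_growth_le_sqNorm hN hα0 hαN
  obtain ⟨C, hC, HC⟩ := exists_abs_rieszForm_le (N := N) (by omega) hα0 hαN
  obtain ⟨C₁, hC₁, hb⟩ := exists_abs_primitive_le hN hα0 hf
  have h1 := one_lt_lowExp hN hα0
  have h2 := one_lt_upExp hN hα0
  refine ⟨C * (C₁ * (K.toReal + 1)) ^ 2, by positivity, fun u G h => ?_⟩
  have hp := h.memLp_primitive hN hα0 hαN hf
  have hfin : sqNorm u G ≠ ⊤ := by
    rw [sqNorm, ← eLpNorm_two_sq, ← eLpNorm_two_sq]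
    exact ENNReal.add_ne_top.2 ⟨ENNReal.pow_ne_top h.memLp_grad.2.ne,
      ENNReal.pow_ne_top h.memLp.2.ne⟩
  have e1 : eLpNorm (fun x => primitive f (u x)) (hlsE N α) volume ≤
      ENNReal.ofReal C₁ * (K * (sqNorm u G ^ (lowExp N α / 2) + sqNorm u G ^ (upExp N α / 2))) := by
    refine (eLpNorm_le_mul_eLpNorm_of_ae_le_mul (Eventually.of_forall fun x => ?_) _).trans
      (mul_le_mul_right (H u G h) _)
    rw [Real.norm_eq_abs, Real.norm_of_nonneg (growth_nonneg _)]
    exact hb _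
  have hlow : sqNorm u G ^ (lowExp N α / 2) ≠ ⊤ := ENNReal.rpow_ne_top_of_nonneg (by linarith) hfin
  have hup : sqNorm u G ^ (upExp N α / 2) ≠ ⊤ := ENNReal.rpow_ne_top_of_nonneg (by linarith) hfin
  have e2 := ENNReal.toReal_mono (ENNReal.mul_ne_top ENNReal.ofReal_ne_top
    (ENNReal.mul_ne_top hK (ENNReal.add_ne_top.2 ⟨hlow, hup⟩))) e1
  rw [ENNReal.toReal_mul, ENNReal.toReal_mul, ENNReal.toReal_add hlow hup,
    ENNReal.toReal_ofReal hC₁.le, ← ENNReal.toReal_rpow, ← ENNReal.toReal_rpow] at e2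
  rw [nonlocalTerm_eq_rieszForm hN hα0 hαN hf h]
  refine (HC _ _ hp hp).trans ?_
  set Y := (eLpNorm (fun x => primitive f (u x)) (hlsE N α) volume).toReal
  set Z := (sqNorm u G).toReal ^ (lowExp N α / 2) + (sqNorm u G).toReal ^ (upExp N α / 2)
  have hZ : 0 ≤ Z := by positivity
  have hY : 0 ≤ Y := ENNReal.toReal_nonneg
  have e3 : Y ≤ C₁ * (K.toReal + 1) * Z := by
    refine e2.trans ?_
    have : 0 ≤ C₁ * Z := by positivity
    nlinarith
  calc C * Y * Y = C * Y ^ 2 := by ring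
    _ ≤ C * (C₁ * (K.toReal + 1) * Z) ^ 2 := by gcongr
    _ = _ := by ring

/-- Dominated convergence in `L^p`. -/
theorem tendsto_eLpNorm_of_dominated {X : Type*} [MeasurableSpace X] {μ : Measure X} {p : ℝ≥0∞}
    (hp0 : p ≠ 0) (hpt : p ≠ ⊤) {g : ℕ → X → ℝ} {b : X → ℝ}
    (hg : ∀ n, AEStronglyMeasurable (g n) μ) (hb : MemLp b p μ)
    (hgb : ∀ n, ∀ᵐ x ∂μ, |g n x| ≤ b x) (hlim : ∀ᵐ x ∂μ, Tendsto (fun n => g n x) atTop (𝓝 0)) :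
    Tendsto (fun n => eLpNorm (g n) p μ) atTop (𝓝 0) := by
  have hpr : 0 < p.toReal := ENNReal.toReal_pos hp0 hpt
  have h := tendsto_lintegral_of_dominated_convergence' (μ := μ)
    (F := fun n x => ‖g n x‖ₑ ^ p.toReal) (f := fun _ => 0) (fun x => ‖b x‖ₑ ^ p.toReal)
    (fun n => (hg n).enorm.pow_const _) (fun n => ?_)
    (lintegral_rpow_enorm_lt_top_of_eLpNorm_lt_top hp0 hpt hb.2).ne ?_
  · rw [lintegral_zero] at h
    have h2 := ((ENNReal.continuous_rpow_const (y := 1 / p.toReal)).tendsto _).comp h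
    rw [ENNReal.zero_rpow_of_pos (by positivity)] at h2
    refine h2.congr fun n => ?_
    rw [eLpNorm_eq_lintegral_rpow_enorm_toReal hp0 hpt]
    rfl
  · filter_upwards [hgb n] with x hx
    refine ENNReal.rpow_le_rpow ?_ hpr.le
    simp only [← ofReal_norm]
    exact ENNReal.ofReal_le_ofReal (hx.trans (le_abs_self _))
  · filter_upwards [hlim] with x hx
    have := ((ENNReal.continuous_rpow_const (y := p.toReal)).tendsto _).comp hx.enorm
    simpa [hpr, Function.comp_def] using this

/-- A Brezis–Lieb lemma: the nonlinearity splits strongly in `L^p`. -/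
theorem tendsto_eLpNorm_primitive_splitting (hN : 3 ≤ N) (hα0 : 0 < α) (hαN : α < N)
    (hf : CondF1 N α f) {w : ℕ → Space N → ℝ} {v : Space N → ℝ}
    (hw : ∀ n, AEStronglyMeasurable (w n) volume) {B : ℝ≥0∞} (hB : B ≠ ⊤)
    (hwB : ∀ n, eLpNorm (fun x => growth N α (w n x)) (hlsE N α) volume ≤ B)
    (hv : MemLp v 2 volume) (hv' : MemLp v (sobE N) volume)
    (hlim : ∀ᵐ x, Tendsto (fun n => w n x) atTop (𝓝 0)) :
    Tendsto (fun n => eLpNorm (fun x => primitive f (w n x + v x) - primitive f (w n x) -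
      primitive f (v x)) (hlsE N α) volume) atTop (𝓝 0) := by
  have hFc := continuous_primitive hf.1
  set r : ℕ → Space N → ℝ := fun n x => primitive f (w n x + v x) - primitive f (w n x) -
      primitive f (v x) with hr
  have hrm : ∀ n, AEStronglyMeasurable (r n) volume := fun n =>
    ((hFc.comp_aestronglyMeasurable ((hw n).add hv.1)).sub
      (hFc.comp_aestronglyMeasurable (hw n))).sub (hFc.comp_aestronglyMeasurable hv.1)
  have hrlim : ∀ᵐ x, Tendsto (fun n => r n x) atTop (𝓝 0) := by
    filter_upwards [hlim] with x hx
    have h1 : Tendsto (fun n => primitive f (w n x + v x)) atTop (𝓝 (primitive f (0 + v x))) :=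
      (hFc.tendsto _).comp (hx.add_const _)
    have h2 : Tendsto (fun n => primitive f (w n x)) atTop (𝓝 (primitive f 0)) :=
      (hFc.tendsto _).comp hx
    have h3 := (h1.sub h2).sub_const (primitive f (v x))
    simpa [primitive_zero] using h3
  rw [ENNReal.tendsto_nhds_zero]
  intro ε hε
  obtain ⟨η, hη, hηB⟩ : ∃ η : ℝ, 0 < η ∧ ENNReal.ofReal η * B ≤ ε / 2 := by
    have h1 : Tendsto (fun k : ℕ => ENNReal.ofReal (1 / ((k : ℝ) + 1)) * B) atTop (𝓝 0) := by
      have := ENNReal.tendsto_ofReal (tendsto_one_div_add_atTop_nhds_zero_nat (𝕜 := ℝ))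
      simpa using ENNReal.Tendsto.mul_const this (Or.inr hB)
    obtain ⟨k, hk⟩ := (ENNReal.tendsto_nhds_zero.1 h1 (ε / 2) (ENNReal.half_pos hε.ne')).exists
    exact ⟨_, by positivity, hk⟩
  obtain ⟨C, hC, hs⟩ := exists_abs_primitive_splitting_le hN hα0 hf hη
  -- The truncated remainder is dominated by a fixed $p$-integrable function and tends to zero a.e.
  -- What the truncation removes is at most $\eta$ times the growth of $w_n$, whose norm is bounded.
  set m : ℕ → Space N → ℝ := fun n x => min |r n x| (C * growth N α (v x)) with hm
  have hgv := memLp_growth hN hα0 hαN hv hv'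
  have hmm : ∀ n, AEStronglyMeasurable (m n) volume := fun n =>
    (hrm n).norm.inf (hgv.1.const_mul C)
  have hmlim := tendsto_eLpNorm_of_dominated (hlsE_ne_zero hα0 hαN) (hlsE_ne_top N α)
    hmm (hgv.const_mul C) (fun n => Eventually.of_forall fun x => by
      have h0 : 0 ≤ m n x :=
        le_min (abs_nonneg _) (mul_nonneg hC.le (growth_nonneg _))
      rw [abs_of_nonneg h0]
      exact min_le_right _ _) (by
      filter_upwards [hrlim] with x hx
      have h1 := (hx.abs).min (tendsto_const_nhds (x := C * growth N α (v x)))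
      rw [abs_zero, min_eq_left (mul_nonneg hC.le (growth_nonneg _))] at h1
      exact h1)
  filter_upwards [ENNReal.tendsto_nhds_zero.1 hmlim (ε / 2) (ENNReal.half_pos hε.ne')] with n hn
  have hgw : AEStronglyMeasurable (fun x => growth N α (w n x)) volume :=
    (continuous_growth hN hα0).comp_aestronglyMeasurable (hw n)
  calc eLpNorm (r n) (hlsE N α) volume
      ≤ eLpNorm (m n + fun x => η * growth N α (w n x)) (hlsE N α) volume := by
        refine eLpNorm_mono_real fun x => ?_
        simp only [Pi.add_apply, Real.norm_eq_abs, hm]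
        have h1 := hs (w n x) (v x)
        have h2 : 0 ≤ η * growth N α (w n x) := mul_nonneg hη.le (growth_nonneg _)
        rcases min_cases |r n x| (C * growth N α (v x)) with ⟨h3, -⟩ | ⟨h3, -⟩ <;> rw [h3]
        · linarith
        · linarith
    _ ≤ eLpNorm (m n) (hlsE N α) volume +
          eLpNorm (fun x => η * growth N α (w n x)) (hlsE N α) volume :=
        eLpNorm_add_le (hmm n) (hgw.const_mul η) (one_le_hlsE hα0 hαN)
    _ ≤ ε / 2 + ε / 2 := by
        refine add_le_add hn (le_trans ?_ hηB)
        have : eLpNorm (fun x => η * growth N α (w n x)) (hlsE N α) volume =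
            ENNReal.ofReal η * eLpNorm (fun x => growth N α (w n x)) (hlsE N α) volume := by
          have := eLpNorm_const_smul (μ := volume) (p := hlsE N α) η
            (fun x => growth N α (w n x))
          rw [Real.enorm_of_nonneg hη.le] at this
          exact this
        rw [this]
        gcongr
        exact hwB n
    _ = ε := ENNReal.add_halves ε

/-- Splitting of the nonlocal term along a sequence converging weakly. -/
theorem tendsto_nonlocalTerm_splitting (hN : 3 ≤ N) (hα0 : 0 < α) (hαN : α < N)
    (hf : CondF1 N α f) {w : ℕ → Space N → ℝ} {G : ℕ → Space N → Space N} {v : Space N → ℝ}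
    {H : Space N → Space N} (hw : ∀ n, H1Pair (w n) (G n)) (hv : H1Pair v H) {B : ℝ≥0∞}
    (hB : B ≠ ⊤) (hwB : ∀ n, sqNorm (w n) (G n) ≤ B)
    (hlim : ∀ᵐ x, Tendsto (fun n => w n x) atTop (𝓝 0)) :
    Tendsto (fun n => nonlocalTerm α f (w n + v) - nonlocalTerm α f (w n)) atTop
      (𝓝 (nonlocalTerm α f v)) := by
  obtain ⟨K, hK, HK⟩ := exists_eLpNorm_growth_le_sqNorm hN hα0 hαN
  obtain ⟨C, hC, HC⟩ := exists_abs_rieszForm_le (N := N) (by omega) hα0 hαN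
  obtain ⟨C₁, hC₁, hb⟩ := exists_abs_primitive_le hN hα0 hf
  have h1 := one_lt_lowExp hN hα0
  have h2 := one_lt_upExp hN hα0
  have hN1 : 1 ≤ N := by omega
  set B₁ : ℝ≥0∞ := K * (B ^ (lowExp N α / 2) + B ^ (upExp N α / 2)) with hB₁
  have hB₁t : B₁ ≠ ⊤ := ENNReal.mul_ne_top hK (ENNReal.add_ne_top.2
    ⟨ENNReal.rpow_ne_top_of_nonneg (by linarith) hB, ENNReal.rpow_ne_top_of_nonneg (by linarith) hB⟩)
  have hgB : ∀ n, eLpNorm (fun x => growth N α (w n x)) (hlsE N α) volume ≤ B₁ := fun n => by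
    refine (HK _ _ (hw n)).trans ?_
    rw [hB₁]
    have := hwB n
    gcongr
  have hkB : ∀ n, eLpNorm (fun x => primitive f (w n x)) (hlsE N α) volume ≤
      ENNReal.ofReal C₁ * B₁ := fun n => by
    refine (eLpNorm_le_mul_eLpNorm_of_ae_le_mul (Eventually.of_forall fun x => ?_) _).trans
      (mul_le_mul_right (hgB n) _)
    rw [Real.norm_eq_abs, Real.norm_of_nonneg (growth_nonneg _)]
    exact hb _
  have hsplit := tendsto_eLpNorm_primitive_splitting hN hα0 hαN hf (fun n => (hw n).memLp.1) hB₁t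
    hgB hv.memLp (hv.memLp_sobE hN) hlim
  set k : ℕ → Space N → ℝ := fun n x => primitive f (w n x) with hk
  set h : Space N → ℝ := fun x => primitive f (v x) with hh
  set g : ℕ → Space N → ℝ := fun n x => primitive f ((w n + v) x) with hg
  have hkp : ∀ n, MemLp (k n) (hlsE N α) volume := fun n => (hw n).memLp_primitive hN hα0 hαN hf
  have hhp : MemLp h (hlsE N α) volume := hv.memLp_primitive hN hα0 hαN hf
  have hgp : ∀ n, MemLp (g n) (hlsE N α) volume := fun n =>
    ((hw n).add hv).memLp_primitive hN hα0 hαN hf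
  set r : ℕ → Space N → ℝ := fun n => g n - k n - h with hr
  have hrp : ∀ n, MemLp (r n) (hlsE N α) volume := fun n => ((hgp n).sub (hkp n)).sub hhp
  have hr0 : Tendsto (fun n => (eLpNorm (r n) (hlsE N α) volume).toReal) atTop (𝓝 0) :=
    (ENNReal.tendsto_toReal ENNReal.zero_ne_top).comp hsplit
  -- The term pairing $F(w_n)$ with $F(v)$ does not vanish by norm convergence; it does because
  -- $F(w_n)$ is bounded and tends to zero a.e., hence weakly.
  have hcross := tendsto_rieszForm_zero hN1 hα0 hαN hkp
    (ENNReal.mul_ne_top ENNReal.ofReal_ne_top hB₁t) hkB (by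
      filter_upwards [hlim] with x hx
      have := ((continuous_primitive hf.1).tendsto 0).comp hx
      rw [primitive_zero] at this
      exact this) hhp
  have hrr : Tendsto (fun n => rieszForm α (r n) (r n)) atTop (𝓝 0) := by
    refine squeeze_zero_norm (fun n => HC _ _ (hrp n) (hrp n)) ?_
    simpa using (hr0.const_mul C).mul hr0
  have hrh : Tendsto (fun n => rieszForm α (r n) h) atTop (𝓝 0) := by
    refine squeeze_zero_norm (fun n => HC _ _ (hrp n) hhp) ?_
    simpa using (hr0.const_mul C).mul_const (eLpNorm h (hlsE N α) volume).toReal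
  have hrk : Tendsto (fun n => rieszForm α (r n) (k n)) atTop (𝓝 0) := by
    refine squeeze_zero_norm (a := fun n => C * (eLpNorm (r n) (hlsE N α) volume).toReal *
      (ENNReal.ofReal C₁ * B₁).toReal) (fun n => (HC _ _ (hrp n) (hkp n)).trans ?_) ?_
    · gcongr
      · exact ENNReal.mul_ne_top ENNReal.ofReal_ne_top hB₁t
      · exact hkB n
    · simpa using (hr0.const_mul C).mul_const (ENNReal.ofReal C₁ * B₁).toReal
  have hsum := ((((hrr.add (hrh.const_mul 2)).add (hrk.const_mul 2)).add
    (hcross.const_mul 2)).add_const (rieszForm α h h))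
  simp only [mul_zero, add_zero, zero_add] at hsum
  rw [nonlocalTerm_eq_rieszForm hN hα0 hαN hf hv]
  refine hsum.congr fun n => ?_
  rw [nonlocalTerm_eq_rieszForm hN hα0 hαN hf ((hw n).add hv),
    nonlocalTerm_eq_rieszForm hN hα0 hαN hf (hw n)]
  -- With $F(w_n+v)=r_n+F(w_n)+F(v)$, expanding the form leaves $F(v)$ against itself plus terms
  -- containing $r_n$ and one cross term, all of which tend to zero.
  have hgn : g n = r n + (k n + h) := by
    rw [hr]
    simp
  change _ = rieszForm α (g n) (g n) - rieszForm α (k n) (k n)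
  rw [hgn, rieszForm_add_left hN1 hα0 hαN (hrp n) ((hkp n).add hhp) ((hrp n).add ((hkp n).add hhp)),
    rieszForm_add_right hN1 hα0 hαN (hrp n) (hrp n) ((hkp n).add hhp),
    rieszForm_add_right hN1 hα0 hαN ((hkp n).add hhp) (hrp n) ((hkp n).add hhp),
    rieszForm_add_right hN1 hα0 hαN (hrp n) (hkp n) hhp,
    rieszForm_add_right hN1 hα0 hαN ((hkp n).add hhp) (hkp n) hhp,
    rieszForm_add_left hN1 hα0 hαN (hkp n) hhp (hrp n),
    rieszForm_add_left hN1 hα0 hαN (hkp n) hhp (hkp n),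
    rieszForm_add_left hN1 hα0 hαN (hkp n) hhp hhp, rieszForm_comm (k n) (r n),
    rieszForm_comm h (r n), rieszForm_comm h (k n)]
  ring

end


/-! ### Nonvanishing, differentiability and scaling of the nonlocal term -/

section

variable {N : ℕ} {α : ℝ} {f : ℝ → ℝ}

/-- If every ball of radius $2$ carried little mass, Lions' lemma would make the norm of exponent
`midExp` small. By (F2), $F(u)$ is a small multiple of the critical growth plus a power controlled
by that norm, so the nonlocal term would fall below $c$. The threshold depends only on $B$ and $c$.
-/
theorem exists_mass_of_le_nonlocalTerm (hN : 3 ≤ N) (hα0 : 0 < α) (hαN : α < N)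
    (hf : CondF1 N α f) (hf2 : CondF2 N α f) {B : ℝ≥0∞} (hB : B ≠ ⊤) {c : ℝ} (hc : 0 < c) :
    ∃ δ : ℝ≥0∞, δ ≠ 0 ∧ ∀ (u : Space N → ℝ) (G : Space N → Space N), H1Pair u G →
      sqNorm u G ≤ B → c ≤ nonlocalTerm α f u →
      ∃ a, δ ≤ ∫⁻ x in Metric.ball a 2, ‖u x‖ₑ ^ 2 := by
  obtain ⟨K, hK, HK⟩ := exists_eLpNorm_growth_le_sqNorm hN hα0 hαN
  obtain ⟨C, hC, HC⟩ := exists_abs_rieszForm_le (N := N) (by omega) hα0 hαN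
  obtain ⟨C₂, hC₂, HL⟩ := exists_lintegral_midExp_le hN
  have h1 := one_lt_lowExp hN hα0
  have h2 := one_lt_upExp hN hα0
  have hp1 := one_lt_hlsExp hα0 hαN
  have hN' : (3 : ℝ) ≤ N := by exact_mod_cast hN
  have hp0 : 0 < hlsExp N α := by linarith
  have hq0 : 0 < midExp N := by unfold midExp; positivity
  set B₁ : ℝ≥0∞ := K * (B ^ (lowExp N α / 2) + B ^ (upExp N α / 2)) with hB₁
  have hB₁t : B₁ ≠ ⊤ := ENNReal.mul_ne_top hK (ENNReal.add_ne_top.2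
    ⟨ENNReal.rpow_ne_top_of_nonneg (by linarith) hB, ENNReal.rpow_ne_top_of_nonneg (by linarith) hB⟩)
  -- The target size of $F(u)$ in the Hardy–Littlewood–Sobolev norm, small enough that the form
  -- stays below $c$.
  obtain ⟨η, hη, hηc⟩ : ∃ η : ℝ, 0 < η ∧ C * η * η < c := by
    refine ⟨min 1 (c / (2 * C)), by positivity, ?_⟩
    have a1 : min 1 (c / (2 * C)) ≤ 1 := min_le_left _ _
    have a2 : min 1 (c / (2 * C)) ≤ c / (2 * C) := min_le_right _ _
    have a3 : 0 < min 1 (c / (2 * C)) := by positivity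
    calc C * min 1 (c / (2 * C)) * min 1 (c / (2 * C)) ≤ C * (c / (2 * C)) * 1 := by gcongr
      _ = c / 2 := by field_simp
      _ < c := by linarith
  have hseq : Tendsto (fun k : ℕ => ENNReal.ofReal (1 / ((k : ℝ) + 1))) atTop (𝓝 0) := by
    simpa using ENNReal.tendsto_ofReal (tendsto_one_div_add_atTop_nhds_zero_nat (𝕜 := ℝ))
  have hη2 : 0 < ENNReal.ofReal η / 2 := ENNReal.half_pos (by simpa using hη)
  obtain ⟨ε, hε, hεB⟩ : ∃ ε : ℝ, 0 < ε ∧ ENNReal.ofReal ε * B₁ ≤ ENNReal.ofReal η / 2 := by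
    have h3 : Tendsto (fun k : ℕ => ENNReal.ofReal (1 / ((k : ℝ) + 1)) * B₁) atTop (𝓝 0) := by
      simpa using ENNReal.Tendsto.mul_const hseq (Or.inr hB₁t)
    obtain ⟨k, hk⟩ := (ENNReal.tendsto_nhds_zero.1 h3 _ hη2).exists
    exact ⟨_, by positivity, hk⟩
  -- The power is chosen so that the `hlsExp` norm of $|u|^r$ is computed from the integral of $|u|$
  -- to the power `midExp`.
  obtain ⟨Cε, hCε, hFε⟩ := exists_abs_primitive_le_eps hN hα0 hf hf2 hε
    (r := midExp N / hlsExp N α) (by positivity)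
  obtain ⟨δ, hδ, hδB⟩ : ∃ δ : ℝ≥0∞, δ ≠ 0 ∧ ENNReal.ofReal Cε *
      (C₂ * δ ^ (2 / (N : ℝ)) * B) ^ (1 / hlsExp N α) ≤ ENNReal.ofReal η / 2 := by
    have h3 := ((ENNReal.continuous_rpow_const (y := 2 / (N : ℝ))).tendsto _).comp hseq
    rw [ENNReal.zero_rpow_of_pos (by positivity)] at h3
    have h4 := ENNReal.Tendsto.mul_const (ENNReal.Tendsto.const_mul h3 (Or.inr hC₂)) (Or.inr hB)
    rw [mul_zero, zero_mul] at h4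
    have h5 := ((ENNReal.continuous_rpow_const (y := 1 / hlsExp N α)).tendsto _).comp h4
    rw [ENNReal.zero_rpow_of_pos (by positivity)] at h5
    have h6 := ENNReal.Tendsto.const_mul h5 (Or.inr (ENNReal.ofReal_ne_top (r := Cε)))
    rw [mul_zero] at h6
    obtain ⟨k, hk⟩ := (ENNReal.tendsto_nhds_zero.1 h6 _ hη2).exists
    exact ⟨_, by simpa using by positivity, hk⟩
  refine ⟨δ, hδ, fun u G h hBu hcD => ?_⟩
  by_contra! hcon
  have hmid := HL u G h δ fun a => (hcon a).le
  have hp := h.memLp_primitive hN hα0 hαN hf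
  have hgB : eLpNorm (fun x => growth N α (u x)) (hlsE N α) volume ≤ B₁ := by
    refine (HK _ _ h).trans ?_
    rw [hB₁]
    gcongr
  have hgm : AEStronglyMeasurable (fun x => growth N α (u x)) volume :=
    (continuous_growth hN hα0).comp_aestronglyMeasurable h.memLp.1
  have hrm : AEStronglyMeasurable (fun x => |u x| ^ (midExp N / hlsExp N α)) volume :=
    (h.memLp.1.norm.aemeasurable.pow_const _).aestronglyMeasurable
  have hr : eLpNorm (fun x => |u x| ^ (midExp N / hlsExp N α)) (hlsE N α) volume ≤
      (C₂ * δ ^ (2 / (N : ℝ)) * B) ^ (1 / hlsExp N α) := by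
    rw [eLpNorm_eq_lintegral_rpow_enorm_toReal (hlsE_ne_zero hα0 hαN) (hlsE_ne_top N α),
      hlsE_toReal hα0 hαN]
    refine ENNReal.rpow_le_rpow ?_ (by positivity)
    have e : ∀ x, ‖|u x| ^ (midExp N / hlsExp N α)‖ₑ ^ hlsExp N α = ‖u x‖ₑ ^ midExp N := by
      intro x
      rw [Real.enorm_of_nonneg (by positivity), ← ofReal_norm, Real.norm_eq_abs,
        ENNReal.ofReal_rpow_of_nonneg (by positivity) hp0.le,
        ENNReal.ofReal_rpow_of_nonneg (abs_nonneg _) hq0.le, ← Real.rpow_mul (abs_nonneg _),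
        div_mul_cancel₀ _ hp0.ne']
    simp_rw [e]
    refine hmid.trans ?_
    exact mul_le_mul_right hBu _
  have hF : eLpNorm (fun x => primitive f (u x)) (hlsE N α) volume ≤ ENNReal.ofReal η := by
    calc _ ≤ eLpNorm ((fun x => ε * growth N α (u x)) +
          fun x => Cε * |u x| ^ (midExp N / hlsExp N α)) (hlsE N α) volume :=
          eLpNorm_mono_real fun x => hFε (u x)
      _ ≤ eLpNorm (ε • fun x => growth N α (u x)) (hlsE N α) volume +
          eLpNorm (Cε • fun x => |u x| ^ (midExp N / hlsExp N α)) (hlsE N α) volume :=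
          eLpNorm_add_le (hgm.const_mul ε) (hrm.const_mul Cε) (one_le_hlsE hα0 hαN)
      _ ≤ ENNReal.ofReal η / 2 + ENNReal.ofReal η / 2 := by
          rw [eLpNorm_const_smul, eLpNorm_const_smul, Real.enorm_of_nonneg hε.le,
            Real.enorm_of_nonneg hCε.le]
          exact add_le_add ((mul_le_mul_right hgB _).trans hεB)
            ((mul_le_mul_right hr _).trans hδB)
      _ = _ := ENNReal.add_halves _
  have hY : (eLpNorm (fun x => primitive f (u x)) (hlsE N α) volume).toReal ≤ η := by
    have := ENNReal.toReal_mono ENNReal.ofReal_ne_top hF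
    rwa [ENNReal.toReal_ofReal hη.le] at this
  have h7 := HC _ _ hp hp
  rw [← nonlocalTerm_eq_rieszForm hN hα0 hαN hf h] at h7
  have h8 : C * (eLpNorm (fun x => primitive f (u x)) (hlsE N α) volume).toReal *
      (eLpNorm (fun x => primitive f (u x)) (hlsE N α) volume).toReal ≤ C * η * η := by gcongr
  linarith [le_abs_self (nonlocalTerm α f u)]

/-- One majorant, the growth of $|a|+|b|$, for both the difference quotients of $F$ and their limit
$f(a)b$; it is $p$-integrable when $a$ and $b$ are values of $H^1$ functions. -/
theorem exists_abs_mul_le_growth (hN : 3 ≤ N) (hα0 : 0 < α) (hf : CondF1 N α f) :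
    ∃ C : ℝ, 0 < C ∧
      (∀ a b s : ℝ, |s| ≤ 1 → |primitive f (a + s * b) - primitive f a| ≤
        C * |s| * growth N α (|a| + |b|)) ∧
      ∀ a b : ℝ, |f a * b| ≤ C * growth N α (|a| + |b|) := by
  obtain ⟨C₀, hC₀, hb⟩ := exists_abs_primitive_add_sub_le hN hα0 hf
  obtain ⟨C₁, hC₁, hb₁⟩ := exists_abs_le_of_condF1 hN hα0 hf
  have h1 := one_lt_lowExp hN hα0
  have h2 := one_lt_upExp hN hα0
  refine ⟨C₀ + C₁, by positivity, fun a b s hs => ?_, fun a b => ?_⟩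
  · have hsb : |s * b| ≤ |b| := by
      rw [abs_mul]
      exact mul_le_of_le_one_left (abs_nonneg _) hs
    have hab : |b| ≤ |a| + |b| := le_add_of_nonneg_left (abs_nonneg _)
    rw [growth_eq_abs_mul hN hα0, abs_of_nonneg (by positivity : 0 ≤ |a| + |b|)]
    calc _ ≤ C₀ * (|s * b| * ((|a| + |s * b|) ^ (lowExp N α - 1) +
          (|a| + |s * b|) ^ (upExp N α - 1))) := hb a (s * b)
      _ ≤ C₀ * ((|s| * (|a| + |b|)) * ((|a| + |b|) ^ (lowExp N α - 1) +
          (|a| + |b|) ^ (upExp N α - 1))) := by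
          have : |s * b| ≤ |s| * (|a| + |b|) := by
            rw [abs_mul]
            gcongr
          gcongr
      _ = C₀ * |s| * ((|a| + |b|) * ((|a| + |b|) ^ (lowExp N α - 1) +
          (|a| + |b|) ^ (upExp N α - 1))) := by ring
      _ ≤ _ := by
          gcongr
          linarith
  · rw [growth_eq_abs_mul hN hα0, abs_of_nonneg (by positivity : 0 ≤ |a| + |b|), abs_mul]
    calc |f a| * |b| ≤ C₁ * (|a| ^ (lowExp N α - 1) + |a| ^ (upExp N α - 1)) * (|a| + |b|) := by
          gcongr
          · exact hb₁ a
          · exact le_add_of_nonneg_left (abs_nonneg _)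
      _ ≤ C₁ * ((|a| + |b|) ^ (lowExp N α - 1) + (|a| + |b|) ^ (upExp N α - 1)) * (|a| + |b|) := by
          gcongr
          · exact le_add_of_nonneg_right (abs_nonneg _)
          · exact le_add_of_nonneg_right (abs_nonneg _)
      _ = C₁ * ((|a| + |b|) * ((|a| + |b|) ^ (lowExp N α - 1) +
          (|a| + |b|) ^ (upExp N α - 1))) := by ring
      _ ≤ _ := by
          gcongr
          linarith

theorem memLp_growth_abs_add (hN : 3 ≤ N) (hα0 : 0 < α) (hαN : α < N) {u φ : Space N → ℝ}
    {G H : Space N → Space N} (hu : H1Pair u G) (hφ : H1Pair φ H) :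
    MemLp (fun x => growth N α (|u x| + |φ x|)) (hlsE N α) volume :=
  memLp_growth hN hα0 hαN (hu.memLp.norm.add hφ.memLp.norm)
    ((hu.memLp_sobE hN).norm.add (hφ.memLp_sobE hN).norm)

theorem memLp_comp_mul (hN : 3 ≤ N) (hα0 : 0 < α) (hαN : α < N) (hf : CondF1 N α f)
    {u φ : Space N → ℝ} {G H : Space N → Space N} (hu : H1Pair u G) (hφ : H1Pair φ H) :
    MemLp (fun x => f (u x) * φ x) (hlsE N α) volume := by
  obtain ⟨C, hC, -, hb⟩ := exists_abs_mul_le_growth hN hα0 hf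
  refine (memLp_growth_abs_add hN hα0 hαN hu hφ).of_le_mul (c := C)
    ((hf.1.comp_aestronglyMeasurable hu.memLp.1).mul hφ.memLp.1) (Eventually.of_forall fun x => ?_)
  rw [Real.norm_eq_abs, Real.norm_of_nonneg (growth_nonneg _)]
  exact hb _ _

/-- The directional derivative of the nonlocal term. -/
theorem tendsto_nonlocalTerm_div (hN : 3 ≤ N) (hα0 : 0 < α) (hαN : α < N) (hf : CondF1 N α f)
    {u φ : Space N → ℝ} {G H : Space N → Space N} (hu : H1Pair u G) (hφ : H1Pair φ H)
    {s : ℕ → ℝ} (hs0 : ∀ n, s n ≠ 0) (hs1 : ∀ n, |s n| ≤ 1) (hs : Tendsto s atTop (𝓝 0)) :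
    Tendsto (fun n => (nonlocalTerm α f (u + s n • φ) - nonlocalTerm α f u) / s n) atTop
      (𝓝 (2 * rieszForm α (fun x => primitive f (u x)) fun x => f (u x) * φ x)) := by
  obtain ⟨C, hC, hb1, hb2⟩ := exists_abs_mul_le_growth hN hα0 hf
  have hN1 : 1 ≤ N := by omega
  have hFc := continuous_primitive hf.1
  have hgr := memLp_growth_abs_add hN hα0 hαN hu hφ
  set g : Space N → ℝ := fun x => primitive f (u x) with hg
  set ψ : Space N → ℝ := fun x => f (u x) * φ x with hψ
  set k : ℕ → Space N → ℝ := fun n x => primitive f ((u + s n • φ) x) with hk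
  have hgp : MemLp g (hlsE N α) volume := hu.memLp_primitive hN hα0 hαN hf
  have hψp : MemLp ψ (hlsE N α) volume := memLp_comp_mul hN hα0 hαN hf hu hφ
  have hkp : ∀ n, MemLp (k n) (hlsE N α) volume := fun n =>
    (hu.add (hφ.const_smul (s n))).memLp_primitive hN hα0 hαN hf
  -- By symmetry $B(k,k)-B(g,g)=B(k-g,k+g)$, so the quotient is $B(d_n,k_n+g)$. Dominated
  -- convergence gives $d_n\to f(u)\varphi$ and $k_n+g\to2g$ in norm.
  set d : ℕ → Space N → ℝ := fun n => (s n)⁻¹ • (k n - g) with hd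
  have hdp : ∀ n, MemLp (d n) (hlsE N α) volume := fun n => ((hkp n).sub hgp).const_smul _
  have hdiff : ∀ n x, |k n x - g x| ≤ C * |s n| * growth N α (|u x| + |φ x|) := fun n x => by
    have := hb1 (u x) (φ x) (s n) (hs1 n)
    simpa [hk, hg] using this
  have hdb : ∀ n x, |d n x| ≤ C * growth N α (|u x| + |φ x|) := fun n x => by
    simp only [hd, Pi.smul_apply, Pi.sub_apply, smul_eq_mul, abs_mul, abs_inv]
    rw [inv_mul_le_iff₀ (abs_pos.2 (hs0 n))]
    refine (hdiff n x).trans (le_of_eq ?_)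
    ring
  have hkg : Tendsto (fun n => eLpNorm (k n - g) (hlsE N α) volume) atTop (𝓝 0) := by
    refine tendsto_eLpNorm_of_dominated (hlsE_ne_zero hα0 hαN) (hlsE_ne_top N α)
      (fun n => ((hkp n).sub hgp).1) (hgr.const_mul C) (fun n => Eventually.of_forall fun x => ?_)
      (Eventually.of_forall fun x => ?_)
    · refine (hdiff n x).trans ?_
      refine mul_le_mul_of_nonneg_right ?_ (growth_nonneg _)
      exact mul_le_of_le_one_right hC.le (hs1 n)
    · refine squeeze_zero_norm (fun n => hdiff n x) ?_
      have := ((hs.abs.const_mul C)).mul_const (growth N α (|u x| + |φ x|))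
      simpa using this
  have hdψ : Tendsto (fun n => eLpNorm (d n - ψ) (hlsE N α) volume) atTop (𝓝 0) := by
    refine tendsto_eLpNorm_of_dominated (hlsE_ne_zero hα0 hαN) (hlsE_ne_top N α)
      (fun n => ((hdp n).sub hψp).1) (hgr.const_mul (2 * C))
      (fun n => Eventually.of_forall fun x => ?_) (Eventually.of_forall fun x => ?_)
    · have h1 := hdb n x
      have h2 := hb2 (u x) (φ x)
      have h3 : |(d n - ψ) x| ≤ |d n x| + |ψ x| := abs_sub _ _
      have h4 : |ψ x| = |f (u x) * φ x| := rfl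
      linarith
    · have hder : HasDerivAt (fun t : ℝ => primitive f (u x + t * φ x)) (f (u x) * φ x) 0 := by
        have h1 : HasDerivAt (fun t : ℝ => u x + t * φ x) (φ x) 0 := by
          simpa using ((hasDerivAt_id (0 : ℝ)).mul_const (φ x)).const_add (u x)
        have h2 := hasDerivAt_primitive hf.1 (u x + 0 * φ x)
        have h3 := HasDerivAt.comp (h₂ := primitive f) (0 : ℝ) h2 h1
        rw [zero_mul, add_zero] at h3
        exact h3
      have h4 := hasDerivAt_iff_tendsto_slope_zero.1 hder
      have h5 : Tendsto s atTop (𝓝[≠] 0) :=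
        tendsto_nhdsWithin_iff.2 ⟨hs, Eventually.of_forall fun n => hs0 n⟩
      have h6 := (h4.comp h5).sub_const (f (u x) * φ x)
      rw [sub_self] at h6
      refine h6.congr fun n => ?_
      simp [hd, hk, hg, hψ]
  have hkgg : Tendsto (fun n => eLpNorm ((k n + g) - ((2 : ℝ) • g)) (hlsE N α) volume) atTop
      (𝓝 0) := by
    refine hkg.congr fun n => ?_
    congr 1
    ext x
    simp
    ring
  have hlim := tendsto_rieszForm hN1 hα0 hαN hdp (fun n => (hkp n).add hgp) hψp (hgp.const_smul 2)
    hdψ hkgg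
  have e0 : rieszForm α ψ ((2 : ℝ) • g) = 2 * rieszForm α g ψ := by
    rw [rieszForm_comm, rieszForm_smul_left]
  rw [e0] at hlim
  refine hlim.congr fun n => ?_
  rw [nonlocalTerm_eq_rieszForm hN hα0 hαN hf hu,
    nonlocalTerm_eq_rieszForm hN hα0 hαN hf (hu.add (hφ.const_smul (s n)))]
  change _ = (rieszForm α (k n) (k n) - rieszForm α g g) / s n
  rw [hd, rieszForm_smul_left, rieszForm_sub_left hN1 hα0 hαN (hkp n) hgp ((hkp n).add hgp),
    rieszForm_add_right hN1 hα0 hαN (hkp n) (hkp n) hgp,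
    rieszForm_add_right hN1 hα0 hαN hgp (hkp n) hgp, rieszForm_comm g (k n)]
  field_simp
  ring

/-! ### Behaviour of the nonlocal term under dilation, translation and change on null sets -/

theorem rieszConv_apply (u : Space N → ℝ) (x : Space N) :
    rieszConv α f u x = ∫ y, rieszKernel N α (x - y) * primitive f (u y) :=
  convolution_rieszKernel _ x

/-- Substitution in the convolution gives $t^N$ from the measure and $t^{\alpha-N}$ from the kernel;
the outer substitution contributes another $t^N$. -/
theorem nonlocalTerm_dilate (u : Space N → ℝ) {t : ℝ} (ht : 0 < t) :
    nonlocalTerm α f (dilate t u) = t ^ ((N : ℝ) + α) * nonlocalTerm α f u := by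
  have h1 : ∀ x, rieszConv α f (dilate t u) x = t ^ α * rieszConv α f u (t⁻¹ • x) := by
    intro x
    rw [rieszConv_apply, rieszConv_apply]
    have := Measure.integral_comp_inv_smul_of_nonneg volume
      (fun z : Space N => rieszKernel N α (x - t • z) * primitive f (u z)) ht.le
    simp only [smul_inv_smul₀ ht.ne', finrank_euclideanSpace_fin, smul_eq_mul] at this
    simp only [dilate]
    rw [this, ← integral_const_mul, ← integral_const_mul]
    refine integral_congr_ae (Eventually.of_forall fun z => ?_)
    have e : x - t • z = t • (t⁻¹ • x - z) := by
      rw [smul_sub, smul_inv_smul₀ ht.ne']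
    simp only
    rw [e, rieszKernel_smul ht, ← Real.rpow_natCast, ← mul_assoc, ← mul_assoc, ← mul_assoc,
      ← Real.rpow_add ht]
    congr 3
    ring
  rw [nonlocalTerm, nonlocalTerm]
  have := Measure.integral_comp_inv_smul_of_nonneg volume
    (fun z : Space N => rieszConv α f u z * primitive f (u z)) ht.le
  simp only [finrank_euclideanSpace_fin, smul_eq_mul] at this
  calc _ = ∫ x, t ^ α * (rieszConv α f u (t⁻¹ • x) * primitive f (u (t⁻¹ • x))) := by
        refine integral_congr_ae (Eventually.of_forall fun x => ?_)
        simp only [h1, dilate]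
        ring
    _ = _ := by
        rw [integral_const_mul, this, ← Real.rpow_natCast, ← mul_assoc, ← Real.rpow_add ht,
          add_comm]

theorem nonlocalTerm_translate (u : Space N → ℝ) (a : Space N) :
    nonlocalTerm α f (fun x => u (x + a)) = nonlocalTerm α f u := by
  have h1 : ∀ x, rieszConv α f (fun x => u (x + a)) x = rieszConv α f u (x + a) := by
    intro x
    rw [rieszConv_apply, rieszConv_apply, ← integral_add_right_eq_self
      (fun y => rieszKernel N α (x + a - y) * primitive f (u y)) a]
    simp
  rw [nonlocalTerm, nonlocalTerm, ← integral_add_right_eq_self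
    (fun x => rieszConv α f u x * primitive f (u x)) a]
  simp only [h1]

theorem nonlocalTerm_congr {u v : Space N → ℝ} (h : u =ᵐ[volume] v) :
    nonlocalTerm α f u = nonlocalTerm α f v := by
  have h1 : ∀ x, rieszConv α f u x = rieszConv α f v x := by
    intro x
    rw [rieszConv_apply, rieszConv_apply]
    refine integral_congr_ae ?_
    filter_upwards [h] with y hy
    rw [hy]
  refine integral_congr_ae ?_
  filter_upwards [h] with y hy
  rw [h1, hy]

theorem nonlocalTerm_eq_zero_of_ae {u : Space N → ℝ} (h : u =ᵐ[volume] 0) :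
    nonlocalTerm α f u = 0 := by
  rw [nonlocalTerm_congr h]
  simp [nonlocalTerm, primitive_zero]

/-- The integrand is nonnegative and equals $c^2I_\alpha(x-y)>0$ on a nonempty open set off the
diagonal. The sign of $c$ is irrelevant, which is why (F3) asks only for $F(s_0)\ne0$. -/
theorem rieszForm_indicator_ball_pos (hN : 3 ≤ N) (hα0 : 0 < α) (hαN : α < N) {c : ℝ}
    (hc : c ≠ 0) :
    0 < rieszForm α ((Metric.closedBall (0 : Space N) 1).indicator fun _ => c)
      ((Metric.closedBall (0 : Space N) 1).indicator fun _ => c) := by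
  set g : Space N → ℝ := (Metric.closedBall (0 : Space N) 1).indicator fun _ => c with hg
  have hgp : MemLp g (hlsE N α) volume :=
    memLp_indicator_const _ Metric.isClosed_closedBall.measurableSet c
      (Or.inr (isCompact_closedBall _ _).measure_lt_top.ne)
  have hgg : ∀ x y, 0 ≤ g x * g y := by
    intro x y
    simp only [hg, indicator]
    split_ifs <;> simp [mul_self_nonneg]
  have hnn : 0 ≤ fun z : Space N × Space N => rieszKernel N α (z.1 - z.2) * g z.2 * g z.1 := by
    intro z
    simp only [Pi.zero_apply]
    rw [mul_assoc]
    exact mul_nonneg (rieszKernel_nonneg hα0 hαN _) (hgg _ _)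
  rw [rieszForm, integral_pos_iff_support_of_nonneg hnn
    (integrable_rieszForm (by omega) hα0 hαN hgp hgp)]
  set U : Set (Space N × Space N) := {z | ‖z.1‖ < 1 ∧ ‖z.2‖ < 1 ∧ z.1 ≠ z.2} with hU
  have hUo : IsOpen U := by
    refine (isOpen_lt continuous_fst.norm continuous_const).inter
      ((isOpen_lt continuous_snd.norm continuous_const).inter ?_)
    exact isOpen_ne_fun continuous_fst continuous_snd
  have hUn : U.Nonempty := by
    refine ⟨(0, EuclideanSpace.single (⟨0, by omega⟩ : Fin N) (1 / 2 : ℝ)), ?_, ?_, ?_⟩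
    · simp
    · simp
      norm_num
    · intro h
      have := congrArg norm h
      simp at this
  refine (hUo.measure_pos volume hUn).trans_le (measure_mono ?_)
  rintro ⟨x, y⟩ ⟨hx, hy, hxy⟩
  have hgx : g x = c := indicator_of_mem (by simpa using hx.le) _
  have hgy : g y = c := indicator_of_mem (by simpa using hy.le) _
  rw [Function.mem_support]
  simp only [hgx, hgy]
  have := rieszKernel_pos hα0 hαN (sub_ne_zero.2 hxy)
  positivity

/-- The multiple $s_0$ of the indicator of the unit ball would do, were it in $H^1$. Smooth bumps
with outer radius decreasing to $1$ approximate it, so that $F(s_0b_n)\to F(s_0)1_{B}$ in norm, and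
the form is continuous. -/
theorem exists_h1Pair_nonlocalTerm_pos (hN : 3 ≤ N) (hα0 : 0 < α) (hαN : α < N)
    (hf : CondF1 N α f) (hf3 : CondF3 f) :
    ∃ (u : Space N → ℝ) (G : Space N → Space N), H1Pair u G ∧ 0 < nonlocalTerm α f u := by
  obtain ⟨s₀, hs₀, hF⟩ := hf3
  obtain ⟨C₁, hC₁, hb⟩ := exists_abs_primitive_le hN hα0 hf
  let b : ℕ → ContDiffBump (0 : Space N) := fun n =>
    { rIn := 1
      rOut := 1 + 1 / ((n : ℝ) + 1)
      rIn_pos := one_pos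
      rIn_lt_rOut := lt_add_of_pos_right _ (by positivity) }
  have hbp : ∀ n, H1Pair (s₀ • ⇑(b n)) (s₀ • gradient (b n)) := fun n =>
    (h1Pair_of_contDiff (b n).contDiff (b n).hasCompactSupport).const_smul s₀
  set g : Space N → ℝ := (Metric.closedBall (0 : Space N) 1).indicator fun _ => primitive f s₀
    with hg
  set k : ℕ → Space N → ℝ := fun n x => primitive f ((s₀ • ⇑(b n)) x) with hk
  have hgp : MemLp g (hlsE N α) volume :=
    memLp_indicator_const _ Metric.isClosed_closedBall.measurableSet _
      (Or.inr (isCompact_closedBall _ _).measure_lt_top.ne)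
  have hkp : ∀ n, MemLp (k n) (hlsE N α) volume := fun n =>
    (hbp n).memLp_primitive hN hα0 hαN hf
  set M := C₁ * growth N α s₀ with hM
  have hM0 : 0 ≤ M := mul_nonneg hC₁.le (growth_nonneg _)
  have hkM : ∀ n x, |k n x| ≤ M := by
    intro n x
    refine (hb _).trans (mul_le_mul_of_nonneg_left (growth_mono hN hα0 ?_) hC₁.le)
    rw [Pi.smul_apply, smul_eq_mul, abs_mul, abs_of_nonneg (b n).nonneg]
    exact mul_le_of_le_one_right (abs_nonneg _) (b n).le_one
  have hgM : ∀ x, |g x| ≤ M := by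
    intro x
    by_cases hx : x ∈ Metric.closedBall (0 : Space N) 1
    · rw [hg, indicator_of_mem hx]
      exact hb s₀
    · rw [hg, indicator_of_notMem hx, abs_zero]
      exact hM0
  have hout : ∀ (n : ℕ) (x : Space N), 1 + 1 / ((n : ℝ) + 1) ≤ ‖x‖ → k n x = 0 := by
    intro n x hx
    have : (b n) x = 0 := (b n).zero_of_le_dist (by simpa only [dist_zero_right] using hx)
    simp [hk, this, primitive_zero]
  have hlim : Tendsto (fun n => eLpNorm (k n - g) (hlsE N α) volume) atTop (𝓝 0) := by
    refine tendsto_eLpNorm_of_dominated (hlsE_ne_zero hα0 hαN) (hlsE_ne_top N α)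
      (b := (Metric.closedBall (0 : Space N) 2).indicator fun _ => 2 * M)
      (fun n => ((hkp n).sub hgp).1) (memLp_indicator_const _
        Metric.isClosed_closedBall.measurableSet _
        (Or.inr (isCompact_closedBall _ _).measure_lt_top.ne))
      (fun n => Eventually.of_forall fun x => ?_) (Eventually.of_forall fun x => ?_)
    · by_cases hx : x ∈ Metric.closedBall (0 : Space N) 2
      · rw [indicator_of_mem hx, Pi.sub_apply]
        have h3 := abs_sub (k n x) (g x)
        linarith [hkM n x, hgM x]
      · rw [indicator_of_notMem hx, Pi.sub_apply]
        rw [mem_closedBall_zero_iff, not_le] at hx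
        have h1 : 1 / ((n : ℝ) + 1) ≤ 1 := by
          rw [div_le_one (by positivity)]
          linarith [(Nat.cast_nonneg n : (0 : ℝ) ≤ n)]
        rw [hout n x (by linarith), hg, indicator_of_notMem (by
          rw [mem_closedBall_zero_iff, not_le]
          linarith)]
        simp
    · by_cases hx : x ∈ Metric.closedBall (0 : Space N) 1
      · refine tendsto_const_nhds.congr fun n => ?_
        have : (b n) x = 1 := (b n).one_of_mem_closedBall hx
        simp [hk, hg, this, indicator_of_mem hx]
      · have hx' := hx
        rw [mem_closedBall_zero_iff, not_le] at hx'
        refine tendsto_const_nhds.congr' ?_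
        have h1 := (tendsto_one_div_add_atTop_nhds_zero_nat (𝕜 := ℝ)).eventually
          (gt_mem_nhds (sub_pos.2 hx'))
        filter_upwards [h1] with n hn
        rw [Pi.sub_apply, hout n x (by linarith), hg, indicator_of_notMem hx, sub_zero]
  have ht := tendsto_rieszForm (by omega) hα0 hαN hkp hkp hgp hgp hlim hlim
  obtain ⟨n, hn⟩ := (ht.eventually (lt_mem_nhds
    (rieszForm_indicator_ball_pos hN hα0 hαN hF))).exists
  refine ⟨_, _, hbp n, ?_⟩
  rw [nonlocalTerm_eq_rieszForm hN hα0 hαN hf (hbp n)]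
  exact hn

end


/-! ### One-variable calculus of the fibering map -/

/-- Weighted arithmetic–geometric mean of $t^s$ and $1$ with weights $r/s$ and $1-r/s$. -/
theorem rpow_bernoulli {r s t : ℝ} (hr : 0 < r) (hrs : r < s) (ht : 0 < t) :
    r * (1 - t ^ s) ≤ s * (1 - t ^ r) := by
  have hs : 0 < s := hr.trans hrs
  have h := Real.geom_mean_le_arith_mean2_weighted (w₁ := r / s) (w₂ := 1 - r / s) (p₁ := t ^ s)
    (p₂ := 1) (by positivity) (by rw [sub_nonneg, div_le_one hs]; exact hrs.le)
    (by positivity) zero_le_one (by ring)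
  rw [Real.one_rpow, mul_one, ← Real.rpow_mul ht.le, mul_div_cancel₀ _ hs.ne'] at h
  have h2 := mul_le_mul_of_nonneg_left h hs.le
  have h3 : s * (r / s * t ^ s + (1 - r / s) * 1) = r * t ^ s + (s - r) := by
    field_simp
  linarith

/-- The fibering map attains its maximum where its derivative vanishes. -/
theorem fiber_le_of_critical {p α a b d t : ℝ} (hp : 0 < p) (hα : 0 < α) (ha : 0 ≤ a)
    (hb : 0 ≤ b) (ht : 0 < t) (h : p * a + (p + 2) * b = (p + 2 + α) * d) :
    t ^ p * a + t ^ (p + 2) * b - t ^ (p + 2 + α) * d ≤ a + b - d := by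
  -- The two Bernoulli inequalities are weighted by $a$ and $b$; criticality turns the sum of their
  -- left sides into the $d$-term. Here $p$ stands for $N-2$.
  have h1 := rpow_bernoulli (r := p) (s := p + 2 + α) hp (by linarith) ht
  have h2 := rpow_bernoulli (r := p + 2) (s := p + 2 + α) (by linarith) (by linarith) ht
  have h3 : 0 < p + 2 + α := by linarith
  have h4 := mul_le_mul_of_nonneg_right h1 ha
  have h5 := mul_le_mul_of_nonneg_right h2 hb
  have h6 : (p + 2 + α) * d * (1 - t ^ (p + 2 + α)) =
    (p * a + (p + 2) * b) * (1 - t ^ (p + 2 + α)) := by rw [h]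
  refine le_of_mul_le_mul_left ?_ h3
  nlinarith

/-- Intermediate value between $T$, where the difference of the two sides is at most zero by
hypothesis, and $t_1=\kappa^{1/\alpha}$, where the $b$- and $d$-terms cancel and leave $pa\ge0$. The
bound $t\le T$ is what later keeps the reduced energy from growing. -/
theorem exists_critical_le {p α a b d T : ℝ} (hp : 0 < p) (hα : 0 < α) (ha : 0 ≤ a)
    (hb : 0 < b) (hd : 0 < d) (hT : 0 < T)
    (h : p * a + (p + 2) * b * T ^ 2 ≤ (p + 2 + α) * d * T ^ (2 + α)) :
    ∃ t, 0 < t ∧ t ≤ T ∧ p * a + (p + 2) * b * t ^ 2 = (p + 2 + α) * d * t ^ (2 + α) := by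
  set κ := (p + 2) * b / ((p + 2 + α) * d) with hκ
  have hκ0 : 0 < κ := by positivity
  set t₁ := κ ^ (1 / α) with ht₁
  have ht₁0 : 0 < t₁ := by positivity
  have ht₁α : t₁ ^ α = κ := by
    rw [ht₁, ← Real.rpow_mul hκ0.le, one_div_mul_cancel hα.ne', Real.rpow_one]
  have hsplit : ∀ t : ℝ, 0 < t → t ^ (2 + α) = t ^ 2 * t ^ α := fun t ht => by
    rw [Real.rpow_add ht, Real.rpow_two]
  have hκ' : (p + 2 + α) * d * κ = (p + 2) * b := by
    rw [hκ]
    field_simp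
  have ht₁T : t₁ ≤ T := by
    have h1 : κ ≤ T ^ α := by
      rw [hκ, div_le_iff₀ (by positivity)]
      rw [hsplit T hT] at h
      have hT2 : 0 < T ^ 2 := by positivity
      refine le_of_mul_le_mul_right ?_ hT2
      nlinarith [mul_nonneg hp.le ha]
    rw [ht₁, ← Real.rpow_le_rpow_iff (by positivity) hT.le hα, ← ht₁, ht₁α]
    exact h1
  have hcont : ContinuousOn
      (fun t : ℝ => p * a + (p + 2) * b * t ^ 2 - (p + 2 + α) * d * t ^ (2 + α)) (Icc t₁ T) := by
    refine Continuous.continuousOn ?_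
    have := Real.continuous_rpow_const (q := 2 + α) (by linarith)
    fun_prop
  have h0 : (0 : ℝ) ∈ Icc (p * a + (p + 2) * b * T ^ 2 - (p + 2 + α) * d * T ^ (2 + α))
      (p * a + (p + 2) * b * t₁ ^ 2 - (p + 2 + α) * d * t₁ ^ (2 + α)) := by
    refine ⟨by linarith, ?_⟩
    rw [hsplit t₁ ht₁0, ht₁α]
    have : (p + 2 + α) * d * (t₁ ^ 2 * κ) = (p + 2) * b * t₁ ^ 2 := by
      rw [← hκ']
      ring
    rw [this]
    have := mul_nonneg hp.le ha
    linarith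
  obtain ⟨t, ⟨h1, h2⟩, h3⟩ := intermediate_value_Icc' ht₁T hcont h0
  exact ⟨t, ht₁0.trans_le h1, h2, by simp only at h3; linarith⟩

theorem exists_critical {p α a b d : ℝ} (hp : 0 < p) (hα : 0 < α) (ha : 0 ≤ a)
    (hb : 0 < b) (hd : 0 < d) :
    ∃ t, 0 < t ∧ p * a + (p + 2) * b * t ^ 2 = (p + 2 + α) * d * t ^ (2 + α) := by
  set κ := (p * a + (p + 2) * b) / ((p + 2 + α) * d) with hκ
  have hκ0 : 0 < κ := by positivity
  -- With $T\ge1$, the term $pa$ is at most $paT^2$, so it is enough that $T^\alpha\ge\kappa$.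
  set T := max 1 (κ ^ (1 / α)) with hT
  have hT1 : 1 ≤ T := le_max_left _ _
  have hT0 : 0 < T := one_pos.trans_le hT1
  have hTα : κ ≤ T ^ α := by
    have h1 : (κ ^ (1 / α)) ^ α = κ := by
      rw [← Real.rpow_mul hκ0.le, one_div_mul_cancel hα.ne', Real.rpow_one]
    rw [← h1]
    exact Real.rpow_le_rpow (by positivity) (le_max_right _ _) hα.le
  have hb' : p * a + (p + 2) * b * T ^ 2 ≤ (p + 2 + α) * d * T ^ (2 + α) := by
    rw [Real.rpow_add hT0, Real.rpow_two]
    rw [hκ, div_le_iff₀ (by positivity)] at hTα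
    have hT2 : 1 ≤ T ^ 2 := one_le_pow₀ hT1
    have h1 := mul_le_mul_of_nonneg_right hTα (zero_le_one.trans hT2)
    have h2 := mul_le_mul_of_nonneg_left hT2 (mul_nonneg hp.le ha)
    linarith
  obtain ⟨t, ht, -, h⟩ := exists_critical_le hp hα ha hb hd hT0 hb'
  exact ⟨t, ht, h⟩

/-! ### The energy along dilations and translations -/

/-- `‖∇u‖₂²`. -/
def gradSq {N : ℕ} (u : Space N → ℝ) : ℝ := ∫ x, ‖weakGrad u x‖ ^ 2

/-- `‖u‖₂²`. -/
def massSq {N : ℕ} (u : Space N → ℝ) : ℝ := ∫ x, u x ^ 2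

section

variable {N : ℕ} {α V : ℝ} {f : ℝ → ℝ} {u w : Space N → ℝ} {G H : Space N → Space N}

theorem H1Pair.gradSq_eq (h : H1Pair u G) : gradSq u = ∫ x, ‖G x‖ ^ 2 := by
  refine integral_congr_ae ?_
  filter_upwards [h.weakGrad_ae] with x hx
  rw [hx]

theorem gradSq_nonneg (u : Space N → ℝ) : 0 ≤ gradSq u := integral_nonneg fun _ => by positivity

theorem massSq_nonneg (u : Space N → ℝ) : 0 ≤ massSq u := integral_nonneg fun _ => by positivity

theorem H1Pair.integrable_norm_sq (h : H1Pair u G) : Integrable fun x => ‖G x‖ ^ 2 :=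
  h.memLp_grad.integrable_norm_pow (by norm_num)

theorem H1Pair.integrable_sq (h : H1Pair u G) : Integrable fun x => u x ^ 2 := h.memLp.integrable_sq

theorem H1Pair.massSq_pos (h : H1Pair u G) (hu : ¬ u =ᵐ[volume] 0) : 0 < massSq u := by
  refine (massSq_nonneg u).lt_of_ne fun h0 => hu ?_
  have h1 := (integral_eq_zero_iff_of_nonneg (fun x => sq_nonneg (u x)) h.integrable_sq).1 h0.symm
  filter_upwards [h1] with x hx
  simpa using hx

theorem H1Pair.sqNorm_eq (h : H1Pair u G) :
    sqNorm u G = ENNReal.ofReal (gradSq u + massSq u) := by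
  rw [h.gradSq_eq, massSq, ENNReal.ofReal_add (integral_nonneg fun _ => by positivity)
    (integral_nonneg fun _ => by positivity),
    ofReal_integral_eq_lintegral_ofReal h.integrable_norm_sq
      (Eventually.of_forall fun _ => by positivity),
    ofReal_integral_eq_lintegral_ofReal h.integrable_sq
      (Eventually.of_forall fun _ => by positivity), sqNorm]
  congr 1
  · refine lintegral_congr fun x => ?_
    rw [ENNReal.ofReal_pow (norm_nonneg _), ofReal_norm]
  · refine lintegral_congr fun x => ?_
    rw [← sq_abs, ENNReal.ofReal_pow (abs_nonneg _), ← Real.norm_eq_abs, ofReal_norm]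

theorem H1Pair.toReal_sqNorm (h : H1Pair u G) : (sqNorm u G).toReal = gradSq u + massSq u := by
  rw [h.sqNorm_eq, ENNReal.toReal_ofReal (add_nonneg (gradSq_nonneg u) (massSq_nonneg u))]

theorem H1Pair.energy_eq (h : H1Pair u G) (α V : ℝ) (f : ℝ → ℝ) :
    energy α V f u = 1 / 2 * (gradSq u + V * massSq u - nonlocalTerm α f u) := by
  have h' := h.memH1.h1Pair
  rw [energy, integral_add h'.integrable_norm_sq (h'.integrable_sq.const_mul V),
    integral_const_mul, gradSq, massSq]
  ring

theorem pohozaev_eq (α V : ℝ) (f : ℝ → ℝ) (u : Space N → ℝ) :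
    pohozaev α V f u = 1 / 2 * (((N : ℝ) - 2) * gradSq u + N * (V * massSq u) -
      ((N : ℝ) + α) * nonlocalTerm α f u) := by
  rw [pohozaev, gradSq, massSq]
  ring

theorem gradSq_dilate (h : H1Pair u G) {t : ℝ} (ht : 0 < t) :
    gradSq (dilate t u) = t ^ ((N : ℝ) - 2) * gradSq u := by
  rw [(h.dilate ht).gradSq_eq, h.gradSq_eq]
  have h1 : ∀ x, ‖t⁻¹ • G (t⁻¹ • x)‖ ^ 2 = (t ^ 2)⁻¹ * ‖G (t⁻¹ • x)‖ ^ 2 := by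
    intro x
    rw [norm_smul, mul_pow, norm_inv, inv_pow, Real.norm_eq_abs, sq_abs]
  simp only [h1]
  rw [integral_const_mul, Measure.integral_comp_inv_smul_of_nonneg volume
    (fun x : Space N => ‖G x‖ ^ 2) ht.le, Real.rpow_sub ht, Real.rpow_natCast, Real.rpow_two]
  simp only [finrank_euclideanSpace, Fintype.card_fin, smul_eq_mul]
  ring

theorem massSq_dilate (u : Space N → ℝ) {t : ℝ} (ht : 0 < t) :
    massSq (dilate t u) = t ^ (N : ℝ) * massSq u := by
  rw [massSq, massSq, Real.rpow_natCast]
  have := Measure.integral_comp_inv_smul_of_nonneg volume (fun x : Space N => u x ^ 2) ht.le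
  simpa [dilate] using this

theorem energy_dilate (h : H1Pair u G) (α V : ℝ) (f : ℝ → ℝ) {t : ℝ} (ht : 0 < t) :
    energy α V f (dilate t u) = 1 / 2 * (t ^ ((N : ℝ) - 2) * gradSq u +
      t ^ (N : ℝ) * (V * massSq u) - t ^ ((N : ℝ) + α) * nonlocalTerm α f u) := by
  rw [(h.dilate ht).energy_eq, gradSq_dilate h ht, massSq_dilate u ht, nonlocalTerm_dilate u ht]
  ring

theorem pohozaev_dilate (h : H1Pair u G) (α V : ℝ) (f : ℝ → ℝ) {t : ℝ} (ht : 0 < t) :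
    pohozaev α V f (dilate t u) = 1 / 2 * t ^ ((N : ℝ) - 2) * (((N : ℝ) - 2) * gradSq u +
      N * (V * massSq u) * t ^ 2 - ((N : ℝ) + α) * nonlocalTerm α f u * t ^ (2 + α)) := by
  rw [pohozaev_eq, gradSq_dilate h ht, massSq_dilate u ht, nonlocalTerm_dilate u ht]
  have h1 : t ^ (N : ℝ) = t ^ ((N : ℝ) - 2) * t ^ 2 := by
    rw [← Real.rpow_two, ← Real.rpow_add ht]
    ring_nf
  have h2 : t ^ ((N : ℝ) + α) = t ^ ((N : ℝ) - 2) * t ^ (2 + α) := by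
    rw [← Real.rpow_add ht]
    ring_nf
  rw [h1, h2]
  ring

theorem massSq_translate (u : Space N → ℝ) (a : Space N) :
    massSq (fun x => u (x + a)) = massSq u :=
  integral_add_right_eq_self (fun x => u x ^ 2) a

theorem gradSq_translate (h : H1Pair u G) (a : Space N) :
    gradSq (fun x => u (x + a)) = gradSq u := by
  rw [(h.translate a).gradSq_eq, h.gradSq_eq]
  exact integral_add_right_eq_self (fun x => ‖G x‖ ^ 2) a

theorem dilate_one (u : Space N → ℝ) : dilate 1 u = u := by
  ext x
  simp [dilate]

theorem not_ae_zero_of_nonlocalTerm_pos (hD : 0 < nonlocalTerm α f u) :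
    ¬ u =ᵐ[volume] 0 := fun h0 => hD.ne' (nonlocalTerm_eq_zero_of_ae h0)

end


/-! ### The Pohožaev manifold -/

/-- The energy on the Pohožaev manifold, with the nonlocal term eliminated. -/
def reducedEnergy {N : ℕ} (α V : ℝ) (u : Space N → ℝ) : ℝ :=
  ((2 + α) * gradSq u + α * V * massSq u) / (2 * ((N : ℝ) + α))

section

variable {N : ℕ} {α V : ℝ} {f : ℝ → ℝ} {u w φ : Space N → ℝ} {G H : Space N → Space N}

theorem reducedEnergy_nonneg (hα0 : 0 < α) (hV : 0 < V) (u : Space N → ℝ) :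
    0 ≤ reducedEnergy α V u := by
  have h1 := gradSq_nonneg u
  have h2 := massSq_nonneg u
  unfold reducedEnergy
  positivity

/-- The multiple of the Pohožaev functional is chosen to cancel the nonlocal term. -/
theorem H1Pair.energy_eq_reducedEnergy_add (h : H1Pair u G) (hα0 : 0 < α) (V : ℝ) (f : ℝ → ℝ) :
    energy α V f u = reducedEnergy α V u + pohozaev α V f u / ((N : ℝ) + α) := by
  have hNα : (N : ℝ) + α ≠ 0 := by positivity
  rw [h.energy_eq, pohozaev_eq, reducedEnergy]
  field_simp
  ring

theorem energy_eq_reducedEnergy (hα0 : 0 < α) (hu : u ∈ pohozaevManifold N α V f) :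
    energy α V f u = reducedEnergy α V u := by
  rw [hu.1.h1Pair.energy_eq_reducedEnergy_add hα0, hu.2.2, zero_div, add_zero]

theorem mem_pohozaevManifold (h : H1Pair u G) (hD : 0 < nonlocalTerm α f u)
    (hP : pohozaev α V f u = 0) : u ∈ pohozaevManifold N α V f :=
  ⟨h.memH1, not_ae_zero_of_nonlocalTerm_pos hD, hP⟩

/-- The quadratic part of the Pohožaev functional is strictly positive for $u\ne0$ and must be
compensated. -/
theorem nonlocalTerm_pos_of_pohozaev_nonpos (hN : 3 ≤ N) (hα0 : 0 < α) (hV : 0 < V)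
    (h : H1Pair u G) (hu : ¬ u =ᵐ[volume] 0) (hP : pohozaev α V f u ≤ 0) :
    0 < nonlocalTerm α f u := by
  have hN' : (3 : ℝ) ≤ N := by exact_mod_cast hN
  rw [pohozaev_eq] at hP
  have h1 := h.massSq_pos hu
  have h2 : 0 ≤ ((N : ℝ) - 2) * gradSq u := mul_nonneg (by linarith) (gradSq_nonneg u)
  have h3 : 0 < (N : ℝ) * (V * massSq u) := by positivity
  have h4 : 0 < ((N : ℝ) + α) * nonlocalTerm α f u := by linarith
  exact pos_of_mul_pos_right h4 (by positivity)

theorem nonlocalTerm_pos_of_mem (hN : 3 ≤ N) (hα0 : 0 < α) (hV : 0 < V)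
    (hu : u ∈ pohozaevManifold N α V f) : 0 < nonlocalTerm α f u :=
  nonlocalTerm_pos_of_pohozaev_nonpos hN hα0 hV hu.1.h1Pair hu.2.1 hu.2.2.le

theorem dilate_mem_pohozaevManifold (h : H1Pair u G) (hD : 0 < nonlocalTerm α f u) {t : ℝ}
    (ht : 0 < t) (hc : ((N : ℝ) - 2) * gradSq u + ((N : ℝ) - 2 + 2) * (V * massSq u) * t ^ 2 =
      ((N : ℝ) - 2 + 2 + α) * nonlocalTerm α f u * t ^ (2 + α)) :
    dilate t u ∈ pohozaevManifold N α V f := by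
  refine mem_pohozaevManifold (h.dilate ht) ?_ ?_
  · rw [nonlocalTerm_dilate u ht]
    positivity
  · rw [sub_add_cancel] at hc
    rw [pohozaev_dilate h α V f ht, hc, sub_self, mul_zero]

theorem exists_dilate_mem (hN : 3 ≤ N) (hα0 : 0 < α) (hV : 0 < V) (h : H1Pair u G)
    (hD : 0 < nonlocalTerm α f u) : ∃ t, 0 < t ∧ dilate t u ∈ pohozaevManifold N α V f := by
  have hN' : (3 : ℝ) ≤ N := by exact_mod_cast hN
  have hB := h.massSq_pos (not_ae_zero_of_nonlocalTerm_pos hD)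
  obtain ⟨t, ht, hc⟩ := exists_critical (p := (N : ℝ) - 2) (by linarith) hα0 (gradSq_nonneg u)
    (mul_pos hV hB) hD
  exact ⟨t, ht, dilate_mem_pohozaevManifold h hD ht hc⟩

theorem exists_dilate_mem_of_pohozaev_nonpos (hN : 3 ≤ N) (hα0 : 0 < α) (hV : 0 < V)
    (h : H1Pair u G) (hu : ¬ u =ᵐ[volume] 0) (hP : pohozaev α V f u ≤ 0) :
    ∃ t, 0 < t ∧ t ≤ 1 ∧ dilate t u ∈ pohozaevManifold N α V f := by
  have hN' : (3 : ℝ) ≤ N := by exact_mod_cast hN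
  have hD := nonlocalTerm_pos_of_pohozaev_nonpos hN hα0 hV h hu hP
  rw [pohozaev_eq] at hP
  obtain ⟨t, ht, ht1, hc⟩ := exists_critical_le (p := (N : ℝ) - 2) (by linarith) hα0
    (gradSq_nonneg u) (mul_pos hV (h.massSq_pos hu)) hD one_pos (by
      rw [Real.one_rpow, sub_add_cancel]
      linarith)
  exact ⟨t, ht, ht1, dilate_mem_pohozaevManifold h hD ht hc⟩

theorem reducedEnergy_dilate_le (hN : 3 ≤ N) (hα0 : 0 < α) (hV : 0 < V) (h : H1Pair u G) {t : ℝ}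
    (ht : 0 < t) (ht1 : t ≤ 1) : reducedEnergy α V (dilate t u) ≤ reducedEnergy α V u := by
  have hN' : (3 : ℝ) ≤ N := by exact_mod_cast hN
  rw [reducedEnergy, reducedEnergy, gradSq_dilate h ht, massSq_dilate u ht]
  have h1 : t ^ ((N : ℝ) - 2) ≤ 1 := Real.rpow_le_one ht.le ht1 (by linarith)
  have h2 : t ^ (N : ℝ) ≤ 1 := Real.rpow_le_one ht.le ht1 (by linarith)
  have h3 := mul_le_of_le_one_left (gradSq_nonneg u) h1
  have h4 := mul_le_of_le_one_left (massSq_nonneg u) h2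
  gcongr

theorem energy_dilate_le_of_mem (hN : 3 ≤ N) (hα0 : 0 < α) (hV : 0 < V)
    (hu : u ∈ pohozaevManifold N α V f) {t : ℝ} (ht : 0 < t) :
    energy α V f (dilate t u) ≤ energy α V f u := by
  have hN' : (3 : ℝ) ≤ N := by exact_mod_cast hN
  have hP := hu.2.2
  rw [pohozaev_eq] at hP
  rw [energy_dilate hu.1.h1Pair α V f ht, hu.1.h1Pair.energy_eq]
  have h1 := fiber_le_of_critical (p := (N : ℝ) - 2) (α := α) (a := gradSq u)
    (b := V * massSq u) (d := nonlocalTerm α f u) (by linarith) hα0 (gradSq_nonneg u)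
    (mul_nonneg hV.le (massSq_nonneg u)) ht (by rw [sub_add_cancel]; linarith)
  rw [sub_add_cancel] at h1
  linarith

/-- Such a function reaches the manifold by a dilation with $t\le1$, which does not raise the
reduced energy. The estimate will be applied to the remainders of a minimising sequence, which are
not on the manifold. -/
theorem le_reducedEnergy_of_pohozaev_nonpos (hN : 3 ≤ N) (hα0 : 0 < α) (hV : 0 < V) {m : ℝ}
    (hm : ∀ u ∈ pohozaevManifold N α V f, m ≤ energy α V f u)
    (h : H1Pair u G) (hu : ¬ u =ᵐ[volume] 0) (hP : pohozaev α V f u ≤ 0) :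
    m ≤ reducedEnergy α V u := by
  obtain ⟨t, ht, ht1, hM⟩ := exists_dilate_mem_of_pohozaev_nonpos hN hα0 hV h hu hP
  refine (hm _ hM).trans ?_
  rw [energy_eq_reducedEnergy hα0 hM]
  exact reducedEnergy_dilate_le hN hα0 hV h ht ht1

/-- The nonlocal term is bounded away from zero on the Pohožaev manifold. -/
theorem exists_le_nonlocalTerm (hN : 3 ≤ N) (hα0 : 0 < α) (hαN : α < N) (hV : 0 < V)
    (hf : CondF1 N α f) :
    ∃ c : ℝ, 0 < c ∧ ∀ u ∈ pohozaevManifold N α V f, c ≤ nonlocalTerm α f u := by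
  have hN' : (3 : ℝ) ≤ N := by exact_mod_cast hN
  have hNα : 0 < (N : ℝ) + α := by positivity
  obtain ⟨C, hC, hb⟩ := exists_abs_nonlocalTerm_le hN hα0 hαN hf
  set l := lowExp N α with hl
  have hl1 : 1 < l := one_lt_lowExp hN hα0
  have hlr : l ≤ upExp N α := by
    rw [hl, lowExp, upExp]
    gcongr
    · linarith
    · linarith
  -- The Pohožaev identity gives $kS\le d$ for the squared norm $S$. If $S\le1$, the lower power
  -- dominates, so $d\le4CS^{l}$; together they force $S\ge(k/4C)^{1/(l-1)}$.
  set k := min ((N : ℝ) - 2) (N * V) / ((N : ℝ) + α) with hk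
  have hk0 : 0 < k := div_pos (lt_min (by linarith) (by positivity)) hNα
  set c := min 1 ((k / (4 * C)) ^ (1 / (l - 1))) with hc
  have hc0 : 0 < c := lt_min one_pos (by positivity)
  refine ⟨k * c, by positivity, fun u hu => ?_⟩
  have hP := hu.2.2
  rw [pohozaev_eq] at hP
  have hA := gradSq_nonneg u
  have hB := hu.1.h1Pair.massSq_pos hu.2.1
  set S := gradSq u + massSq u with hS
  have hS0 : 0 < S := by linarith
  have hkS : k * S ≤ nonlocalTerm α f u := by
    rw [hk, div_mul_eq_mul_div, div_le_iff₀ hNα]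
    have h1 := mul_le_mul_of_nonneg_right (min_le_left ((N : ℝ) - 2) (N * V)) hA
    have h2 := mul_le_mul_of_nonneg_right (min_le_right ((N : ℝ) - 2) (N * V)) hB.le
    rw [hS, mul_add]
    linarith
  refine (mul_le_mul_of_nonneg_left ?_ hk0.le).trans hkS
  rcases le_total 1 S with h1 | h1
  · exact (min_le_left _ _).trans h1
  refine (min_le_right _ _).trans ?_
  have h2 := hkS.trans ((le_abs_self _).trans (hb u _ hu.1.h1Pair))
  rw [hu.1.h1Pair.toReal_sqNorm, ← hS] at h2
  have h3 : S ^ (upExp N α / 2) ≤ S ^ (l / 2) :=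
    Real.rpow_le_rpow_of_exponent_ge hS0 h1 (by linarith)
  have h4 : (S ^ (l / 2) + S ^ (upExp N α / 2)) ^ 2 ≤ (2 * S ^ (l / 2)) ^ 2 := by
    have : 0 ≤ S ^ (upExp N α / 2) := by positivity
    gcongr
    linarith
  have h5 : (S ^ (l / 2)) ^ 2 = S * S ^ (l - 1) := by
    rw [← Real.rpow_natCast, ← Real.rpow_mul hS0.le]
    nth_rewrite 2 [← Real.rpow_one S]
    rw [← Real.rpow_add hS0]
    congr 1
    push_cast
    ring
  rw [mul_pow, h5] at h4
  have h6 : k * S ≤ 4 * C * S ^ (l - 1) * S := by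
    have := mul_le_mul_of_nonneg_left h4 hC.le
    linarith
  have h7 : k / (4 * C) ≤ S ^ (l - 1) := by
    rw [div_le_iff₀ (by positivity)]
    have := le_of_mul_le_mul_right h6 hS0
    linarith
  have h8 := Real.rpow_le_rpow (by positivity) h7 (one_div_nonneg.2 (sub_nonneg.2 hl1.le))
  rwa [← Real.rpow_mul hS0.le, mul_one_div_cancel (sub_ne_zero.2 hl1.ne'), Real.rpow_one] at h8

/-! ### Quadratic expansion of the gradient and mass integrals -/

theorem integrable_inner_of_memLp {G H : Space N → Space N} (hG : MemLp G 2 volume)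
    (hH : MemLp H 2 volume) : Integrable fun x => inner ℝ (G x) (H x) := by
  refine (hG.norm.integrable_mul hH.norm).mono (hG.1.inner hH.1)
    (Eventually.of_forall fun x => ?_)
  rw [Pi.mul_apply, norm_mul, norm_norm, norm_norm]
  exact norm_inner_le_norm _ _

theorem gradSq_add_smul (hu : H1Pair u G) (hφ : H1Pair φ H) (s : ℝ) :
    gradSq (u + s • φ) = gradSq u + 2 * s * (∫ x, inner ℝ (G x) (H x)) + s ^ 2 * gradSq φ := by
  have hi : Integrable fun x => inner ℝ (G x) (H x) :=
    integrable_inner_of_memLp hu.memLp_grad hφ.memLp_grad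
  have hi' : Integrable fun x => ‖G x‖ ^ 2 + 2 * s * inner ℝ (G x) (H x) :=
    hu.integrable_norm_sq.add (hi.const_mul _)
  rw [(hu.add (hφ.const_smul s)).gradSq_eq, hu.gradSq_eq, hφ.gradSq_eq, ← integral_const_mul,
    ← integral_const_mul, ← integral_add hu.integrable_norm_sq (hi.const_mul _),
    ← integral_add hi' (hφ.integrable_norm_sq.const_mul _)]
  refine integral_congr_ae (Eventually.of_forall fun x => ?_)
  simp only [Pi.add_apply, Pi.smul_apply]
  rw [norm_add_sq_real, inner_smul_right, norm_smul, mul_pow, Real.norm_eq_abs, sq_abs]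
  ring

theorem massSq_add_smul (hu : H1Pair u G) (hφ : H1Pair φ H) (s : ℝ) :
    massSq (u + s • φ) = massSq u + 2 * s * (∫ x, u x * φ x) + s ^ 2 * massSq φ := by
  have hi : Integrable fun x => u x * φ x := hu.memLp.integrable_mul hφ.memLp
  have hi' : Integrable fun x => u x ^ 2 + 2 * s * (u x * φ x) :=
    hu.integrable_sq.add (hi.const_mul _)
  rw [massSq, massSq, massSq, ← integral_const_mul,
    ← integral_const_mul, ← integral_add hu.integrable_sq (hi.const_mul _),
    ← integral_add hi' (hφ.integrable_sq.const_mul _)]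
  refine integral_congr_ae (Eventually.of_forall fun x => ?_)
  simp only [Pi.add_apply, Pi.smul_apply, smul_eq_mul]
  ring

end


/-! ### Existence of a minimiser -/

section

variable {N : ℕ} {α V : ℝ} {f : ℝ → ℝ} {u w φ : Space N → ℝ} {G H : Space N → Space N}

theorem gradSq_sub (hu : H1Pair u G) (hw : H1Pair w H) :
    gradSq (u - w) = gradSq u - 2 * (∫ x, inner ℝ (G x) (H x)) + gradSq w := by
  have := gradSq_add_smul hu hw (-1)
  rw [neg_one_smul, ← sub_eq_add_neg] at this
  linarith

theorem massSq_sub (hu : H1Pair u G) (hw : H1Pair w H) :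
    massSq (u - w) = massSq u - 2 * (∫ x, u x * w x) + massSq w := by
  have := massSq_add_smul hu hw (-1)
  rw [neg_one_smul, ← sub_eq_add_neg] at this
  linarith

theorem gradSq_sub_le (hu : H1Pair u G) (hw : H1Pair w H) :
    gradSq (u - w) ≤ 2 * gradSq u + 2 * gradSq w := by
  have h1 := gradSq_add_smul hu hw 1
  have h2 := gradSq_nonneg (u + (1 : ℝ) • w)
  have h3 := gradSq_sub hu hw
  linarith

theorem massSq_sub_le (hu : H1Pair u G) (hw : H1Pair w H) :
    massSq (u - w) ≤ 2 * massSq u + 2 * massSq w := by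
  have h1 := massSq_add_smul hu hw 1
  have h2 := massSq_nonneg (u + (1 : ℝ) • w)
  have h3 := massSq_sub hu hw
  linarith

theorem setLIntegral_ball_translate (u : Space N → ℝ) (a : Space N) (r : ℝ) :
    ∫⁻ x in Metric.ball 0 r, ‖u (x + a)‖ₑ ^ 2 = ∫⁻ x in Metric.ball a r, ‖u x‖ₑ ^ 2 := by
  have h := (measurePreserving_add_right (volume : Measure (Space N)) a).setLIntegral_comp_preimage_emb
    (measurableEmbedding_addRight a) (fun x => ‖u x‖ₑ ^ 2) (Metric.ball a r)
  rw [← h]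
  congr 2
  ext x
  simp

/-- Both coefficients of the reduced energy are positive. This coercivity bounds minimising
sequences and makes the reduced energy of a nonzero limit strictly positive. -/
theorem exists_add_le_mul_reducedEnergy (hα0 : 0 < α) (hV : 0 < V) :
    ∃ K : ℝ, 0 < K ∧ ∀ u : Space N → ℝ, gradSq u + massSq u ≤ K * reducedEnergy α V u := by
  refine ⟨2 * ((N : ℝ) + α) * ((2 + α)⁻¹ + (α * V)⁻¹), by positivity, fun u => ?_⟩
  have hA := gradSq_nonneg u
  have hB := massSq_nonneg u
  have hNα : (N : ℝ) + α ≠ 0 := by positivity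
  have h1 : 2 * ((N : ℝ) + α) * ((2 + α)⁻¹ + (α * V)⁻¹) * reducedEnergy α V u =
      gradSq u + massSq u + ((2 + α)⁻¹ * (α * V * massSq u) + (α * V)⁻¹ * ((2 + α) * gradSq u)) := by
    rw [reducedEnergy]
    field_simp
    ring
  rw [h1]
  have : 0 ≤ (2 + α)⁻¹ * (α * V * massSq u) + (α * V)⁻¹ * ((2 + α) * gradSq u) := by positivity
  linarith

/-- A bounded sequence that nearly minimises the energy on the Pohožaev manifold and keeps a fixed
amount of mass near the origin has a weak limit, some dilate of which is a minimiser. -/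
theorem exists_minimizer_of_mass (hN : 3 ≤ N) (hα0 : 0 < α) (hαN : α < N) (hV : 0 < V)
    (hf : CondF1 N α f) {m : ℝ} (hm : ∀ u ∈ pohozaevManifold N α V f, m ≤ energy α V f u)
    {u : ℕ → Space N → ℝ} {G : ℕ → Space N → Space N} (hu : ∀ n, H1Pair (u n) (G n))
    (hP : ∀ n, pohozaev α V f (u n) = 0)
    (hlim : Tendsto (fun n => reducedEnergy α V (u n)) atTop (𝓝 m)) {K : ℝ}
    (hK : ∀ n, gradSq (u n) + massSq (u n) ≤ K) {δ : ℝ≥0∞} (hδ : δ ≠ 0)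
    (hmass : ∀ n, δ ≤ ∫⁻ x in Metric.ball 0 2, ‖u n x‖ₑ ^ 2) :
    ∃ v ∈ pohozaevManifold N α V f, energy α V f v ≤ m := by
  have hN' : (3 : ℝ) ≤ N := by exact_mod_cast hN
  have hS : ∀ n, sqNorm (u n) (G n) ≤ ENNReal.ofReal K := fun n => by
    rw [(hu n).sqNorm_eq]
    exact ENNReal.ofReal_le_ofReal (hK n)
  have hle : ∀ {F : Type} [NormedAddCommGroup F] (g : Space N → F),
      ∫⁻ x, ‖g x‖ₑ ^ 2 ≤ ENNReal.ofReal K → eLpNorm g 2 volume ≤ ENNReal.ofReal K ^ (1 / 2 : ℝ) := by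
    intro F _ g hg
    rw [← eLpNorm_two_sq] at hg
    have := ENNReal.rpow_le_rpow hg (by norm_num : (0 : ℝ) ≤ 1 / 2)
    rwa [← ENNReal.rpow_natCast, ← ENNReal.rpow_mul, Nat.cast_ofNat, mul_one_div_cancel two_ne_zero,
      ENNReal.rpow_one] at this
  obtain ⟨σ, v, H, hσ, hv, hwu, hwG, hloc, hae⟩ := exists_weak_limit hu
    (B := ENNReal.ofReal K ^ (1 / 2 : ℝ)) (ENNReal.rpow_ne_top_of_nonneg (by norm_num)
      ENNReal.ofReal_ne_top) (fun n => hle _ (le_add_self.trans (hS n)))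
    (fun n => hle _ (le_self_add.trans (hS n)))
  -- Local strong convergence carries the mass near the origin to the limit.
  have hv0 : ¬ v =ᵐ[volume] 0 := by
    intro h0
    refine hδ (le_antisymm (ge_of_tendsto' (hloc 2) fun n => ?_) zero_le)
    refine (hmass (σ n)).trans_eq (lintegral_congr_ae (ae_restrict_of_ae ?_))
    filter_upwards [h0] with x hx
    rw [hx, Pi.zero_apply, sub_zero]
  set w : ℕ → Space N → ℝ := fun n => u (σ n) - v with hw
  have hwp : ∀ n, H1Pair (w n) (G (σ n) - H) := fun n => (hu _).sub hv
  have hA : Tendsto (fun n => gradSq (u (σ n)) - gradSq (w n)) atTop (𝓝 (gradSq v)) := by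
    have h1 := ((hwG H hv.memLp_grad).const_mul 2).sub_const (gradSq v)
    have h2 : ∫ x, inner ℝ (H x) (H x) = gradSq v := by
      rw [hv.gradSq_eq]
      simp only [real_inner_self_eq_norm_sq]
    rw [h2, two_mul, add_sub_cancel_right] at h1
    refine h1.congr fun n => ?_
    rw [hw, gradSq_sub (hu _) hv]
    ring
  have hB : Tendsto (fun n => massSq (u (σ n)) - massSq (w n)) atTop (𝓝 (massSq v)) := by
    have h1 := ((hwu v hv.memLp).const_mul 2).sub_const (massSq v)
    have h2 : ∫ x, v x * v x = massSq v := by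
      rw [massSq]
      simp only [sq]
    rw [h2, two_mul, add_sub_cancel_right] at h1
    refine h1.congr fun n => ?_
    rw [hw, massSq_sub (hu _) hv]
    ring
  have hD : Tendsto (fun n => nonlocalTerm α f (u (σ n)) - nonlocalTerm α f (w n)) atTop
      (𝓝 (nonlocalTerm α f v)) := by
    have h1 := tendsto_nonlocalTerm_splitting hN hα0 hαN hf hwp hv
      (B := ENNReal.ofReal (2 * K + 2 * (gradSq v + massSq v))) ENNReal.ofReal_ne_top
      (fun n => ?_) ?_
    · simpa only [hw, sub_add_cancel] using h1
    · rw [(hwp n).sqNorm_eq]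
      refine ENNReal.ofReal_le_ofReal ?_
      have h1 := gradSq_sub_le (hu (σ n)) hv
      have h2 := massSq_sub_le (hu (σ n)) hv
      have h3 := hK (σ n)
      simp only [hw]
      linarith
    · filter_upwards [hae] with x hx
      have := hx.sub_const (v x)
      rwa [sub_self] at this
  -- The Pohožaev functional splits and vanishes along the sequence, so the remainders inherit the
  -- opposite of the value at $v$.
  have hPlim : Tendsto (fun n => pohozaev α V f (w n)) atTop (𝓝 (-pohozaev α V f v)) := by
    have h1 := (((hA.const_mul ((N : ℝ) - 2)).add ((hB.const_mul V).const_mul (N : ℝ))).sub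
      (hD.const_mul ((N : ℝ) + α))).const_mul (-(1 / 2))
    rw [pohozaev_eq, ← neg_mul]
    refine h1.congr fun n => ?_
    have h2 := hP (σ n)
    rw [pohozaev_eq] at h2 ⊢
    linarith
  have hrlim : Tendsto (fun n => reducedEnergy α V (w n)) atTop (𝓝 (m - reducedEnergy α V v)) := by
    have h1 := (((hA.const_mul (2 + α)).add (hB.const_mul (α * V))).div_const
      (2 * ((N : ℝ) + α)))
    refine ((hlim.comp hσ.tendsto_atTop).sub h1).congr fun n => ?_
    simp only [reducedEnergy, Function.comp_apply]
    ring
  have hrv : reducedEnergy α V v ≤ m := by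
    have := ge_of_tendsto' hrlim fun n => reducedEnergy_nonneg hα0 hV (w n)
    linarith
  have hPv : pohozaev α V f v ≤ 0 := by
    -- Otherwise the remainders have negative Pohožaev value, so their reduced energy is at least
    -- $m$ although it tends to $m$ minus that of $v$; this contradicts $v\ne0$.
    by_contra! hpos
    have h1 : ∀ᶠ n in atTop, pohozaev α V f (w n) < 0 :=
      hPlim.eventually (gt_mem_nhds (neg_neg_of_pos hpos))
    have h2 : m ≤ m - reducedEnergy α V v := by
      refine ge_of_tendsto hrlim (h1.mono fun n hn => ?_)
      refine le_reducedEnergy_of_pohozaev_nonpos hN hα0 hV hm (hwp n) (fun h0 => ?_) hn.le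
      rw [pohozaev_eq, nonlocalTerm_eq_zero_of_ae h0, mul_zero, sub_zero] at hn
      have h3 : 0 ≤ ((N : ℝ) - 2) * gradSq (w n) :=
        mul_nonneg (by linarith) (gradSq_nonneg _)
      have h4 : 0 ≤ (N : ℝ) * (V * massSq (w n)) := by
        have := massSq_nonneg (w n)
        positivity
      linarith
    obtain ⟨K', hK', hb⟩ := exists_add_le_mul_reducedEnergy (N := N) hα0 hV
    have h3 := hb v
    have h4 := hv.massSq_pos hv0
    have h5 := gradSq_nonneg v
    nlinarith
  obtain ⟨t, ht, ht1, hM⟩ := exists_dilate_mem_of_pohozaev_nonpos hN hα0 hV hv hv0 hPv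
  refine ⟨_, hM, ?_⟩
  rw [energy_eq_reducedEnergy hα0 hM]
  exact (reducedEnergy_dilate_le hN hα0 hV hv ht ht1).trans hrv

theorem exists_minimizer (hN : 3 ≤ N) (hα0 : 0 < α) (hαN : α < N) (hV : 0 < V)
    (hf : CondF1 N α f) (hf2 : CondF2 N α f) (hf3 : CondF3 f) :
    ∃ v ∈ pohozaevManifold N α V f, ∀ u ∈ pohozaevManifold N α V f,
      energy α V f v ≤ energy α V f u := by
  set S := energy α V f '' pohozaevManifold N α V f with hS
  have hne : S.Nonempty := by
    obtain ⟨u, G, h, hD⟩ := exists_h1Pair_nonlocalTerm_pos hN hα0 hαN hf hf3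
    obtain ⟨t, ht, hM⟩ := exists_dilate_mem hN hα0 hV h hD
    exact ⟨_, mem_image_of_mem _ hM⟩
  have hbd : BddBelow S := by
    refine ⟨0, ?_⟩
    rintro _ ⟨u, hu, rfl⟩
    rw [energy_eq_reducedEnergy hα0 hu]
    exact reducedEnergy_nonneg hα0 hV u
  have hm : ∀ u ∈ pohozaevManifold N α V f, sInf S ≤ energy α V f u := fun u hu =>
    csInf_le hbd (mem_image_of_mem _ hu)
  obtain ⟨e, -, he, heS⟩ := exists_seq_tendsto_sInf hne hbd
  choose u hu hue using heS
  obtain ⟨K, hK, hKb⟩ := exists_add_le_mul_reducedEnergy (N := N) hα0 hV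
  obtain ⟨M, hM⟩ := he.bddAbove_range
  have hbound : ∀ n, gradSq (u n) + massSq (u n) ≤ K * M := fun n => by
    refine (hKb _).trans (mul_le_mul_of_nonneg_left ?_ hK.le)
    rw [← energy_eq_reducedEnergy hα0 (hu n), hue]
    exact hM (mem_range_self n)
  obtain ⟨c, hc, hcb⟩ := exists_le_nonlocalTerm hN hα0 hαN hV hf
  obtain ⟨δ, hδ, hmass⟩ := exists_mass_of_le_nonlocalTerm hN hα0 hαN hf hf2
    (B := ENNReal.ofReal (K * M)) ENNReal.ofReal_ne_top hc
  have hex : ∀ n, ∃ a, δ ≤ ∫⁻ x in Metric.ball a 2, ‖u n x‖ₑ ^ 2 := fun n => by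
    refine hmass _ _ (hu n).1.h1Pair ?_ (hcb _ (hu n))
    rw [(hu n).1.h1Pair.sqNorm_eq]
    exact ENNReal.ofReal_le_ofReal (hbound n)
  choose a ha using hex
  -- Every term of the functionals is translation invariant, so the mass may be moved to the origin.
  have hg : ∀ n, gradSq (fun x => u n (x + a n)) = gradSq (u n) := fun n =>
    gradSq_translate (hu n).1.h1Pair _
  have hq : ∀ n, massSq (fun x => u n (x + a n)) = massSq (u n) := fun n => massSq_translate _ _
  have hP : ∀ n, pohozaev α V f (fun x => u n (x + a n)) = 0 := fun n => by
    rw [pohozaev_eq, hg, hq, nonlocalTerm_translate, ← pohozaev_eq]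
    exact (hu n).2.2
  have hlim : Tendsto (fun n => reducedEnergy α V fun x => u n (x + a n)) atTop
      (𝓝 (sInf S)) := by
    refine he.congr fun n => ?_
    rw [← hue n, energy_eq_reducedEnergy hα0 (hu n), reducedEnergy, reducedEnergy, hg, hq]
  obtain ⟨v, hv, hvm⟩ := exists_minimizer_of_mass hN hα0 hαN hV hf hm
    (fun n => (hu n).1.h1Pair.translate (a n)) hP hlim (K := K * M)
    (fun n => by rw [hg, hq]; exact hbound n) hδ
    (fun n => by rw [setLIntegral_ball_translate]; exact ha n)
  exact ⟨v, hv, fun w hw => hvm.trans (hm w hw)⟩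

end


/-! ### Minimisers are weak solutions -/

/-- Eliminating $d$ makes the sign visible: for $a,b\ge0$ both summands are nonnegative for $t<1$
and nonpositive for $t>1$. -/
theorem critical_sign {p α a b d t : ℝ} (ht : 0 < t)
    (h : p * a + (p + 2) * b = (p + 2 + α) * d) :
    p * a + (p + 2) * b * t ^ 2 - (p + 2 + α) * d * t ^ (2 + α) =
      p * a * (1 - t ^ (2 + α)) + (p + 2) * b * (t ^ 2 * (1 - t ^ α)) := by
  have h1 : t ^ (2 + α) = t ^ 2 * t ^ α := by rw [Real.rpow_add ht, Real.rpow_two]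
  rw [← h, h1]
  ring

/-- Critical points of the fibering map persist near `1` under small perturbations. -/
theorem exists_critical_near_one {p α a b d : ℝ} (hp : 0 < p) (hα : 0 < α) (ha : 0 ≤ a)
    (hb : 0 < b) (h : p * a + (p + 2) * b = (p + 2 + α) * d) {A B D : ℕ → ℝ}
    (hA : Tendsto A atTop (𝓝 a)) (hB : Tendsto B atTop (𝓝 b)) (hD : Tendsto D atTop (𝓝 d))
    {ε : ℝ} (hε0 : 0 < ε) (hε1 : ε < 1) :
    ∀ᶠ n in atTop, ∃ t ∈ Icc (1 - ε) (1 + ε),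
      p * A n + (p + 2) * B n * t ^ 2 = (p + 2 + α) * D n * t ^ (2 + α) := by
  have hlim : ∀ t : ℝ, Tendsto (fun n => p * A n + (p + 2) * B n * t ^ 2 -
      (p + 2 + α) * D n * t ^ (2 + α)) atTop
      (𝓝 (p * a + (p + 2) * b * t ^ 2 - (p + 2 + α) * d * t ^ (2 + α))) := fun t =>
    ((hA.const_mul p).add ((hB.const_mul (p + 2)).mul_const _)).sub
      ((hD.const_mul (p + 2 + α)).mul_const _)
  -- The strict signs at $1\pm\varepsilon$ persist along the sequence, and an intermediate zero
  -- follows.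
  have h1 : 0 < p * a + (p + 2) * b * (1 - ε) ^ 2 - (p + 2 + α) * d * (1 - ε) ^ (2 + α) := by
    have ht : 0 < 1 - ε := by linarith
    rw [critical_sign ht h]
    have h2 : (1 - ε) ^ (2 + α) < 1 := Real.rpow_lt_one ht.le (by linarith) (by linarith)
    have h3 : (1 - ε) ^ α < 1 := Real.rpow_lt_one ht.le (by linarith) hα
    have h4 : 0 ≤ p * a * (1 - (1 - ε) ^ (2 + α)) :=
      mul_nonneg (mul_nonneg hp.le ha) (by linarith)
    have h5 : 0 < (p + 2) * b * ((1 - ε) ^ 2 * (1 - (1 - ε) ^ α)) :=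
      mul_pos (by positivity) (mul_pos (by positivity) (by linarith))
    linarith
  have h2 : p * a + (p + 2) * b * (1 + ε) ^ 2 - (p + 2 + α) * d * (1 + ε) ^ (2 + α) < 0 := by
    have ht : 0 < 1 + ε := by linarith
    rw [critical_sign ht h]
    have h2 : 1 < (1 + ε) ^ (2 + α) := Real.one_lt_rpow (by linarith) (by linarith)
    have h3 : 1 < (1 + ε) ^ α := Real.one_lt_rpow (by linarith) hα
    have h4 : 0 ≤ p * a * ((1 + ε) ^ (2 + α) - 1) :=
      mul_nonneg (mul_nonneg hp.le ha) (by linarith)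
    have h5 : 0 < (p + 2) * b * ((1 + ε) ^ 2 * ((1 + ε) ^ α - 1)) :=
      mul_pos (by positivity) (mul_pos (by positivity) (by linarith))
    linarith
  filter_upwards [(hlim _).eventually (lt_mem_nhds h1), (hlim _).eventually (gt_mem_nhds h2)]
    with n hn1 hn2
  have hcont : ContinuousOn (fun t : ℝ => p * A n + (p + 2) * B n * t ^ 2 -
      (p + 2 + α) * D n * t ^ (2 + α)) (Icc (1 - ε) (1 + ε)) := by
    refine Continuous.continuousOn ?_
    have := Real.continuous_rpow_const (q := 2 + α) (by linarith)
    fun_prop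
  obtain ⟨t, ht, h3⟩ := intermediate_value_Icc' (by linarith) hcont ⟨hn2.le, hn1.le⟩
  exact ⟨t, ht, by simp only at h3; linarith⟩

section

variable {N : ℕ} {α V : ℝ} {f : ℝ → ℝ} {u v φ : Space N → ℝ} {G H : Space N → Space N}

/-- Since $v$ maximises its own fibre, $I(v_t)\le I(v)\le I(u_t)$ for the same $t$; then divide by
$t^{N-2}/2$. Using one common $t$ avoids differentiating $t$ with respect to the perturbation. -/
theorem gradSq_add_nonneg_of_minimizer (hN : 3 ≤ N) (hα0 : 0 < α) (hV : 0 < V)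
    (hv : v ∈ pohozaevManifold N α V f)
    (hmin : ∀ u ∈ pohozaevManifold N α V f, energy α V f v ≤ energy α V f u)
    (hu : H1Pair u G) (hD : 0 < nonlocalTerm α f u) {t : ℝ} (ht : 0 < t)
    (hc : ((N : ℝ) - 2) * gradSq u + ((N : ℝ) - 2 + 2) * (V * massSq u) * t ^ 2 =
      ((N : ℝ) - 2 + 2 + α) * nonlocalTerm α f u * t ^ (2 + α)) :
    0 ≤ (gradSq u - gradSq v) + V * t ^ 2 * (massSq u - massSq v) -
      t ^ (2 + α) * (nonlocalTerm α f u - nonlocalTerm α f v) := by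
  have h1 := (energy_dilate_le_of_mem hN hα0 hV hv ht).trans
    (hmin _ (dilate_mem_pohozaevManifold hu hD ht hc))
  rw [energy_dilate hv.1.h1Pair α V f ht, energy_dilate hu α V f ht] at h1
  have h2 : t ^ (N : ℝ) = t ^ ((N : ℝ) - 2) * t ^ 2 := by
    rw [← Real.rpow_two, ← Real.rpow_add ht]
    ring_nf
  have h3 : t ^ ((N : ℝ) + α) = t ^ ((N : ℝ) - 2) * t ^ (2 + α) := by
    rw [← Real.rpow_add ht]
    ring_nf
  rw [h2, h3] at h1
  have h4 : 0 < t ^ ((N : ℝ) - 2) := by positivity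
  refine nonneg_of_mul_nonneg_right (a := t ^ ((N : ℝ) - 2)) ?_ h4
  linarith

/-- The comparison above with $u=v+s\varphi$, divided by $s>0$, passes to the limit as $s\to0$ and
$t\to1$: the three difference quotients converge, and the powers of $t$ tend to $1$. -/
theorem deriv_nonneg_of_minimizer (hN : 3 ≤ N) (hα0 : 0 < α) (hαN : α < N) (hV : 0 < V)
    (hf : CondF1 N α f) (hv : v ∈ pohozaevManifold N α V f)
    (hmin : ∀ u ∈ pohozaevManifold N α V f, energy α V f v ≤ energy α V f u)
    (hφ : H1Pair φ H) :
    0 ≤ (∫ x, inner ℝ (weakGrad v x) (H x)) + V * (∫ x, v x * φ x) -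
      rieszForm α (fun x => primitive f (v x)) fun x => f (v x) * φ x := by
  have hN' : (3 : ℝ) ≤ N := by exact_mod_cast hN
  have hvp := hv.1.h1Pair
  set i := ∫ x, inner ℝ (weakGrad v x) (H x) with hi
  set j := ∫ x, v x * φ x with hj
  set r := rieszForm α (fun x => primitive f (v x)) fun x => f (v x) * φ x with hr
  set s : ℕ → ℝ := fun n => 1 / ((n : ℝ) + 1) with hs
  have hs0 : ∀ n, 0 < s n := fun n => by positivity
  have hs1 : ∀ n, |s n| ≤ 1 := fun n => by
    rw [abs_of_pos (hs0 n), hs]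
    simp only
    rw [div_le_one (by positivity)]
    linarith [(Nat.cast_nonneg n : (0 : ℝ) ≤ n)]
  have hsl : Tendsto s atTop (𝓝 0) := tendsto_one_div_add_atTop_nhds_zero_nat
  have hwp : ∀ n, H1Pair (v + s n • φ) (weakGrad v + s n • H) := fun n =>
    hvp.add (hφ.const_smul _)
  have hqA : Tendsto (fun n => (gradSq (v + s n • φ) - gradSq v) / s n) atTop (𝓝 (2 * i)) := by
    have h1 := (hsl.mul_const (gradSq φ)).const_add (2 * i)
    rw [zero_mul, add_zero] at h1
    refine h1.congr fun n => ?_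
    have := (hs0 n).ne'
    rw [gradSq_add_smul hvp hφ, ← hi]
    field_simp
    ring
  have hqB : Tendsto (fun n => (massSq (v + s n • φ) - massSq v) / s n) atTop (𝓝 (2 * j)) := by
    have h1 := (hsl.mul_const (massSq φ)).const_add (2 * j)
    rw [zero_mul, add_zero] at h1
    refine h1.congr fun n => ?_
    have := (hs0 n).ne'
    rw [massSq_add_smul hvp hφ, ← hj]
    field_simp
    ring
  have hqD := tendsto_nonlocalTerm_div hN hα0 hαN hf hvp hφ (fun n => (hs0 n).ne') hs1 hsl
  rw [← hr] at hqD
  have hback : ∀ {X : ℕ → ℝ} {x y : ℝ}, Tendsto (fun n => (X n - x) / s n) atTop (𝓝 y) →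
      Tendsto X atTop (𝓝 x) := by
    intro X x y hX
    have h1 := (hX.mul hsl).add_const x
    rw [mul_zero, zero_add] at h1
    refine h1.congr fun n => ?_
    rw [div_mul_cancel₀ _ (hs0 n).ne', sub_add_cancel]
  have hDv := nonlocalTerm_pos_of_mem hN hα0 hV hv
  have hP := hv.2.2
  rw [pohozaev_eq] at hP
  -- A diagonal choice: for each tolerance, a late index and a critical $t$ that close to $1$. The
  -- denominator $k+2$ keeps the tolerance below $1$ even at $k=0$, so that $t>0$.
  have hex : ∀ k : ℕ, ∃ n t, k ≤ n ∧ |t - 1| ≤ 1 / ((k : ℝ) + 1 + 1) ∧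
      0 ≤ (gradSq (v + s n • φ) - gradSq v) / s n +
        V * t ^ 2 * ((massSq (v + s n • φ) - massSq v) / s n) -
        t ^ (2 + α) * ((nonlocalTerm α f (v + s n • φ) - nonlocalTerm α f v) / s n) := by
    intro k
    have hε0 : 0 < 1 / ((k : ℝ) + 1 + 1) := by positivity
    have hε1 : 1 / ((k : ℝ) + 1 + 1) < 1 := by
      rw [div_lt_one (by positivity)]
      linarith [(Nat.cast_nonneg k : (0 : ℝ) ≤ k)]
    have h1 := exists_critical_near_one (p := (N : ℝ) - 2) (by linarith) hα0 (gradSq_nonneg v)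
      (mul_pos hV (hvp.massSq_pos hv.2.1)) (by rw [sub_add_cancel]; linarith)
      (hback hqA) ((hback hqB).const_mul V) (hback hqD) hε0 hε1
    obtain ⟨n, ⟨t, ht, hc⟩, hDn, hkn⟩ := (h1.and (((hback hqD).eventually
      (lt_mem_nhds hDv)).and (eventually_ge_atTop k))).exists
    have ht0 : 0 < t := by linarith [ht.1]
    refine ⟨n, t, hkn, abs_le.2 ⟨by linarith [ht.1], by linarith [ht.2]⟩, ?_⟩
    have h2 := div_nonneg
      (gradSq_add_nonneg_of_minimizer hN hα0 hV hv hmin (hwp n) hDn ht0 hc) (hs0 n).le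
    rw [sub_div, add_div, mul_div_assoc, mul_div_assoc] at h2
    exact h2
  choose n t hn ht hpos using hex
  have hnl : Tendsto n atTop atTop := tendsto_atTop_mono hn tendsto_id
  have htl : Tendsto t atTop (𝓝 1) := by
    have h1 := (tendsto_add_atTop_iff_nat 1).2 (tendsto_one_div_add_atTop_nhds_zero_nat (𝕜 := ℝ))
    have h2 : Tendsto (fun k => t k - 1) atTop (𝓝 0) :=
      squeeze_zero_norm (fun k => ht k) (by simpa using h1)
    simpa using h2.add_const 1
  have ht2 : Tendsto (fun k => t k ^ (2 + α)) atTop (𝓝 1) := by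
    have := htl.rpow_const (p := 2 + α) (Or.inl one_ne_zero)
    rwa [Real.one_rpow] at this
  have hfin := ge_of_tendsto' (((hqA.comp hnl).add (((htl.pow 2).const_mul V).mul
    (hqB.comp hnl))).sub (ht2.mul (hqD.comp hnl))) hpos
  rw [one_pow, mul_one, one_mul] at hfin
  linarith

theorem isWeakSolution_of_minimizer (hN : 3 ≤ N) (hα0 : 0 < α) (hαN : α < N) (hV : 0 < V)
    (hf : CondF1 N α f) (hv : v ∈ pohozaevManifold N α V f)
    (hmin : ∀ u ∈ pohozaevManifold N α V f, energy α V f v ≤ energy α V f u) :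
    IsWeakSolution α V f v := by
  refine ⟨hv.1, fun φ hφ => ?_⟩
  have hvp := hv.1.h1Pair
  have hφp := hφ.h1Pair
  have hF := hvp.memLp_primitive hN hα0 hαN hf
  have hfφ := memLp_comp_mul hN hα0 hαN hf hvp hφp
  have hassoc : (fun x => rieszConv α f v x * f (v x) * φ x) =
      fun x => rieszConv α f v x * (f (v x) * φ x) := by
    ext x
    ring
  rw [hassoc]
  refine ⟨integrable_convolution_rieszKernel_mul (by omega) hα0 hαN hF hfφ, ?_⟩
  have hr : ∫ x, rieszConv α f v x * (f (v x) * φ x) =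
      rieszForm α (fun x => primitive f (v x)) fun x => f (v x) * φ x :=
    integral_convolution_rieszKernel_mul (by omega) hα0 hαN hF hfφ
  have hl : ∫ x, (inner ℝ (weakGrad v x) (weakGrad φ x) + V * v x * φ x) =
      (∫ x, inner ℝ (weakGrad v x) (weakGrad φ x)) + V * ∫ x, v x * φ x := by
    have hi : Integrable fun x => V * (v x * φ x) :=
      (hvp.memLp.integrable_mul hφp.memLp).const_mul V
    simp only [mul_assoc]
    rw [integral_add (integrable_inner_of_memLp hvp.memLp_grad hφp.memLp_grad)
      hi, integral_const_mul]
  rw [hl, hr]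
  -- The derivative is linear in the direction, so its nonnegativity at $\varphi$ and $-\varphi$
  -- makes it vanish.
  have h1 := deriv_nonneg_of_minimizer hN hα0 hαN hV hf hv hmin hφp
  have h2 := deriv_nonneg_of_minimizer hN hα0 hαN hV hf hv hmin (hφp.const_smul (-1))
  have h3 : ∫ x, inner ℝ (weakGrad v x) (((-1 : ℝ) • weakGrad φ) x) =
      -∫ x, inner ℝ (weakGrad v x) (weakGrad φ x) := by
    rw [← integral_neg]
    refine integral_congr_ae (Eventually.of_forall fun x => ?_)
    simp
  have h4 : ∫ x, v x * ((-1 : ℝ) • φ) x = -∫ x, v x * φ x := by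
    rw [← integral_neg]
    refine integral_congr_ae (Eventually.of_forall fun x => ?_)
    simp
  have h5 : rieszForm α (fun x => primitive f (v x)) (fun x => f (v x) * ((-1 : ℝ) • φ) x) =
      -rieszForm α (fun x => primitive f (v x)) fun x => f (v x) * φ x := by
    have h6 : (fun x => f (v x) * ((-1 : ℝ) • φ) x) = (-1 : ℝ) • fun x => f (v x) * φ x := by
      ext x
      simp
    rw [h6, rieszForm_comm, rieszForm_smul_left, rieszForm_comm]
    ring
  rw [h3, h4, h5] at h2
  linarith

/-- Dilations compose multiplicatively, so $u_\tau$ is the dilate of $u_t$ by $\tau/t$, and points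
of the manifold maximise their own fibre. -/
theorem isGreatest_fiberValues (hN : 3 ≤ N) (hα0 : 0 < α) (hV : 0 < V) {t : ℝ}
    (ht : 0 < t) (hM : dilate t u ∈ pohozaevManifold N α V f) :
    IsGreatest (fiberValues α V f u) (energy α V f (dilate t u)) := by
  refine ⟨mem_image_of_mem _ ht, ?_⟩
  rintro _ ⟨τ, hτ, rfl⟩
  have hτ0 : 0 < τ := hτ
  have h1 := energy_dilate_le_of_mem hN hα0 hV hM (t := τ / t) (by positivity)
  have h2 : dilate (τ / t) (dilate t u) = dilate τ u := by
    ext x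
    simp only [dilate, smul_smul]
    congr 2
    field_simp
  rwa [h2] at h1

theorem energy_pos_of_mem (hα0 : 0 < α) (hV : 0 < V) (hu : u ∈ pohozaevManifold N α V f) :
    0 < energy α V f u := by
  rw [energy_eq_reducedEnergy hα0 hu, reducedEnergy]
  have h1 := hu.1.h1Pair.massSq_pos hu.2.1
  have h2 := gradSq_nonneg u
  positivity

end

end

end Choquard

theorem corollary1p2 (N : ℕ) (hN : 3 ≤ N) (α : ℝ) (hα0 : 0 < α) (hαN : α < N)
    (V : ℝ) (hV : 0 < V) (f : ℝ → ℝ)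
    (hF1 : Choquard.CondF1 N α f) (hF2 : Choquard.CondF2 N α f) (hF3 : Choquard.CondF3 f) :
    (∀ w ∈ Choquard.Lam N α f, ∃ c : ℝ, IsGreatest (Choquard.fiberValues α V f w) c) ∧
    ∃ u : Choquard.Space N → ℝ,
      Choquard.IsWeakSolution α V f u ∧
      IsGLB (Choquard.energy α V f '' Choquard.pohozaevManifold N α V f)
        (Choquard.energy α V f u) ∧
      IsGLB {c : ℝ | ∃ w ∈ Choquard.Lam N α f, IsGreatest (Choquard.fiberValues α V f w) c}
        (Choquard.energy α V f u) ∧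
      0 < Choquard.energy α V f u := by
  have hmax : ∀ w ∈ Choquard.Lam N α f, ∃ t, Choquard.dilate t w ∈
      Choquard.pohozaevManifold N α V f ∧ IsGreatest (Choquard.fiberValues α V f w)
        (Choquard.energy α V f (Choquard.dilate t w)) := by
    intro w hw
    obtain ⟨t, ht, hM⟩ := Choquard.exists_dilate_mem hN hα0 hV hw.1.h1Pair hw.2
    exact ⟨t, hM, Choquard.isGreatest_fiberValues hN hα0 hV ht hM⟩
  refine ⟨fun w hw => ?_, ?_⟩
  · obtain ⟨t, -, ht⟩ := hmax w hw
    exact ⟨_, ht⟩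
  obtain ⟨v, hv, hmin⟩ := Choquard.exists_minimizer hN hα0 hαN hV hF1 hF2 hF3
  refine ⟨v, Choquard.isWeakSolution_of_minimizer hN hα0 hαN hV hF1 hv hmin, ?_, ?_,
    Choquard.energy_pos_of_mem hα0 hV hv⟩
  · refine IsLeast.isGLB ⟨Set.mem_image_of_mem _ hv, ?_⟩
    rintro _ ⟨u, hu, rfl⟩
    exact hmin u hu
  -- The minimax value is attained by $v$, which lies in $\Lambda$ and maximises its fibre at $t=1$.
  -- For any other $w$ the fibre maximum is the energy of a point of the manifold.
  · refine IsLeast.isGLB ⟨⟨v, ⟨hv.1, Choquard.nonlocalTerm_pos_of_mem hN hα0 hV hv⟩, ?_⟩, ?_⟩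
    · have h := Choquard.isGreatest_fiberValues hN hα0 hV one_pos
        ((Choquard.dilate_one v).symm ▸ hv)
      rwa [Choquard.dilate_one] at h
    · rintro c ⟨w, hw, hc⟩
      obtain ⟨t, hM, ht⟩ := hmax w hw
      rw [hc.unique ht]
      exact hmin _ hM
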